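/- Let $k$ be an algebraically closed field of characteristic $0$, let $M$ be a nonsingular irreducible algebraic variety over $k$, let $\mathcal L$ be a line bundle on $M$, and let $X\subset M$ be the zero-scheme of a nonzero section $F$ of $\mathcal L$; assume that $X$ is reduced. Let $Y$ be the singularity subscheme of $X$: the zero-scheme in $M$ of the section of the bundle $\mathcal P^1_M\mathcal L$ of first order principal parts determined by $F$ (locally, if $F=f e$ with $e$ a local frame of $\mathcal L$ and $x_1,\dots,x_n$ are local parameters on $M$, the ideal of $Y$ is $(f,\partial f/\partial x_1,\dots,\partial f/\partial x_n)$). Let $\mathcal J_{Y,X}\subset\mathcal O_X$ be the ideal sheaf of $Y$ in $X$ and $B\ell_YX=\mathrm{Proj}\bigl(\bigoplus_{m\ge 0}\mathcal J_{Y,X}^m\bigr)$ the blow-up of $X$ along $Y$. Let $\mathbb P(T^*M)=\mathrm{Proj}(\mathrm{Sym}_{\mathcal O_M}((\Omega^1_M)^\vee))$, whose points are the lines in the fibres of $T^*M$. Let $\mathbb P(T^*_XM)\subset\mathbb P(T^*M)$ be the projectivized conormal space of $X$: the closure, with its reduced structure, of the set of points $[\xi]$ with $\xi$ a nonzero element of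 the kernel of $(T^*M)_x\to(T^*X)_x$ and $x$ a nonsingular point of $X$. Then there is a closed embedding $j:B\ell_YX\to\mathbb P(T^*M|_X)=\mathbb P(T^*M)\times_MX$ over $X$ which is given by $dF$, i.e. over each affine open set on which $F=fe$ with $e$ a local frame of $\mathcal L$, it is induced by the homomorphism of graded algebras $\mathrm{Sym}((\Omega^1_M)^\vee)\to\bigoplus_m\mathcal J_{Y,X}^m$ sending a local section $D$ of $(\Omega^1_M)^\vee$ to $D(df)|_X\in\mathcal J_{Y,X}$ in degree one; and, for this embedding, $$[\mathbb P(T^*_XM)]=[B\ell_YX]$$ as cycles in $\mathbb P(T^*M)$. -/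

import Mathlib

open CategoryTheory AlgebraicGeometry Limits Graded

universe u

namespace ConormalCycle

section ProjBaseChange

variable {A B : Type u} [CommRing A] [CommRing B]
  {σ τ : Type u} [SetLike σ A] [AddSubgroupClass σ A] [SetLike τ B] [AddSubgroupClass τ B]
  {𝒜 : ℕ → σ} {ℬ : ℕ → τ} [GradedRing 𝒜] [GradedRing ℬ]

/-- A homomorphism of graded rings exhibits its target as the localization of its source away from
the degree-zero element `r`. -/
structure IsAwayMap (φ : 𝒜 →+*ᵍ ℬ) (r : A) : Prop where
  mem : r ∈ 𝒜 0
  isUnit : IsUnit (φ r)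
  surj : ∀ b : B, ∃ (n : ℕ) (a : A), φ a = φ r ^ n * b
  exists_of_eq_zero : ∀ a : A, φ a = 0 → ∃ n : ℕ, r ^ n * a = 0

variable {φ : 𝒜 →+*ᵍ ℬ} {r : A}

lemma IsAwayMap.surj_homogeneous (h : IsAwayMap φ r) {d : ℕ} {b : B} (hb : b ∈ ℬ d) :
    ∃ (n : ℕ) (a : A), a ∈ 𝒜 d ∧ φ a = φ r ^ n * b := by
  classical
  obtain ⟨n, a, ha⟩ := h.surj b
  refine ⟨n, DirectSum.decompose 𝒜 a d, SetLike.coe_mem _, ?_⟩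
  have hr : φ r ^ n ∈ ℬ 0 := by
    simpa using map_mem φ (SetLike.pow_mem_graded n h.mem)
  have h2 : φ r ^ n * b ∈ ℬ d := by
    simpa using SetLike.mul_mem_graded hr hb
  rw [GradedRingHom.map_directSumDecompose 𝒜 ℬ φ, ha, DirectSum.decompose_of_mem_same _ h2]

lemma IsAwayMap.irrelevant_le (h : IsAwayMap φ r) :
    HomogeneousIdeal.irrelevant ℬ ≤ (HomogeneousIdeal.irrelevant 𝒜).map φ := by
  rw [HomogeneousIdeal.irrelevant_le]
  intro i hi b hb
  obtain ⟨n, a, ha, hab⟩ := h.surj_homogeneous hb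
  have h1 : φ a ∈ ((HomogeneousIdeal.irrelevant 𝒜).map φ).toIdeal :=
    Ideal.mem_map_of_mem _ (HomogeneousIdeal.mem_irrelevant_of_mem 𝒜 hi ha)
  rw [hab] at h1
  exact (Ideal.unit_mul_mem_iff_mem _ (h.isUnit.pow n)).mp h1

open HomogeneousLocalization in
lemma IsAwayMap.isLocalization_awayMap (h : IsAwayMap φ r) {d : ℕ} {s : A} (hs : s ∈ 𝒜 d) :
    letI := (Away.map φ s).toAlgebra
    IsLocalization.Away (fromZeroRingHom 𝒜 (Submonoid.powers s) ⟨r, h.mem⟩) (Away ℬ (φ s)) := by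
  let := (Away.map φ s).toAlgebra
  have hr : ∀ n, r ^ n ∈ 𝒜 (0 • d) := fun n ↦ by simpa using SetLike.pow_mem_graded n h.mem
  have hpow : ∀ n, fromZeroRingHom 𝒜 (Submonoid.powers s) ⟨r, h.mem⟩ ^ n =
      Away.mk 𝒜 hs 0 (r ^ n) (hr n) := by
    intro n
    ext
    rw [val_pow, Away.val_mk]
    change Localization.mk r 1 ^ n = _
    rw [Localization.mk_pow]
    congr 1
    ext; simp
  have hmap : ∀ x, algebraMap (Away 𝒜 s) (Away ℬ (φ s)) x = Away.map φ s x := fun _ ↦ rfl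
  have hφr : ∀ n, φ r ^ n ∈ ℬ 0 := fun n ↦ by simpa using map_mem φ (SetLike.pow_mem_graded n h.mem)
  rw [IsLocalization.Away, isLocalization_iff]
  refine ⟨?_, ?_, ?_⟩
  · rintro ⟨_, n, rfl⟩
    obtain ⟨b, hb⟩ := h.isUnit
    have hb' : (DirectSum.decompose ℬ (↑b⁻¹ : B) 0 : B) * φ r = 1 := by
      have h1 : DirectSum.decompose ℬ ((↑b⁻¹ : B) * φ r) 0 =
        (DirectSum.decompose ℬ (↑b⁻¹ : B) 0 : B) * φ r :=
        DirectSum.coe_decompose_mul_of_right_mem_zero ℬ (by simpa using hφr 1)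
      rw [← h1, ← hb, Units.inv_mul, DirectSum.decompose_of_mem_same _ SetLike.GradedOne.one_mem]
    simp only
    rw [map_pow]
    refine IsUnit.pow _ ?_
    rw [← pow_one (fromZeroRingHom _ _ _), hpow, hmap, Away.map_mk]
    refine IsUnit.of_mul_eq_one (Away.mk ℬ (map_mem φ hs) 0 (DirectSum.decompose ℬ (↑b⁻¹ : B) 0)
      (by simp)) ?_
    ext
    rw [val_mul, Away.val_mk, Away.val_mk, Localization.mk_mul, val_one, ← Localization.mk_one]
    congr 1
    · rw [mul_comm, pow_one, hb']
    · ext; simp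
  · intro z
    obtain ⟨n, b, hb, rfl⟩ := Away.mk_surjective ℬ (map_mem φ hs) z
    obtain ⟨m, a, ha, hab⟩ := h.surj_homogeneous hb
    refine ⟨⟨Away.mk 𝒜 hs n a ha, ⟨_, m, rfl⟩⟩, ?_⟩
    simp only [hpow, hmap, Away.map_mk]
    ext
    rw [val_mul, Away.val_mk, Away.val_mk, Localization.mk_mul, Away.val_mk]
    congr 1
    · rw [hab, map_pow, mul_comm]
    · ext; simp
  · intro x y hxy
    obtain ⟨z, rfl⟩ : ∃ z, x = y + z := ⟨x - y, by ring⟩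
    have hz : Away.map φ s z = 0 := by simpa [hmap] using hxy
    obtain ⟨n, a, ha, rfl⟩ := Away.mk_surjective 𝒜 hs z
    rw [Away.map_mk] at hz
    have hz' := congrArg val hz
    rw [Away.val_mk, val_zero, Localization.mk_eq_mk', IsLocalization.mk'_eq_zero_iff] at hz'
    obtain ⟨⟨_, m, rfl⟩, hm⟩ := hz'
    simp only [← map_pow, ← map_mul] at hm
    obtain ⟨k, hk⟩ := h.exists_of_eq_zero _ hm
    refine ⟨⟨_, k, rfl⟩, ?_⟩
    simp only [mul_add, add_eq_left, hpow]
    ext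
    rw [val_mul, Away.val_mk, Away.val_mk, Localization.mk_mul, val_zero, Localization.mk_eq_mk',
      IsLocalization.mk'_eq_zero_iff]
    exact ⟨⟨_, m, rfl⟩, by linear_combination hk⟩

lemma IsAwayMap.isPullback_awayι (φ : 𝒜 →+*ᵍ ℬ)
    (hφ : HomogeneousIdeal.irrelevant ℬ ≤ (HomogeneousIdeal.irrelevant 𝒜).map φ)
    {d : ℕ} (hd : 0 < d) {s : A} (hs : s ∈ 𝒜 d) :
    IsPullback (Spec.map (CommRingCat.ofHom (HomogeneousLocalization.Away.map φ s)))
      (Proj.awayι ℬ (φ s) (map_mem φ hs) hd) (Proj.awayι 𝒜 s hs hd) (Proj.map φ hφ) := by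
  refine IsOpenImmersion.isPullback _ _ _ _ (Proj.awayι_comp_map φ hφ hd s hs) ?_
  rw [Proj.opensRange_awayι, Proj.opensRange_awayι, Proj.map_preimage_basicOpen]

lemma IsAwayMap.isOpenImmersion_snd (h : IsAwayMap φ r) {d : ℕ} (hd : 0 < d) {s : A}
    (hs : s ∈ 𝒜 d) :
    IsOpenImmersion (pullback.snd (Proj.map φ h.irrelevant_le) (Proj.awayι 𝒜 s hs hd)) := by
  have hp := IsAwayMap.isPullback_awayι φ h.irrelevant_le hd hs
  have : IsOpenImmersion (Spec.map (CommRingCat.ofHom (HomogeneousLocalization.Away.map φ s))) := by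
    let := (HomogeneousLocalization.Away.map φ s).toAlgebra
    have := h.isLocalization_awayMap hs
    exact IsOpenImmersion.of_isLocalization (R := HomogeneousLocalization.Away 𝒜 s)
      (S := HomogeneousLocalization.Away ℬ (φ s))
      (HomogeneousLocalization.fromZeroRingHom 𝒜 (Submonoid.powers s) ⟨r, h.mem⟩)
  rw [← hp.flip.isoPullback_inv_snd]
  infer_instance

lemma IsAwayMap.isOpenImmersion (h : IsAwayMap φ r) :
    IsOpenImmersion (Proj.map φ h.irrelevant_le) := by
  rw [IsZariskiLocalAtTarget.iff_of_openCover (P := @IsOpenImmersion)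
    (Proj.affineOpenCover 𝒜).openCover]
  rintro ⟨⟨d, hd⟩, ⟨s, hs⟩⟩
  exact h.isOpenImmersion_snd hd hs

end ProjBaseChange

section ProjOver

variable {R A S B : Type u} [CommRing R] [CommRing A] [Algebra R A] [CommRing S] [CommRing B]
  [Algebra S B] (𝒜 : ℕ → Submodule R A) [GradedAlgebra 𝒜] (ℬ : ℕ → Submodule S B) [GradedAlgebra ℬ]

/-- The structure morphism `Proj 𝒜 ⟶ Spec R` of a graded `R`-algebra. -/
noncomputable def projToSpec : Proj 𝒜 ⟶ Spec (.of R) :=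
  Proj.toSpecZero 𝒜 ≫ Spec.map (CommRingCat.ofHom (algebraMap R (𝒜 0)))

variable {𝒜 ℬ}

lemma awayι_projToSpec {d : ℕ} (hd : 0 < d) {s : A} (hs : s ∈ 𝒜 d) :
    Proj.awayι 𝒜 s hs hd ≫ projToSpec 𝒜 = Spec.map (CommRingCat.ofHom
      ((HomogeneousLocalization.fromZeroRingHom 𝒜 (Submonoid.powers s)).comp
        (algebraMap R (𝒜 0)))) := by
  rw [projToSpec, Proj.awayι_toSpecZero_assoc, ← Spec.map_comp]
  rfl

lemma proj_hom_ext {Z : Scheme.{u}} (φ : 𝒜 →+*ᵍ ℬ)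
    (hφ : HomogeneousIdeal.irrelevant ℬ ≤ (HomogeneousIdeal.irrelevant 𝒜).map φ)
    {f g : Proj ℬ ⟶ Z} (H : ∀ (d : ℕ) (hd : 0 < d) (s : A) (hs : s ∈ 𝒜 d),
      Proj.awayι ℬ (φ s) (map_mem φ hs) hd ≫ f = Proj.awayι ℬ (φ s) (map_mem φ hs) hd ≫ g) :
    f = g := by
  refine (Proj.mapAffineOpenCover φ hφ).openCover.hom_ext _ _ ?_
  rintro ⟨⟨d, hd⟩, ⟨s, hs⟩⟩
  exact H d hd s hs

lemma proj_exists_awayι (x : Proj 𝒜) : ∃ (d : ℕ) (hd : 0 < d) (s : A) (hs : s ∈ 𝒜 d)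
    (y : Spec (.of (HomogeneousLocalization.Away 𝒜 s))), Proj.awayι 𝒜 s hs hd y = x := by
  obtain ⟨⟨⟨d, hd⟩, ⟨s, hs⟩⟩, y, hy⟩ := (Proj.affineOpenCover 𝒜).openCover.exists_eq x
  exact ⟨d, hd, s, hs, y, hy⟩

lemma map_projToSpec (ψ : R →+* S) (φ : 𝒜 →+*ᵍ ℬ)
    (hφ : HomogeneousIdeal.irrelevant ℬ ≤ (HomogeneousIdeal.irrelevant 𝒜).map φ)
    (hψ : ∀ r, φ (algebraMap R A r) = algebraMap S B (ψ r)) :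
    Proj.map φ hφ ≫ projToSpec 𝒜 = projToSpec ℬ ≫ Spec.map (CommRingCat.ofHom ψ) := by
  refine proj_hom_ext φ hφ fun d hd s hs ↦ ?_
  rw [Proj.awayι_comp_map_assoc φ hφ hd s hs, awayι_projToSpec, ← Category.assoc,
    awayι_projToSpec, ← Spec.map_comp, ← Spec.map_comp]
  congr 1
  ext r
  change Localization.mk _ _ = Localization.mk _ _
  congr 1
  · exact hψ r
  · ext
    exact map_one φ

theorem isPullback_projToSpec (ψ : R →+* S) (φ : 𝒜 →+*ᵍ ℬ) (r : R)
    (hr : letI := ψ.toAlgebra; IsLocalization.Away r S)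
    (h : IsAwayMap φ (algebraMap R A r))
    (hψ : ∀ r, φ (algebraMap R A r) = algebraMap S B (ψ r)) :
    IsPullback (Proj.map φ h.irrelevant_le) (projToSpec ℬ) (projToSpec 𝒜)
      (Spec.map (CommRingCat.ofHom ψ)) := by
  have := h.isOpenImmersion
  let := ψ.toAlgebra
  have : IsOpenImmersion (Spec.map (CommRingCat.ofHom ψ)) :=
    IsOpenImmersion.of_isLocalization (R := R) (S := S) r
  refine (IsOpenImmersion.isPullback _ _ _ _ (map_projToSpec ψ φ h.irrelevant_le hψ) ?_).flip
  ext x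
  obtain ⟨d, hd, s, hs, y, rfl⟩ := proj_exists_awayι x
  have hp := IsAwayMap.isPullback_awayι φ h.irrelevant_le hd hs
  trans y ∈ PrimeSpectrum.basicOpen
    (HomogeneousLocalization.fromZeroRingHom 𝒜 (Submonoid.powers s) ⟨_, h.mem⟩)
  · have h1 : (Spec.map (CommRingCat.ofHom ψ)).opensRange = PrimeSpectrum.basicOpen r := by
      ext1
      exact PrimeSpectrum.localization_away_comap_range S r
    rw [h1]
    change (Proj.awayι 𝒜 s hs hd ≫ projToSpec 𝒜) y ∈ PrimeSpectrum.basicOpen r ↔ _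
    rw [awayι_projToSpec]
    rfl
  · let := (HomogeneousLocalization.Away.map φ s).toAlgebra
    have := h.isLocalization_awayMap hs
    have h2 := PrimeSpectrum.localization_away_comap_range (HomogeneousLocalization.Away ℬ (φ s))
      (HomogeneousLocalization.fromZeroRingHom 𝒜 (Submonoid.powers s) ⟨_, h.mem⟩)
    refine Iff.trans (Set.ext_iff.mp h2.symm y) ?_
    constructor
    · rintro ⟨z, rfl⟩
      refine ⟨Proj.awayι ℬ (φ s) (map_mem φ hs) hd z, ?_⟩
      exact congr($(hp.w.symm) z)
    · rintro ⟨z, hz⟩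
      obtain ⟨w, hw, -⟩ := Scheme.exists_preimage_of_isPullback hp y z hz.symm
      exact ⟨w, hw⟩

end ProjOver

section RelProj

open Scheme

/-- A graded quasi-coherent algebra on a scheme, given by its sections over the affine open sets. -/
structure GradedQCAlg (X : Scheme.{u}) where
  obj : X.AffineZariskiSite → Type u
  [commRing : ∀ U, CommRing (obj U)]
  [algebra : ∀ U, Algebra Γ(X, U.1) (obj U)]
  deg : ∀ U, ℕ → Submodule Γ(X, U.1) (obj U)
  [graded : ∀ U, GradedAlgebra (deg U)]
  map : ∀ {U V : X.AffineZariskiSite}, U ≤ V → (deg V →+*ᵍ deg U)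
  map_algebraMap : ∀ {U V : X.AffineZariskiSite} (h : U ≤ V) (r : Γ(X, V.1)),
    map h (algebraMap _ _ r) = algebraMap _ _
      ((X.presheaf.map (homOfLE (AffineZariskiSite.toOpens_mono h)).op).hom r)
  map_id : ∀ (U : X.AffineZariskiSite) (a : obj U), map (le_refl U) a = a
  map_map : ∀ {U V W : X.AffineZariskiSite} (h : U ≤ V) (h' : V ≤ W) (a : obj W),
    map h (map h' a) = map (h.trans h') a
  isAwayMap : ∀ {U V : X.AffineZariskiSite} (h : U ≤ V) (f : Γ(X, V.1)), X.basicOpen f = U.1 →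
    IsAwayMap (map h) (algebraMap _ _ f)

namespace GradedQCAlg

variable {X : Scheme.{u}} (𝒮 : GradedQCAlg X)

instance (U : X.AffineZariskiSite) : CommRing (𝒮.obj U) := 𝒮.commRing U
instance (U : X.AffineZariskiSite) : Algebra Γ(X, U.1) (𝒮.obj U) := 𝒮.algebra U
instance (U : X.AffineZariskiSite) : GradedAlgebra (𝒮.deg U) := 𝒮.graded U

lemma irrelevant_le {U V : X.AffineZariskiSite} (h : U ≤ V) :
    HomogeneousIdeal.irrelevant (𝒮.deg U) ≤
      (HomogeneousIdeal.irrelevant (𝒮.deg V)).map (𝒮.map h) :=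
  (𝒮.isAwayMap h h.choose h.choose_spec).irrelevant_le

lemma proj_map_congr {A B σ τ : Type u} [CommRing A] [CommRing B] [SetLike σ A]
    [AddSubgroupClass σ A] [SetLike τ B] [AddSubgroupClass τ B]
    {𝒜 : ℕ → σ} {ℬ : ℕ → τ} [GradedRing 𝒜] [GradedRing ℬ] {φ ψ : 𝒜 →+*ᵍ ℬ} (e : φ = ψ)
    (hφ : HomogeneousIdeal.irrelevant ℬ ≤ (HomogeneousIdeal.irrelevant 𝒜).map φ)
    (hψ : HomogeneousIdeal.irrelevant ℬ ≤ (HomogeneousIdeal.irrelevant 𝒜).map ψ) :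
    Proj.map φ hφ = Proj.map ψ hψ := by
  subst e; rfl

/-- The functor `U ↦ Proj 𝒮(U)` on the affine open sets. -/
noncomputable def projFunctor : X.AffineZariskiSite ⥤ Scheme.{u} where
  obj U := Proj (𝒮.deg U)
  map h := Proj.map (𝒮.map h.le) (𝒮.irrelevant_le h.le)
  map_id U := by
    rw [← Proj.map_id]
    exact proj_map_congr (GradedRingHom.ext (𝒮.map_id U)) _ _
  map_comp {U V W} h h' := by
    rw [← Proj.map_comp]
    exact proj_map_congr (GradedRingHom.ext fun a ↦ (𝒮.map_map h.le h'.le a).symm) _ _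

lemma projFunctor_isPullback {U V : X.AffineZariskiSite} (h : U ⟶ V) :
    IsPullback (𝒮.projFunctor.map h) (projToSpec (𝒮.deg U)) (projToSpec (𝒮.deg V))
      (Spec.map (X.presheaf.map (homOfLE (AffineZariskiSite.toOpens_mono h.le)).op)) := by
  obtain ⟨f, hf⟩ := h.le
  refine isPullback_projToSpec
    (X.presheaf.map (homOfLE (AffineZariskiSite.toOpens_mono h.le)).op).hom (𝒮.map h.le) f ?_
    (𝒮.isAwayMap h.le f hf) (𝒮.map_algebraMap h.le)
  obtain ⟨U, hU⟩ := U
  obtain rfl : X.basicOpen f = U := hf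
  exact V.2.isLocalization_basicOpen f

/-- The structure morphisms `Proj 𝒮(U) ⟶ Spec Γ(X, U)`. -/
noncomputable def projNatTrans : 𝒮.projFunctor ⟶
    AffineZariskiSite.toOpensFunctor X ⋙ X.presheaf.rightOp ⋙ Scheme.Spec where
  app U := projToSpec (𝒮.deg U)
  naturality _ _ h := (𝒮.projFunctor_isPullback h).w

/-- The gluing datum of the relative `Proj`. -/
noncomputable def gluingData : (AffineZariskiSite.directedCover X).RelativeGluingData where
  functor := 𝒮.projFunctor
  natTrans := 𝒮.projNatTrans ≫ (AffineZariskiSite.restrictIsoSpec X).inv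
  equifibered := by
    refine NatTrans.Equifibered.comp ?_ (.of_isIso (AffineZariskiSite.restrictIsoSpec X).inv)
    intro U V h
    exact 𝒮.projFunctor_isPullback h

/-- The relative `Proj` of a graded quasi-coherent algebra. -/
noncomputable def relProj : Scheme.{u} := 𝒮.gluingData.glued

/-- The structure morphism of the relative `Proj`. -/
noncomputable def toBase : 𝒮.relProj ⟶ X := 𝒮.gluingData.toBase

/-- The open immersion of `Proj 𝒮(U)`, as the preimage of `U`, in the relative `Proj`. -/
noncomputable def ι (U : X.AffineZariskiSite) : Proj (𝒮.deg U) ⟶ 𝒮.relProj :=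
  𝒮.gluingData.cover.f U

instance (U : X.AffineZariskiSite) : IsOpenImmersion (𝒮.ι U) :=
  𝒮.gluingData.cover.map_prop U

lemma ι_toBase (U : X.AffineZariskiSite) :
    𝒮.ι U ≫ 𝒮.toBase = projToSpec (𝒮.deg U) ≫ U.2.fromSpec := by
  refine (𝒮.gluingData.ι_toBase U).trans ?_
  exact (Category.assoc _ _ _).trans (congrArg (projToSpec (𝒮.deg U) ≫ ·) rfl)

lemma map_ι {U V : X.AffineZariskiSite} (h : U ≤ V) :
    Proj.map (𝒮.map h) (𝒮.irrelevant_le h) ≫ 𝒮.ι V = 𝒮.ι U :=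
  Scheme.Cover.trans_map 𝒮.gluingData.cover (homOfLE h : U ⟶ V)

end GradedQCAlg

end RelProj

section Rees

open Polynomial

variable {R S : Type u} [CommRing R] [CommRing S]

/-- The degree `n` part `Iⁿtⁿ` of the Rees algebra of `I`. -/
def reesDeg (I : Ideal R) (n : ℕ) : Submodule R (reesAlgebra I) where
  carrier := { p | ∀ m, m ≠ n → (p : R[X]).coeff m = 0 }
  add_mem' hp hq m hm := by simp [hp m hm, hq m hm]
  zero_mem' m _ := by simp
  smul_mem' r p hp m hm := by simp [hp m hm]

lemma mem_reesDeg {I : Ideal R} {n : ℕ} {p : reesAlgebra I} :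
    p ∈ reesDeg I n ↔ ∀ m, m ≠ n → (p : R[X]).coeff m = 0 := Iff.rfl

/-- The element `atⁿ` of the Rees algebra, for `a ∈ Iⁿ`. -/
noncomputable def reesMonomial (I : Ideal R) (n : ℕ) (a : R) (ha : a ∈ I ^ n) : reesAlgebra I :=
  ⟨monomial n a, reesAlgebra.monomial_mem.mpr ha⟩

lemma reesMonomial_mem (I : Ideal R) (n : ℕ) (a : R) (ha : a ∈ I ^ n) :
    reesMonomial I n a ha ∈ reesDeg I n := by
  intro m hm
  simp [reesMonomial, coeff_monomial, hm.symm]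

lemma reesMonomial_add (I : Ideal R) (n : ℕ) (a b : R) (ha : a ∈ I ^ n) (hb : b ∈ I ^ n) :
    reesMonomial I n (a + b) (add_mem ha hb) = reesMonomial I n a ha + reesMonomial I n b hb :=
  Subtype.ext (map_add (monomial n) a b)

lemma sum_reesMonomial {I : Ideal R} (p : reesAlgebra I) :
    ∑ n ∈ (p : R[X]).support, reesMonomial I n ((p : R[X]).coeff n) (p.2 n) = p := by
  apply Subtype.ext
  rw [AddSubmonoidClass.coe_finsetSum]
  exact (as_sum_support (p : R[X])).symm

instance (I : Ideal R) : SetLike.GradedMonoid (reesDeg I) where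
  one_mem m hm := by
    change (1 : R[X]).coeff m = 0
    simp [coeff_one, hm]
  mul_mem := by
    rintro i j p q hp hq m hm
    change ((p : R[X]) * (q : R[X])).coeff m = 0
    rw [coeff_mul]
    refine Finset.sum_eq_zero fun x hx ↦ ?_
    by_cases h1 : x.1 = i
    · by_cases h2 : x.2 = j
      · exact absurd (by rw [← h1, ← h2, Finset.HasAntidiagonal.mem_antidiagonal.mp hx]) hm
      · rw [hq _ h2, mul_zero]
    · rw [hp _ h1, zero_mul]

noncomputable instance (I : Ideal R) : DirectSum.Decomposition (reesDeg I) where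
  decompose' p := ∑ n ∈ (p : R[X]).support, DirectSum.of (fun n ↦ reesDeg I n) n
    ⟨reesMonomial I n ((p : R[X]).coeff n) (p.2 n), reesMonomial_mem I n _ _⟩
  left_inv p := by
    rw [map_sum]
    simp only [DirectSum.coeAddMonoidHom_of]
    exact sum_reesMonomial p
  right_inv x := by
    have key (p : reesAlgebra I) (s : Finset ℕ) (hs : (p : R[X]).support ⊆ s) :
        ∑ n ∈ (p : R[X]).support, DirectSum.of (fun n ↦ reesDeg I n) n
          ⟨reesMonomial I n ((p : R[X]).coeff n) (p.2 n), reesMonomial_mem I n _ _⟩ =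
        ∑ n ∈ s, DirectSum.of (fun n ↦ reesDeg I n) n
          ⟨reesMonomial I n ((p : R[X]).coeff n) (p.2 n), reesMonomial_mem I n _ _⟩ := by
      refine Finset.sum_subset hs fun n _ hn ↦ ?_
      have h0 : (p : R[X]).coeff n = 0 := notMem_support_iff.mp hn
      have : (⟨reesMonomial I n ((p : R[X]).coeff n) (p.2 n), reesMonomial_mem I n _ _⟩ :
          reesDeg I n) = 0 := by
        apply Subtype.ext; apply Subtype.ext
        simp [reesMonomial, h0]
      rw [this, map_zero]
    induction x using DirectSum.induction_on with
    | zero => simp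
    | of n p =>
      rw [DirectSum.coeAddMonoidHom_of]
      have hsub : ((p : reesAlgebra I) : R[X]).support ⊆ {n} := by
        intro m hm
        by_contra h
        exact mem_support_iff.mp hm (p.2 m (by simpa using h))
      refine (key _ _ hsub).trans ?_
      rw [Finset.sum_singleton]
      congr 1
      apply Subtype.ext; apply Subtype.ext
      ext m
      by_cases h : m = n
      · subst h; simp [reesMonomial]
      · simp [reesMonomial, coeff_monomial, Ne.symm h, p.2 m h]
    | add x y hx hy =>
      classical
      rw [map_add]
      set p := DirectSum.coeAddMonoidHom (reesDeg I) x
      set q := DirectSum.coeAddMonoidHom (reesDeg I) y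
      conv_rhs => rw [← hx, ← hy]
      refine (key (p + q) ((p : R[X]).support ∪ (q : R[X]).support) support_add).trans ?_
      refine Eq.trans ?_ (congrArg₂ (· + ·)
        (key p ((p : R[X]).support ∪ (q : R[X]).support) Finset.subset_union_left)
        (key q ((p : R[X]).support ∪ (q : R[X]).support) Finset.subset_union_right)).symm
      rw [← Finset.sum_add_distrib]
      refine Finset.sum_congr rfl fun n _ ↦ ?_
      refine Eq.trans ?_ (map_add (DirectSum.of (fun n ↦ reesDeg I n) n) _ _)
      refine congrArg (DirectSum.of (fun n ↦ reesDeg I n) n) ?_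
      apply Subtype.ext; apply Subtype.ext
      simp [reesMonomial, p, q]

noncomputable instance (I : Ideal R) : GradedAlgebra (reesDeg I) where

/-- The homomorphism of Rees algebras induced by a ring homomorphism. -/
noncomputable def reesMap (ψ : R →+* S) (I : Ideal R) (J : Ideal S) (h : I.map ψ ≤ J) :
    reesDeg I →+*ᵍ reesDeg J where
  toRingHom := ((mapRingHom ψ).comp (reesAlgebra I).val.toRingHom).codRestrict
    (reesAlgebra J) fun p n ↦ by
      change (Polynomial.map ψ (p : R[X])).coeff n ∈ J ^ n
      rw [coeff_map]
      refine Ideal.pow_right_mono h n ?_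
      rw [← Ideal.map_pow]
      exact Ideal.mem_map_of_mem _ (p.2 n)
  map_mem {n p} hp m hm := by
    change (Polynomial.map ψ (p : R[X])).coeff m = 0
    rw [coeff_map, hp m hm, map_zero]

lemma coe_reesMap (ψ : R →+* S) (I : Ideal R) (J : Ideal S) (h : I.map ψ ≤ J)
    (p : reesAlgebra I) : (reesMap ψ I J h p : S[X]) = Polynomial.map ψ (p : R[X]) := rfl

lemma isAwayMap_reesMap (ψ : R →+* S) (I : Ideal R) (J : Ideal S) (h : I.map ψ = J) (r : R)
    (hr : letI := ψ.toAlgebra; IsLocalization.Away r S) :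
    IsAwayMap (reesMap ψ I J h.le) (algebraMap R (reesAlgebra I) r) := by
  let := ψ.toAlgebra
  have hψ : ψ = algebraMap R S := rfl
  have hmap : reesMap ψ I J h.le (algebraMap R (reesAlgebra I) r) =
      algebraMap S (reesAlgebra J) (ψ r) := by
    apply Subtype.ext
    rw [coe_reesMap]
    exact Polynomial.map_C ψ
  refine ⟨SetLike.algebraMap_mem_graded _ _, ?_, fun b ↦ ?_, fun a ha ↦ ?_⟩
  · rw [hmap]
    exact (IsLocalization.Away.algebraMap_isUnit (S := S) r).map _
  · rw [hmap]
    rw [← sum_reesMonomial b]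
    induction (b : S[X]).support using Finset.induction_on with
    | empty => exact ⟨0, 0, by simp⟩
    | insert n s hn ih =>
      obtain ⟨m, a, ha⟩ := ih
      have hb : (b : S[X]).coeff n ∈ (I ^ n).map ψ := by
        rw [Ideal.map_pow, h]
        exact b.2 n
      rw [hψ,
        IsLocalization.mem_map_algebraMap_iff (Submonoid.powers r) S] at hb
      obtain ⟨⟨⟨c, hc⟩, ⟨_, l, rfl⟩⟩, hcl⟩ := hb
      have hc' : reesMap ψ I J h.le (reesMonomial I n c hc) =
          algebraMap S (reesAlgebra J) (ψ r) ^ l * reesMonomial J n ((b : S[X]).coeff n) (b.2 n) := by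
        apply Subtype.ext
        rw [coe_reesMap, ← map_pow, ← Algebra.smul_def]
        change Polynomial.map ψ (monomial n c) = ψ r ^ l • monomial n ((b : S[X]).coeff n)
        rw [Polynomial.map_monomial, Polynomial.smul_monomial, smul_eq_mul, hψ, ← hcl]
        simp [mul_comm]
      refine ⟨l + m, algebraMap R _ r ^ m * reesMonomial I n c hc + algebraMap R _ r ^ l * a, ?_⟩
      rw [Finset.sum_insert hn, map_add, map_mul, map_mul, map_pow, map_pow, hmap, ha, hc']
      ring
  · have hcoeff (n : ℕ) : ψ ((a : R[X]).coeff n) = 0 := by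
      rw [← coeff_map, ← coe_reesMap ψ I J h.le, ha]; simp
    have hex (n : ℕ) : ∃ l, r ^ l * (a : R[X]).coeff n = 0 := by
      obtain ⟨⟨_, l, rfl⟩, hl⟩ :=
        (IsLocalization.map_eq_zero_iff (Submonoid.powers r) S _).mp (hcoeff n)
      exact ⟨l, hl⟩
    choose l hl using hex
    refine ⟨∑ n ∈ (a : R[X]).support, l n, ?_⟩
    rw [← map_pow, ← Algebra.smul_def]
    apply Subtype.ext
    change r ^ _ • (a : R[X]) = 0
    ext n
    rw [coeff_smul, smul_eq_mul, coeff_zero]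
    by_cases hn : n ∈ (a : R[X]).support
    · rw [← Finset.add_sum_erase _ _ hn, add_comm, pow_add, mul_assoc, hl, mul_zero]
    · rw [notMem_support_iff.mp hn, mul_zero]

open Scheme

/-- The Rees algebra of an ideal sheaf. -/
noncomputable def rees (X : Scheme.{u}) (𝒥 : X.IdealSheafData) : GradedQCAlg X where
  obj U := reesAlgebra (𝒥.ideal ⟨U.1, U.2⟩)
  deg U := reesDeg (𝒥.ideal ⟨U.1, U.2⟩)
  map {U V} h := reesMap (X.presheaf.map (homOfLE (AffineZariskiSite.toOpens_mono h)).op).hom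
    (𝒥.ideal ⟨V.1, V.2⟩) (𝒥.ideal ⟨U.1, U.2⟩)
    (𝒥.map_ideal (U := ⟨U.1, U.2⟩) (V := ⟨V.1, V.2⟩) (AffineZariskiSite.toOpens_mono h)).le
  map_algebraMap h r := Subtype.ext (Polynomial.map_C _)
  map_id U a := by
    apply Subtype.ext
    refine (coe_reesMap _ _ _ _ a).trans ?_
    rw [show (X.presheaf.map (homOfLE (AffineZariskiSite.toOpens_mono (le_refl U))).op).hom =
      RingHom.id _ from congrArg CommRingCat.Hom.hom (X.presheaf.map_id (.op U.1))]
    exact Polynomial.map_id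
  map_map {U V W} h h' a := by
    apply Subtype.ext
    refine (Polynomial.map_map _ _ _).trans ?_
    exact congrArg (fun φ ↦ Polynomial.map φ (a : Γ(X, W.1)[X])) (congrArg CommRingCat.Hom.hom
      (X.presheaf.map_comp (homOfLE (AffineZariskiSite.toOpens_mono h')).op
      (homOfLE (AffineZariskiSite.toOpens_mono h)).op).symm)
  isAwayMap {U V} h f hf := by
    refine isAwayMap_reesMap _ _ _ (𝒥.map_ideal (U := ⟨U.1, U.2⟩) (V := ⟨V.1, V.2⟩) _) f ?_
    obtain ⟨U, hU⟩ := U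
    obtain rfl : X.basicOpen f = U := hf
    exact V.2.isLocalization_basicOpen f

/-- The blow-up of a scheme along the closed subscheme defined by an ideal sheaf. -/
noncomputable def blowup (X : Scheme.{u}) (𝒥 : X.IdealSheafData) : Scheme.{u} :=
  (rees X 𝒥).relProj

end Rees

section Sym

open scoped DirectSum

variable (A : Type u) [CommRing A] (N : Type u) [AddCommGroup N] [Module A N]

/-- The degree `n` part of the symmetric algebra. -/
def symDeg (n : ℕ) : Submodule A (SymmetricAlgebra A N) :=
  LinearMap.range (SymmetricAlgebra.ι A N) ^ n

lemma ι_mem_symDeg (x : N) : SymmetricAlgebra.ι A N x ∈ symDeg A N 1 := by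
  rw [symDeg, pow_one]
  exact LinearMap.mem_range_self _ x

instance : SetLike.GradedMonoid (symDeg A N) where
  one_mem := Submodule.one_le.mp (pow_zero _).ge
  mul_mem _ _ _ _ hx hy := by
    rw [symDeg, pow_add]
    exact Submodule.mul_mem_mul hx hy

/-- The canonical map to the degree one part. -/
noncomputable def symι : N →ₗ[A] ⨁ n, symDeg A N n :=
  DirectSum.lof A ℕ (fun n ↦ symDeg A N n) 1 ∘ₗ
    (SymmetricAlgebra.ι A N).codRestrict _ (ι_mem_symDeg A N)

lemma symι_apply (x : N) : symι A N x =
    DirectSum.of (fun n ↦ symDeg A N n) 1 ⟨SymmetricAlgebra.ι A N x, ι_mem_symDeg A N x⟩ := rfl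

noncomputable instance : GradedAlgebra (symDeg A N) :=
  GradedAlgebra.ofAlgHom _ (SymmetricAlgebra.lift (symι A N))
    (by
      ext x
      change DirectSum.coeAlgHom (symDeg A N) (SymmetricAlgebra.lift (symι A N)
        (SymmetricAlgebra.ι A N x)) = SymmetricAlgebra.ι A N x
      rw [SymmetricAlgebra.lift_ι_apply, symι_apply, DirectSum.coeAlgHom_of])
    fun i x ↦ by
      obtain ⟨x, hx⟩ := x
      dsimp only [DirectSum.lof_eq_of]
      unfold symDeg at hx
      induction hx using Submodule.pow_induction_on_left' with
      | algebraMap r =>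
        rw [AlgHom.commutes, DirectSum.algebraMap_apply]; rfl
      | add x y i hx hy ihx ihy =>
        rw [map_add, ihx, ihy, ← map_add]
        rfl
      | mem_mul m hm i x hx ih =>
        obtain ⟨_, rfl⟩ := hm
        rw [map_mul, ih, SymmetricAlgebra.lift_ι_apply, symι_apply, DirectSum.of_mul_of]
        exact DirectSum.of_eq_of_gradedMonoid_eq (Sigma.subtype_ext (add_comm _ _) rfl)

variable {A N}

lemma sym_ringHom_ext {T : Type u} [CommRing T] {f g : SymmetricAlgebra A N →+* T}
    (h0 : ∀ a, f (algebraMap A (SymmetricAlgebra A N) a) = g (algebraMap A (SymmetricAlgebra A N) a))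
    (h1 : ∀ x, f (SymmetricAlgebra.ι A N x) = g (SymmetricAlgebra.ι A N x)) : f = g := by
  refine RingHom.ext fun a ↦ ?_
  induction a using SymmetricAlgebra.induction with
  | algebraMap r => exact h0 r
  | ι x => exact h1 x
  | mul a b ha hb => rw [map_mul, map_mul, ha, hb]
  | add a b ha hb => rw [map_add, map_add, ha, hb]

/-- The homomorphism from a symmetric algebra to a ring given by a ring homomorphism on scalars and
an additive map in degree one. -/
noncomputable def symLiftHom {T : Type u} [CommRing T] (ψ : A →+* T) (g : N →+ T)
    (hs : ∀ a x, g (a • x) = ψ a * g x) : SymmetricAlgebra A N →+* T :=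
  letI := ψ.toAlgebra
  (SymmetricAlgebra.lift
    { g with map_smul' := fun a x ↦ (hs a x).trans (Algebra.smul_def a (g x)).symm } :
      SymmetricAlgebra A N →ₐ[A] T).toRingHom

lemma symLiftHom_algebraMap {T : Type u} [CommRing T] (ψ : A →+* T) (g : N →+ T)
    (hs : ∀ a x, g (a • x) = ψ a * g x) (a : A) :
    symLiftHom ψ g hs (algebraMap A (SymmetricAlgebra A N) a) = ψ a :=
  letI := ψ.toAlgebra
  AlgHom.commutes (SymmetricAlgebra.lift _ : SymmetricAlgebra A N →ₐ[A] T) a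

lemma symLiftHom_ι {T : Type u} [CommRing T] (ψ : A →+* T) (g : N →+ T)
    (hs : ∀ a x, g (a • x) = ψ a * g x) (x : N) :
    symLiftHom ψ g hs (SymmetricAlgebra.ι A N x) = g x :=
  letI := ψ.toAlgebra
  SymmetricAlgebra.lift_ι_apply _ x

/-- The graded homomorphism from a symmetric algebra to a graded ring given by a ring homomorphism
in degree zero and an additive map in degree one. -/
noncomputable def symLift {T τ : Type u} [CommRing T] [SetLike τ T] [AddSubgroupClass τ T]
    (𝒯 : ℕ → τ) [GradedRing 𝒯] (ψ : A →+* T) (g : N →+ T)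
    (hs : ∀ a x, g (a • x) = ψ a * g x) (hψ : ∀ a, ψ a ∈ 𝒯 0) (hg : ∀ x, g x ∈ 𝒯 1) :
    symDeg A N →+*ᵍ 𝒯 where
  toRingHom := symLiftHom ψ g hs
  map_mem {n a} ha := by
    change symLiftHom ψ g hs a ∈ 𝒯 n
    unfold symDeg at ha
    induction ha using Submodule.pow_induction_on_left' with
    | algebraMap r => rw [symLiftHom_algebraMap]; exact hψ r
    | add x y i hx hy ihx ihy => rw [map_add]; exact add_mem ihx ihy
    | mem_mul m hm i x hx ih =>
      obtain ⟨y, rfl⟩ := hm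
      rw [Nat.succ_eq_add_one, add_comm, map_mul, symLiftHom_ι]
      exact SetLike.mul_mem_graded (hg y) ih

section

variable {T τ : Type u} [CommRing T] [SetLike τ T] [AddSubgroupClass τ T]
  (𝒯 : ℕ → τ) [GradedRing 𝒯] (ψ : A →+* T) (g : N →+ T)
  (hs : ∀ a x, g (a • x) = ψ a * g x) (hψ : ∀ a, ψ a ∈ 𝒯 0) (hg : ∀ x, g x ∈ 𝒯 1)

lemma symLift_algebraMap (a : A) :
    symLift 𝒯 ψ g hs hψ hg (algebraMap A (SymmetricAlgebra A N) a) = ψ a :=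
  symLiftHom_algebraMap ψ g hs a

lemma symLift_ι (x : N) : symLift 𝒯 ψ g hs hψ hg (SymmetricAlgebra.ι A N x) = g x :=
  symLiftHom_ι ψ g hs x

end

variable {B : Type u} [CommRing B] {N' : Type u} [AddCommGroup N'] [Module B N']

/-- The homomorphism of symmetric algebras induced by a semilinear map. -/
noncomputable def symMap (ψ : A →+* B) (g : N →ₛₗ[ψ] N') : symDeg A N →+*ᵍ symDeg B N' :=
  symLift (symDeg B N') ((algebraMap B (SymmetricAlgebra B N')).comp ψ)
    ((SymmetricAlgebra.ι B N').toAddMonoidHom.comp g.toAddMonoidHom)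
    (fun a x ↦ by
      change SymmetricAlgebra.ι B N' (g (a • x)) = _ * SymmetricAlgebra.ι B N' (g x)
      rw [map_smulₛₗ, map_smul, Algebra.smul_def]; rfl)
    (fun a ↦ SetLike.algebraMap_mem_graded _ _) (fun x ↦ ι_mem_symDeg _ _ _)

lemma symMap_algebraMap (ψ : A →+* B) (g : N →ₛₗ[ψ] N') (a : A) :
    symMap ψ g (algebraMap A (SymmetricAlgebra A N) a) = algebraMap B _ (ψ a) :=
  symLift_algebraMap ..

lemma symMap_ι (ψ : A →+* B) (g : N →ₛₗ[ψ] N') (x : N) :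
    symMap ψ g (SymmetricAlgebra.ι A N x) = SymmetricAlgebra.ι B N' (g x) :=
  symLift_ι ..

lemma isAwayMap_symMap (ψ : A →+* B) (g : N →ₛₗ[ψ] N') (r : A)
    (hr : letI := ψ.toAlgebra; IsLocalization.Away r B)
    (hsurj : ∀ y : N', ∃ (n : ℕ) (x : N), g x = ψ r ^ n • y)
    (hzero : ∀ x : N, g x = 0 → ∃ n : ℕ, r ^ n • x = 0) :
    IsAwayMap (symMap ψ g) (algebraMap A (SymmetricAlgebra A N) r) := by
  let := ψ.toAlgebra
  have hu : IsUnit (ψ r) := IsLocalization.Away.algebraMap_isUnit (S := B) r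
  let T := Localization.Away (algebraMap A (SymmetricAlgebra A N) r)
  let c : SymmetricAlgebra A N →+* T := algebraMap _ T
  have hcu : IsUnit (c (algebraMap A _ r)) := IsLocalization.Away.algebraMap_isUnit _
  let ψ' : B →+* T := IsLocalization.Away.lift (S := B) r (g := c.comp (algebraMap A _)) hcu
  have hψ' : ∀ a, ψ' (ψ a) = c (algebraMap A _ a) :=
    IsLocalization.Away.lift_eq (S := B) r (g := c.comp (algebraMap A _)) hcu
  have hg0 : ∀ x, g x = 0 → c (SymmetricAlgebra.ι A N x) = 0 := by
    intro x hx
    obtain ⟨n, hn⟩ := hzero x hx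
    have := congrArg (fun z ↦ c (SymmetricAlgebra.ι A N z)) hn
    simp only [map_smul, Algebra.smul_def, map_mul, map_pow, map_zero] at this
    exact ((hcu.pow n).mul_right_eq_zero).mp this
  have hgc : ∀ x x', g x = g x' → c (SymmetricAlgebra.ι A N x) = c (SymmetricAlgebra.ι A N x') := by
    intro x x' h
    rw [← sub_eq_zero, ← map_sub, ← map_sub]
    exact hg0 _ (by rw [map_sub, h, sub_self])
  -- every semilinear extension is determined by its values on the image of `g`
  have hex : ∀ y : N', ∃ t : T, ∀ (b : A) (x : N), g x = ψ b • y →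
      c (SymmetricAlgebra.ι A N x) = c (algebraMap A _ b) * t := by
    intro y
    obtain ⟨n, x, hx⟩ := hsurj y
    refine ⟨((hcu.pow n).unit⁻¹ : Tˣ) * c (SymmetricAlgebra.ι A N x), fun b x' hx' ↦ ?_⟩
    have h1 : g (r ^ n • x') = g (b • x) := by
      rw [map_smulₛₗ, map_smulₛₗ, hx, hx', smul_smul, smul_smul, map_pow, mul_comm]
    have h2 := hgc _ _ h1
    simp only [map_smul, Algebra.smul_def, map_mul, map_pow] at h2
    refine (hcu.pow n).mul_left_cancel ?_
    rw [h2]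
    have h3 := (hcu.pow n).mul_val_inv
    linear_combination (-(c (algebraMap A _ b) * c (SymmetricAlgebra.ι A N x))) * h3
  choose t ht using hex
  have huniq : ∀ (y : N') (s : T), (∃ (n : ℕ) (x : N), g x = ψ r ^ n • y ∧
      c (SymmetricAlgebra.ι A N x) = c (algebraMap A _ r) ^ n * s) → s = t y := by
    rintro y s ⟨n, x, hx, hs⟩
    refine (hcu.pow n).mul_left_cancel ?_
    rw [← hs, ht y (r ^ n) x (by rw [map_pow, hx]), map_pow, map_pow]
  have htsmul : ∀ (b : B) (y : N'), t (b • y) = ψ' b * t y := by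
    intro b y
    obtain ⟨⟨a, ⟨_, m, rfl⟩⟩, hma⟩ := IsLocalization.surj (Submonoid.powers r) b
    replace hma : b * ψ r ^ m = ψ a := by rw [← map_pow]; exact hma
    obtain ⟨n, x, hx⟩ := hsurj y
    refine (huniq _ _ ⟨n + m, a • x, ?_, ?_⟩).symm
    · rw [map_smulₛₗ, hx, ← hma, smul_smul, smul_smul]
      congr 1
      ring
    · have h1 := ht y (r ^ n) x (by rw [map_pow, hx])
      have h2 := hψ' a
      rw [← hma, map_mul, map_pow, hψ'] at h2
      rw [map_smul, Algebra.smul_def, map_mul, h1, ← h2, map_pow, map_pow]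
      ring
  have htadd : ∀ y y', t (y + y') = t y + t y' := by
    intro y y'
    obtain ⟨n, x, hx⟩ := hsurj y
    obtain ⟨n', x', hx'⟩ := hsurj y'
    refine (huniq _ _ ⟨n + n', r ^ n' • x + r ^ n • x', ?_, ?_⟩).symm
    · rw [map_add, map_smulₛₗ, map_smulₛₗ, hx, hx', map_pow, map_pow, smul_smul, smul_smul, smul_add]
      congr 2 <;> ring
    · have h1 := ht y (r ^ n) x (by rw [map_pow, hx])
      have h2 := ht y' (r ^ n') x' (by rw [map_pow, hx'])
      simp only [map_add, map_smul, Algebra.smul_def, map_mul, h1, h2, map_pow]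
      ring
  let F : SymmetricAlgebra B N' →+* T := symLiftHom ψ' (AddMonoidHom.mk' t htadd) htsmul
  have hF : ∀ a, F (symMap ψ g a) = c a := by
    intro a
    have : F.comp (symMap ψ g).toRingHom = c := by
      refine sym_ringHom_ext (fun a ↦ ?_) (fun x ↦ ?_)
      · change F (symMap ψ g (algebraMap A _ a)) = _
        rw [symMap_algebraMap, ← hψ']
        exact symLiftHom_algebraMap ..
      · change F (symMap ψ g (SymmetricAlgebra.ι A N x)) = _
        rw [symMap_ι]
        refine (symLiftHom_ι ..).trans ?_
        change t (g x) = _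
        rw [ht (g x) 1 x (by simp)]
        simp
    exact congr($this a)
  refine ⟨SetLike.algebraMap_mem_graded _ _, ?_, fun b ↦ ?_, fun a ha ↦ ?_⟩
  · rw [symMap_algebraMap]
    exact hu.map _
  · rw [symMap_algebraMap]
    induction b using SymmetricAlgebra.induction with
    | algebraMap b =>
      obtain ⟨⟨a, ⟨_, n, rfl⟩⟩, h⟩ := IsLocalization.surj (Submonoid.powers r) b
      refine ⟨n, algebraMap A _ a, ?_⟩
      rw [symMap_algebraMap, ← map_pow, ← map_mul, ← map_pow, mul_comm]
      exact congrArg _ h.symm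
    | ι y =>
      obtain ⟨n, x, hx⟩ := hsurj y
      refine ⟨n, SymmetricAlgebra.ι A N x, ?_⟩
      rw [symMap_ι, hx, map_smul, Algebra.smul_def, map_pow]
    | mul b b' hb hb' =>
      obtain ⟨n, a, ha⟩ := hb
      obtain ⟨n', a', ha'⟩ := hb'
      exact ⟨n + n', a * a', by rw [map_mul, ha, ha']; ring⟩
    | add b b' hb hb' =>
      obtain ⟨n, a, ha⟩ := hb
      obtain ⟨n', a', ha'⟩ := hb'
      refine ⟨n + n', algebraMap A _ r ^ n' * a + algebraMap A _ r ^ n * a', ?_⟩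
      rw [map_add, map_mul, map_mul, map_pow, map_pow, ha, ha', symMap_algebraMap]
      ring
  · have h0 : c a = 0 := by rw [← hF, ha, map_zero]
    obtain ⟨⟨_, n, rfl⟩, hn⟩ :=
      (IsLocalization.map_eq_zero_iff (Submonoid.powers (algebraMap A _ r)) T a).mp h0
    exact ⟨n, hn⟩

end Sym

section Tangent

open scoped TensorProduct
open KaehlerDifferential

variable {k A B C : Type u} [CommRing k] [CommRing A] [CommRing B] [CommRing C]
  [Algebra k A] [Algebra k B] [Algebra k C]

variable (k A) in
/-- The module dual to the module of differentials. -/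
abbrev Tangent : Type u := Module.Dual A Ω[A⁄k]

lemma tangent_ext (ψ : A →ₐ[k] B) (h : ψ.toRingHom.FormallyEtale) {D D' : Tangent k B}
    (hD : ∀ a, D (KaehlerDifferential.D k B (ψ a)) = D' (KaehlerDifferential.D k B (ψ a))) :
    D = D' := by
  let := ψ.toRingHom.toAlgebra
  have : IsScalarTower k A B := .of_algebraMap_eq fun x ↦ (ψ.commutes x).symm
  have : Algebra.FormallyEtale A B := h
  let e := tensorKaehlerEquivOfFormallyEtale k A B
  suffices D ∘ₗ e.toLinearMap = D' ∘ₗ e.toLinearMap by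
    ext x
    obtain ⟨y, hy⟩ := e.surjective (KaehlerDifferential.D k B x)
    have := congr($this y)
    rw [LinearMap.comp_apply, LinearMap.comp_apply, LinearEquiv.coe_coe, hy] at this
    exact this
  refine TensorProduct.AlgebraTensorModule.curry_injective ?_
  refine LinearMap.ext_ring ?_
  refine LinearMap.ext_on_range (v := KaehlerDifferential.D k A) (span_range_derivation k A)
    fun a ↦ ?_
  have he : e (1 ⊗ₜ KaehlerDifferential.D k A a) = KaehlerDifferential.D k B (ψ a) := by
    rw [← e.symm_apply_eq.mp (tensorKaehlerEquivOfFormallyEtale_symm_D_algebraMap k A B a)]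
    rfl
  change D (e (1 ⊗ₜ _)) = D' (e (1 ⊗ₜ _))
  rw [he, hD]

/-- The restriction of vector fields along a formally étale homomorphism: `D` is sent to the unique
`D'` with `D' (d (ψ a)) = ψ (D (d a))`. -/
noncomputable def tangentRes (ψ : A →ₐ[k] B) (h : ψ.toRingHom.FormallyEtale) :
    Tangent k A →ₛₗ[ψ.toRingHom] Tangent k B :=
  letI := ψ.toRingHom.toAlgebra
  haveI : IsScalarTower k A B := .of_algebraMap_eq fun x ↦ (ψ.commutes x).symm
  haveI : Algebra.FormallyEtale A B := h
  { toFun D := Module.Dual.baseChange B D ∘ₗ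
      (tensorKaehlerEquivOfFormallyEtale k A B).symm.toLinearMap
    map_add' D D' := by
      rw [map_add, LinearMap.add_comp]
    map_smul' a D := by
      rw [map_smul]
      ext x
      exact Algebra.smul_def a _ }

lemma tangentRes_apply (ψ : A →ₐ[k] B) (h : ψ.toRingHom.FormallyEtale) (D : Tangent k A) (a : A) :
    tangentRes ψ h D (KaehlerDifferential.D k B (ψ a)) = ψ (D (KaehlerDifferential.D k A a)) := by
  let := ψ.toRingHom.toAlgebra
  have : IsScalarTower k A B := .of_algebraMap_eq fun x ↦ (ψ.commutes x).symm
  have : Algebra.FormallyEtale A B := h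
  change Module.Dual.baseChange B D ((tensorKaehlerEquivOfFormallyEtale k A B).symm
      (KaehlerDifferential.D k B (algebraMap A B a))) = _
  rw [tensorKaehlerEquivOfFormallyEtale_symm_D_algebraMap, Module.Dual.baseChange_apply_tmul,
    Algebra.smul_def, mul_one]
  rfl

lemma tangentRes_id (ψ : A →ₐ[k] A) (h : ψ.toRingHom.FormallyEtale) (hψ : ∀ a, ψ a = a)
    (D : Tangent k A) : tangentRes ψ h D = D := by
  refine tangent_ext ψ h fun a ↦ ?_
  rw [tangentRes_apply, hψ, hψ]

lemma tangentRes_comp (ψ : A →ₐ[k] B) (h : ψ.toRingHom.FormallyEtale)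
    (ψ' : B →ₐ[k] C) (h' : ψ'.toRingHom.FormallyEtale)
    (ψ'' : A →ₐ[k] C) (h'' : ψ''.toRingHom.FormallyEtale) (hψ : ∀ a, ψ' (ψ a) = ψ'' a)
    (D : Tangent k A) : tangentRes ψ' h' (tangentRes ψ h D) = tangentRes ψ'' h'' D := by
  refine tangent_ext ψ'' h'' fun a ↦ ?_
  rw [tangentRes_apply ψ'' h'', ← hψ, ← hψ, tangentRes_apply, tangentRes_apply]

lemma formallyEtale_of_away (ψ : A →+* B) (r : A)
    (hr : letI := ψ.toAlgebra; IsLocalization.Away r B) : ψ.FormallyEtale := by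
  let := ψ.toAlgebra
  exact Algebra.FormallyEtale.of_isLocalization (Rₘ := B) (Submonoid.powers r)

lemma isLocalizedModule_tangentRes (ψ : A →ₐ[k] B) (h : ψ.toRingHom.FormallyEtale) (r : A)
    [Module.FinitePresentation A Ω[A⁄k]]
    (hr : letI := ψ.toRingHom.toAlgebra; IsLocalization.Away r B) :
    (∀ D' : Tangent k B, ∃ (n : ℕ) (D : Tangent k A), tangentRes ψ h D = ψ r ^ n • D') ∧
    ∀ D : Tangent k A, tangentRes ψ h D = 0 → ∃ n : ℕ, r ^ n • D = 0 := by
  let := ψ.toRingHom.toAlgebra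
  have : IsScalarTower k A B := .of_algebraMap_eq fun x ↦ (ψ.commutes x).symm
  have hloc : IsLocalizedModule (Submonoid.powers r) (Algebra.linearMap A B) := inferInstance
  let g := IsLocalizedModule.mapExtendScalars (Submonoid.powers r) (KaehlerDifferential.map k k A B)
    (Algebra.linearMap A B) B
  have hg : ∀ D, g D = tangentRes ψ h D := by
    intro D
    refine tangent_ext ψ h fun a ↦ ?_
    rw [tangentRes_apply]
    have := IsLocalizedModule.map_apply (Submonoid.powers r) (KaehlerDifferential.map k k A B)
      (Algebra.linearMap A B) D (KaehlerDifferential.D k A a)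
    rw [KaehlerDifferential.map_D] at this
    exact this
  have hgl : IsLocalizedModule (Submonoid.powers r) g := inferInstance
  refine ⟨fun D' ↦ ?_, fun D hD ↦ ?_⟩
  · obtain ⟨⟨D, ⟨_, n, rfl⟩⟩, hD⟩ := hgl.surj D'
    refine ⟨n, D, ?_⟩
    rw [← hg, ← hD]
    change r ^ n • D' = _
    rw [← algebraMap_smul B (r ^ n) D', map_pow]
    rfl
  · rw [← hg] at hD
    obtain ⟨⟨_, n, rfl⟩, hn⟩ := (IsLocalizedModule.eq_zero_iff (Submonoid.powers r) g).mp hD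
    exact ⟨n, hn⟩

end Tangent

section Cotangent

open Scheme

/-- The ring of functions on an open set of a scheme over `k` is a `k`-algebra. -/
noncomputable instance sectionsAlgebra (k : Type u) [CommRing k] (M : Scheme.{u})
    [M.Over (Spec (.of k))] (U : M.Opens) : Algebra k Γ(M, U) :=
  ((ΓSpecIso (.of k)).inv ≫ (M ↘ Spec (.of k)).appLE ⊤ U (by simp)).hom.toAlgebra

/-- Restriction of functions, as a homomorphism of `k`-algebras. -/
noncomputable def resHom (k : Type u) [CommRing k] {M : Scheme.{u}} [M.Over (Spec (.of k))]
    {U V : M.Opens} (h : U ≤ V) : Γ(M, V) →ₐ[k] Γ(M, U) where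
  toRingHom := (M.presheaf.map (homOfLE h).op).hom
  commutes' r := by
    exact congr(((ΓSpecIso (.of k)).inv ≫
      $((M ↘ Spec (.of k)).appLE_map (U := ⊤) (V := V) (by simp) (homOfLE h).op)).hom r)

variable (k : Type u) [CommRing k] (M : Scheme.{u}) [M.Over (Spec (.of k))]

lemma isLocalization_res {M : Scheme.{u}} {U V : M.AffineZariskiSite} (h : U ≤ V) (f : Γ(M, V.1))
    (hf : M.basicOpen f = U.1) :
    letI := (M.presheaf.map (homOfLE (AffineZariskiSite.toOpens_mono h)).op).hom.toAlgebra
    IsLocalization.Away f Γ(M, U.1) := by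
  obtain ⟨U, hU⟩ := U
  obtain rfl : M.basicOpen f = U := hf
  exact V.2.isLocalization_basicOpen f

lemma formallyEtale_resHom {M : Scheme.{u}} [M.Over (Spec (.of k))] {U V : M.AffineZariskiSite}
    (h : U ≤ V) : (resHom k (AffineZariskiSite.toOpens_mono h)).toRingHom.FormallyEtale :=
  formallyEtale_of_away _ h.choose (isLocalization_res h h.choose h.choose_spec)

lemma finitePresentation_kaehler [LocallyOfFinitePresentation (M ↘ Spec (.of k))]
    (U : M.AffineZariskiSite) : Module.FinitePresentation Γ(M, U.1) Ω[Γ(M, U.1)⁄k] := by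
  have h1 := (M ↘ Spec (.of k)).finitePresentation_appLE (isAffineOpen_top _) U.2 (by simp)
  have h2 : Algebra.FinitePresentation k Γ(M, U.1) := by
    have h3 : (ΓSpecIso (.of k)).inv.hom.FinitePresentation :=
      RingHom.FinitePresentation.of_bijective
        (ConcreteCategory.bijective_of_isIso (ΓSpecIso (.of k)).inv)
    exact h1.comp h3
  infer_instance

/-- The symmetric algebra of the dual of the sheaf of differentials. -/
noncomputable def symTangent [LocallyOfFinitePresentation (M ↘ Spec (.of k))] : GradedQCAlg M where
  obj U := SymmetricAlgebra Γ(M, U.1) (Tangent k Γ(M, U.1))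
  deg U := symDeg Γ(M, U.1) (Tangent k Γ(M, U.1))
  map {U V} h := symMap _
    (tangentRes (resHom k (AffineZariskiSite.toOpens_mono h)) (formallyEtale_resHom k h))
  map_algebraMap h r := symMap_algebraMap _ _ r
  map_id U a := by
    refine congrFun (congrArg DFunLike.coe (sym_ringHom_ext (f := (symMap _ (tangentRes
      (resHom k _) (formallyEtale_resHom k (le_refl U)))).toRingHom) (g := RingHom.id _)
      (fun a ↦ ?_) (fun D ↦ ?_))) a
    · exact (symMap_algebraMap _ _ a).trans
        (congrArg (algebraMap _ _) congr($(M.presheaf.map_id (.op U.1)) a))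
    · refine (symMap_ι _ _ D).trans (congrArg (SymmetricAlgebra.ι _ _) ?_)
      refine tangentRes_id _ _ (fun a ↦ ?_) D
      exact congr($(M.presheaf.map_id (.op U.1)) a)
  map_map {U V W} h h' a := by
    have hc : ∀ a, resHom k (AffineZariskiSite.toOpens_mono h)
        (resHom k (AffineZariskiSite.toOpens_mono h') a) =
        resHom k (AffineZariskiSite.toOpens_mono (h.trans h')) a := fun a ↦
      congr($((M.presheaf.map_comp (homOfLE (AffineZariskiSite.toOpens_mono h')).op
      (homOfLE (AffineZariskiSite.toOpens_mono h)).op).symm) a)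
    refine congrFun (congrArg DFunLike.coe (sym_ringHom_ext (f := (symMap _ (tangentRes
      (resHom k _) (formallyEtale_resHom k h))).toRingHom.comp (symMap _ (tangentRes
      (resHom k _) (formallyEtale_resHom k h'))).toRingHom) (g := (symMap _ (tangentRes
      (resHom k _) (formallyEtale_resHom k (h.trans h')))).toRingHom)
      (fun a ↦ ?_) (fun D ↦ ?_))) a
    · refine (congrArg (symMap _ (tangentRes (resHom k _) (formallyEtale_resHom k h)))
        (symMap_algebraMap _ _ a)).trans ?_
      refine (symMap_algebraMap _ _ _).trans ?_
      refine Eq.trans ?_ (symMap_algebraMap _ _ a).symm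
      exact congrArg (algebraMap _ _) (hc a)
    · refine (congrArg (symMap _ (tangentRes (resHom k _) (formallyEtale_resHom k h)))
        (symMap_ι _ _ D)).trans ?_
      refine (symMap_ι _ _ _).trans ?_
      refine Eq.trans ?_ (symMap_ι _ _ D).symm
      exact congrArg (SymmetricAlgebra.ι _ _) (tangentRes_comp _ _ _ _ _ _ hc D)
  isAwayMap {U V} h f hf := by
    have := finitePresentation_kaehler k M V
    have hl := isLocalizedModule_tangentRes (resHom k (AffineZariskiSite.toOpens_mono h))
      (formallyEtale_resHom k h) f (isLocalization_res h f hf)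
    exact isAwayMap_symMap _ _ f (isLocalization_res h f hf) hl.1 hl.2

/-- The projectivized cotangent bundle `P(T^*M) = Proj (Sym (Ω¹_M)^∨)`: the points of a fibre are the
lines in the cotangent space. -/
noncomputable def projCotangent [LocallyOfFinitePresentation (M ↘ Spec (.of k))] : Scheme.{u} :=
  (symTangent k M).relProj

end Cotangent

section Conormal

open scoped TensorProduct
open Polynomial Scheme

section Algebra

variable (k : Type u) {A B κ : Type u} [CommRing k] [CommRing A] [CommRing B] [Field κ]
  [Algebra k A]

section Cotangent

variable [Algebra k B] [Algebra A B] [IsScalarTower k A B]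
  [Algebra A κ] [Algebra B κ] [IsScalarTower A B κ]

variable (A B κ) in
/-- The homomorphism of fibres of the modules of differentials
`κ ⊗ Ω[A⁄k] → κ ⊗ Ω[B⁄k]` at a `κ`-valued point of `B`. -/
noncomputable def cotangentMap : κ ⊗[A] Ω[A⁄k] →ₗ[κ] κ ⊗[B] Ω[B⁄k] :=
  LinearMap.liftBaseChange κ
    ((TensorProduct.mk B κ Ω[B⁄k] 1).restrictScalars A ∘ₗ KaehlerDifferential.map k k A B)

/-- A cotangent vector `ξ` in the fibre of `Ω[A⁄k]` at a `κ`-valued point, as the homomorphism from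
the symmetric algebra of the dual of `Ω[A⁄k]` to `κ[t]` which sends `D` to `⟨D, ξ⟩t`; it
parametrizes the line spanned by `ξ`. -/
noncomputable def covectorHom (ξ : κ ⊗[A] Ω[A⁄k]) : SymmetricAlgebra A (Tangent k A) →+* κ[X] :=
  symLiftHom (C.comp (algebraMap A κ))
    { toFun := fun D ↦ monomial 1 (Module.Dual.baseChange κ D ξ)
      map_zero' := by rw [map_zero, LinearMap.zero_apply, map_zero]
      map_add' := fun D D' ↦ by rw [map_add, LinearMap.add_apply, map_add] }
    (fun a D ↦ by
      change monomial 1 (Module.Dual.baseChange κ (a • D) ξ) =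
        C (algebraMap A κ a) * monomial 1 (Module.Dual.baseChange κ D ξ)
      rw [map_smul, LinearMap.smul_apply, C_mul_monomial, Algebra.smul_def])

end Cotangent

/-- For `k`-algebra homomorphisms `A → B → κ`, the set of homogeneous ideals of the points `[ξ]` of
`Proj Sym (Ω[A⁄k])^∨` which correspond to the nonzero vectors `ξ` in the kernel of
`κ ⊗ Ω[A⁄k] → κ ⊗ Ω[B⁄k]`. -/
def conormalIdeals (α : A →+* B) (β : B →+* κ) : Set (Ideal (SymmetricAlgebra A (Tangent k A))) :=
  letI := α.toAlgebra
  letI := β.toAlgebra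
  letI := (β.comp α).toAlgebra
  letI := (α.comp (algebraMap k A)).toAlgebra
  haveI : IsScalarTower k A B := .of_algebraMap_eq fun _ ↦ rfl
  haveI : IsScalarTower A B κ := .of_algebraMap_eq fun _ ↦ rfl
  { I | ∃ ξ : κ ⊗[A] Ω[A⁄k], ξ ≠ 0 ∧ cotangentMap k A B κ ξ = 0 ∧
    I = RingHom.ker (covectorHom k ξ) }

end Algebra

variable (k : Type u) [CommRing k] {M : Scheme.{u}} [M.Over (Spec (.of k))]
  [LocallyOfFinitePresentation (M ↘ Spec (.of k))] {X : Scheme.{u}} (i : X ⟶ M)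

/-- The points `[ξ]` of `P(T^*M)`, where `ξ` is a nonzero vector in the kernel of
`(T^*M)_x → (T^*X)_x` and `x` is a nonsingular point of `X`. -/
def conormalPoints : Set (projCotangent k M) :=
  { p | ∃ (x : X) (U : M.AffineZariskiSite) (hx : x ∈ i ⁻¹ᵁ U.1)
    (q : Proj (symDeg Γ(M, U.1) (Tangent k Γ(M, U.1)))),
    (∃ W : X.Opens, x ∈ W ∧ Smooth (W.ι ≫ i ≫ (M ↘ Spec (.of k)))) ∧
    q.asHomogeneousIdeal.toIdeal ∈
      conormalIdeals k (i.app U.1).hom (X.evaluation (i ⁻¹ᵁ U.1) x hx).hom ∧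
    (symTangent k M).ι U q = p }

/-- The projectivized conormal space `P(T^*_X M)`, with its reduced structure. -/
noncomputable def projConormal : Scheme.{u} :=
  (IdealSheafData.vanishingIdeal
    (⟨closure (conormalPoints k i), isClosed_closure⟩ :
      TopologicalSpace.Closeds (projCotangent k M))).subscheme

/-- The inclusion of the projectivized conormal space in `P(T^*M)`. -/
noncomputable def projConormalι : projConormal k i ⟶ projCotangent k M :=
  IdealSheafData.subschemeι _

end Conormal

section Cycles

/-- The multiplicity of the point `p` in the fundamental cycle of a closed subscheme: the length of
the local ring at `p` if `p` is the generic point of an irreducible component, and `0` otherwise. -/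
noncomputable def cycleMultiplicity {Z P : Scheme.{u}} (j : Z ⟶ P) (p : P) : ℕ∞ :=
  ⨆ z : { z : Z // j z = p ∧ closure {z} ∈ irreducibleComponents Z },
    Module.length (Z.presheaf.stalk z.1) (Z.presheaf.stalk z.1)

/-- The cycle `c` on `P` is the fundamental cycle of the closed subscheme `j : Z ⟶ P`. -/
def IsCycleOf {Z P : Scheme.{u}} (j : Z ⟶ P) (c : AlgebraicCycle P ℤ) : Prop :=
  ∀ p : P, ∃ n : ℕ, c p = n ∧ cycleMultiplicity j p = n

end Cycles

section Hypersurface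

open scoped TensorProduct
open Polynomial Scheme

section Algebra

variable (k A N : Type u) [CommRing k] [CommRing A] [Algebra k A] [AddCommGroup N] [Module A N]
  [Module k N] [IsScalarTower k A N]

/-- The relations of the module of principal parts of order one: the `A`-submodule `I² (A ⊗ N)`,
where `I` is the kernel of the multiplication `A ⊗ A → A`. -/
def principalPartsRel : Submodule A (A ⊗[k] N) :=
  Submodule.span A { x | ∃ (a b : A) (m : N),
    x = (a * b) ⊗ₜ m - a ⊗ₜ (b • m) - b ⊗ₜ (a • m) + 1 ⊗ₜ ((a * b) • m) }

/-- The module of principal parts of order one of an `A`-module. -/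
abbrev PrincipalParts : Type u := (A ⊗[k] N) ⧸ principalPartsRel k A N

variable {N} in
/-- The section of the module of principal parts determined by an element of `N`. -/
def principalPart (m : N) : PrincipalParts k A N := (principalPartsRel k A N).mkQ (1 ⊗ₜ m)

end Algebra

/-- The ideal of the zero-scheme of an element of a module: its image under all functionals. -/
def zeroIdeal (A : Type u) {N : Type u} [CommRing A] [AddCommGroup N] [Module A N] (s : N) :
    Ideal A := LinearMap.range (Module.Dual.eval A N s)

variable {M : Scheme.{u}} (L : M.Modules)

/-- Restriction of sections of a sheaf of modules. -/
noncomputable def resSection {U V : M.Opens} (h : U ≤ V) (s : Γ(L, V)) : Γ(L, U) :=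
  (L.presheaf.map (homOfLE h).op) s

/-- A section `e` over `U` is a frame if multiplication by `e` is an isomorphism from the structure
sheaf of `U` to the restriction of `L`. -/
def IsFrame (U : M.Opens) (e : Γ(L, U)) : Prop :=
  ∀ (V : M.Opens) (h : V ≤ U), Function.Bijective fun r : Γ(M, V) ↦ r • resSection L h e

/-- A line bundle is a sheaf of modules that is locally isomorphic to the structure sheaf. -/
def IsLineBundle : Prop :=
  ∀ x : M, ∃ (U : M.Opens) (e : Γ(L, U)), x ∈ U ∧ IsFrame L U e

variable (F : Γ(L, ⊤))

/-- The ideal sheaf of the zero-scheme of a section `F`. -/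
noncomputable def zeroIdealSheaf : M.IdealSheafData :=
  .ofIdeals fun U ↦ zeroIdeal Γ(M, U) (resSection L (le_top : U.1 ≤ ⊤) F)

/-- The ideal sheaf of the zero-scheme of the section of the sheaf of principal parts of `L` which
is determined by `F`. -/
noncomputable def singularityIdealSheaf (k : Type u) [CommRing k] [M.Over (Spec (.of k))] :
    M.IdealSheafData :=
  .ofIdeals fun U ↦
    letI : Module k Γ(L, U.1) := Module.compHom _ (algebraMap k Γ(M, U))
    haveI : IsScalarTower k Γ(M, U) Γ(L, U.1) := ⟨fun c a m ↦ by
      rw [Algebra.smul_def, mul_smul]; rfl⟩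
    zeroIdeal Γ(M, U) (principalPart k Γ(M, U) (resSection L (le_top : U.1 ≤ ⊤) F))

/-- The zero-scheme of a section of a line bundle. -/
noncomputable def hypersurface : Scheme.{u} := (zeroIdealSheaf L F).subscheme

/-- The inclusion of the zero-scheme of a section of a line bundle. -/
noncomputable def hypersurfaceι : hypersurface L F ⟶ M := (zeroIdealSheaf L F).subschemeι

instance : IsClosedImmersion (hypersurfaceι L F) :=
  inferInstanceAs (IsClosedImmersion (zeroIdealSheaf L F).subschemeι)

variable (k : Type u) [CommRing k] [M.Over (Spec (.of k))]

/-- The ideal sheaf of the singularity subscheme in the hypersurface. -/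
noncomputable def singularityIdeal : (hypersurface L F).IdealSheafData :=
  (singularityIdealSheaf L F k).comap (hypersurfaceι L F)

/-- The blow-up of the hypersurface along its singularity subscheme. -/
noncomputable def blowupSing : Scheme.{u} := blowup (hypersurface L F) (singularityIdeal L F k)

/-- The blow-down morphism to the hypersurface. -/
noncomputable def blowupSingπ : blowupSing L F k ⟶ hypersurface L F :=
  (rees (hypersurface L F) (singularityIdeal L F k)).toBase

/-- The preimage of an affine open set in the hypersurface. -/
noncomputable def hypersurfaceAffine (U : M.AffineZariskiSite) :
    (hypersurface L F).AffineZariskiSite :=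
  ⟨hypersurfaceι L F ⁻¹ᵁ U.1, U.2.preimage (hypersurfaceι L F)⟩

variable [LocallyOfFinitePresentation (M ↘ Spec (.of k))]

/-- The restriction `P(T^*M|_X)` of the projectivized cotangent bundle to the hypersurface. -/
noncomputable def projCotangentRestrict : Scheme.{u} :=
  pullback (symTangent k M).toBase (hypersurfaceι L F)

/-- The morphism `P(T^*M|_X) ⟶ P(T^*M)`. -/
noncomputable def restrictToProjCotangent : projCotangentRestrict L F k ⟶ projCotangent k M :=
  pullback.fst _ _

/-- The projection of `P(T^*M|_X)` to the hypersurface. -/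
noncomputable def projCotangentRestrictπ : projCotangentRestrict L F k ⟶ hypersurface L F :=
  pullback.snd _ _

/-- The morphism `j` from the blow-up to `P(T^*M|_X)` is the one given by `dF`: wherever `F = f e`
for a local frame `e` of the line bundle, `j` is induced by the homomorphism of graded algebras
from `Sym (Ω¹_M)^∨` to the Rees algebra that sends a vector field `D` to `D(df)|_X t`. -/
def IsInducedByDifferential (j : blowupSing L F k ⟶ projCotangentRestrict L F k) : Prop :=
  ∀ (U : M.AffineZariskiSite) (e : Γ(L, U.1)) (f : Γ(M, U.1)), IsFrame L U.1 e →
    resSection L (le_top : U.1 ≤ ⊤) F = f • e →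
    ∃ (φ : (symTangent k M).deg U →+*ᵍ
        (rees _ (singularityIdeal L F k)).deg (hypersurfaceAffine L F U))
      (hφ : HomogeneousIdeal.irrelevant
        ((rees _ (singularityIdeal L F k)).deg (hypersurfaceAffine L F U)) ≤
        (HomogeneousIdeal.irrelevant ((symTangent k M).deg U)).map φ),
      (∀ a : Γ(M, U.1), φ (algebraMap Γ(M, U.1) _ a) =
        algebraMap Γ(hypersurface L F, (hypersurfaceAffine L F U).1) _
          ((hypersurfaceι L F).app U.1 a)) ∧
      (∀ D : Tangent k Γ(M, U.1),
        (φ (SymmetricAlgebra.ι Γ(M, U.1) (Tangent k Γ(M, U.1)) D)).1 =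
          monomial 1 ((hypersurfaceι L F).app U.1 (D (KaehlerDifferential.D k Γ(M, U.1) f)))) ∧
      (rees _ (singularityIdeal L F k)).ι (hypersurfaceAffine L F U) ≫ j ≫
        restrictToProjCotangent L F k = Proj.map φ hφ ≫ (symTangent k M).ι U

end Hypersurface

end ConormalCycle

/-! Local picture. On an affine open set where `F = f e`, put `A = Γ(M, U)` and `B = A/f`. A
functional on the first order principal parts sends the section given by `F` to `f c + D(df)`, with
`c ∈ A` and `D` a vector field, and every pair `(c, D)` occurs. So the ideal `J ⊆ B` of the
singularity subscheme is exactly the set of the `D(df)|_X`, and the homomorphism `diffHom` from the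
symmetric algebra of vector fields to the Rees algebra of `J` is surjective; on `Proj` it is a
closed immersion. For another frame with `e = v e'` and `f' = f v` one has `D(df')|_X = v D(df)|_X`.
The homomorphism is then multiplied by `vⁿ` in degree `n`, which `Proj` does not see
(`proj_map_eq_of_twist`). Hence the local immersions glue to a closed immersion `G` into `P(T^*M)`,
which lifts to `P(T^*M|_X)`.

Cycles. The Rees algebra of a reduced `B` is a subring of `B[t]`, so the blow-up is reduced, and so
is the conormal space. All multiplicities are therefore one (`cycleMultiplicity_eq`), and it remains
to show that the image of `G` is the closure of the conormal points. A conormal covector at `x` is a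
multiple of `df(x)` by the conormal sequence; if it is nonzero, then `df(x) ≠ 0` and its line is the
point of the blow-up over `x` (`conormalPoints_subset_range`). Conversely, every prime of the Rees
algebra contains the contraction of `P B[t]` for some minimal prime `P` of `B`
(`exists_minimalPrime_le`), so every point of the blow-up is a specialization of the point `[df]`
over the generic point of a component of `X`. That point is conormal: `X` is smooth there because
`k` is perfect, and `df` does not vanish there, since the residue field is formally smooth over `k`,
the conormal sequence is split injective, and locally `f ∉ (f²)` (`exists_tangent_apply_notMem`).

A technical matter comes before all this. The ideal sheaves are the largest ones contained in ideals
prescribed on all affine open sets, including those where `L` is not trivial. That they have the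
expected value on trivializing ones (`ofIdeals_ideal_eq`) amounts to extending functionals from
`D(f)` to `U` after multiplication by a power of `f` (`exists_operator`). -/

namespace ConormalCycle

/-! ### Ideal sheaves generated by ideals that behave well on a basis of affine open sets. -/

section IdealSheaves

open Scheme

/-- Restriction of functions to a smaller open set, as a ring homomorphism. -/
abbrev resO {M : Scheme.{u}} {U V : M.Opens} (h : U ≤ V) : Γ(M, V) →+* Γ(M, U) :=
  (M.presheaf.map (homOfLE h).op).hom

variable {M : Scheme.{u}}

lemma resO_resO {U V W : M.Opens} (h : U ≤ V) (h' : V ≤ W) (a : Γ(M, W)) :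
    resO h (resO h' a) = resO (h.trans h') a :=
  congr($((M.presheaf.map_comp (homOfLE h').op (homOfLE h).op).symm) a)

lemma azs_mono {U V : M.AffineZariskiSite} (h : U ≤ V) : U.toOpens ≤ V.toOpens :=
  AffineZariskiSite.toOpens_mono h

/-- The order of `AffineZariskiSite` is "is a distinguished open subset of", so an inclusion of open
sets is not enough. With `V = D(g)`, the function to use on `D(f)` is the restriction of `g`. -/
lemma basicOpen_resO_le {U V : M.AffineZariskiSite} (h : V ≤ U) (f : Γ(M, U.toOpens)) :
    V.basicOpen (resO (azs_mono h) f) ≤ U.basicOpen f := by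
  obtain ⟨g, hg⟩ := h
  refine ⟨resO (M.basicOpen_le f) g, ?_⟩
  refine (M.basicOpen_res g _).trans (Eq.trans ?_ (M.basicOpen_res f _).symm)
  rw [hg, inf_comm]
  rfl

lemma exists_pow_mul_mem {A B : Type u} [CommRing A] [CommRing B] (ψ : A →+* B) (r : A)
    (hr : letI := ψ.toAlgebra; IsLocalization.Away r B) (I : Ideal A) (a : A)
    (h : ψ a ∈ I.map ψ) : ∃ n : ℕ, r ^ n * a ∈ I := by
  let := ψ.toAlgebra
  obtain ⟨_, ⟨n, rfl⟩, hn⟩ :=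
    (IsLocalization.algebraMap_mem_map_algebraMap_iff (Submonoid.powers r) B I a).mp h
  exact ⟨n, hn⟩

lemma mem_of_span_eq_top {A : Type u} [CommRing A] (I : Ideal A) (s : Set A)
    (hs : Ideal.span s = ⊤) (a : A) (h : ∀ f ∈ s, ∃ n : ℕ, f ^ n * a ∈ I) : a ∈ I :=
  Submodule.mem_of_span_eq_top_of_smul_pow_mem I s hs a fun f ↦ h f.1 f.2

lemma span_basicOpen_eq_top {P : M.AffineZariskiSite → Prop} (U : M.AffineZariskiSite)
    (hcov : ∀ x ∈ U.toOpens, ∃ V ≤ U, P V ∧ x ∈ V.toOpens) :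
    Ideal.span { f : Γ(M, U.toOpens) | P (U.basicOpen f) } = ⊤ := by
  rw [← U.2.self_le_iSup_basicOpen_iff]
  intro x hx
  obtain ⟨V, ⟨f, hf⟩, hV, hxV⟩ := hcov x hx
  obtain rfl : U.basicOpen f = V := Subtype.ext hf
  exact TopologicalSpace.Opens.mem_iSup.mpr ⟨⟨f, hV⟩, hxV⟩

section OfIdeals

variable (I : ∀ U : M.AffineZariskiSite, Ideal Γ(M, U.toOpens)) (P : M.AffineZariskiSite → Prop)
  (hcov : ∀ (U : M.AffineZariskiSite) (x : M), x ∈ U.toOpens → ∃ V ≤ U, P V ∧ x ∈ V.toOpens)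
  (hres : ∀ {U V : M.AffineZariskiSite}, V ≤ U → P U → P V)
  (hI : ∀ {U V : M.AffineZariskiSite} (h : V ≤ U), P U → (I U).map (resO (azs_mono h)) = I V)
  (hloc : ∀ (U : M.AffineZariskiSite) (f : Γ(M, U.toOpens)), P (U.basicOpen f) → ∀ a : Γ(M, U.toOpens),
    resO (azs_mono (U.basicOpen_le f)) a ∈ I (U.basicOpen f) → ∃ n : ℕ, f ^ n * a ∈ I U)

/-- The functions whose restrictions to all the distinguished basic open sets lie in the given
ideals. -/
def localIdeal (U : M.AffineZariskiSite) : Ideal Γ(M, U.toOpens) where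
  carrier := { a | ∀ (V : M.AffineZariskiSite) (h : V ≤ U), P V → resO (azs_mono h) a ∈ I V }
  add_mem' ha hb V h hV := by
    rw [map_add]
    exact add_mem (ha V h hV) (hb V h hV)
  zero_mem' V h hV := by
    rw [map_zero]
    exact zero_mem _
  smul_mem' c a ha V h hV := by
    rw [smul_eq_mul, map_mul]
    exact Ideal.mul_mem_left _ _ (ha V h hV)

include hcov hres hI hloc

lemma localIdeal_map (U : M.AffineZariskiSite) (g : Γ(M, U.toOpens)) :
    (localIdeal I P U).map (resO (azs_mono (U.basicOpen_le g))) = localIdeal I P (U.basicOpen g) := by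
  apply le_antisymm
  · rw [Ideal.map_le_iff_le_comap]
    intro a ha V h hV
    rw [resO_resO]
    exact ha V (h.trans (U.basicOpen_le g)) hV
  intro b hb
  let := (resO (azs_mono (U.basicOpen_le g))).toAlgebra
  have hlg : IsLocalization.Away g Γ(M, (U.basicOpen g).toOpens) := U.2.isLocalization_basicOpen g
  obtain ⟨⟨a, ⟨_, m, rfl⟩⟩, ha⟩ := IsLocalization.surj (Submonoid.powers g) b
  obtain ⟨t, htP, ht⟩ := (Ideal.span_eq_top_iff_finite _).mp
    (span_basicOpen_eq_top U (P := P) (hcov U))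
  -- The condition `f ∈ t` is placed inside the existential so that `choose` gives an exponent for
  -- every `f`, and these can be summed over `t`.
  have hex : ∀ f : Γ(M, U.toOpens), ∃ n : ℕ, f ∈ t →
      resO (azs_mono (U.basicOpen_le f)) (g ^ n * a) ∈ I (U.basicOpen f) := by
    intro f
    by_cases hft : f ∈ t
    swap
    · exact ⟨0, fun h ↦ absurd h hft⟩
    have hPf : P (U.basicOpen f) := htP hft
    let W := (U.basicOpen f).basicOpen (resO (azs_mono (U.basicOpen_le f)) g)
    have hWf : W ≤ U.basicOpen f := AffineZariskiSite.basicOpen_le _ _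
    have hWg : W ≤ U.basicOpen g := basicOpen_resO_le (U.basicOpen_le f) g
    obtain ⟨n, hn⟩ := exists_pow_mul_mem (resO (azs_mono hWf)) (resO (azs_mono (U.basicOpen_le f)) g)
      ((U.basicOpen f).2.isLocalization_basicOpen _) (I (U.basicOpen f))
      (resO (azs_mono (U.basicOpen_le f)) a) (by
        rw [hI hWf hPf, resO_resO]
        have h1 : resO (azs_mono (hWg.trans (U.basicOpen_le g))) a =
            resO (azs_mono hWg) (b * resO (azs_mono (U.basicOpen_le g)) (g ^ m)) := by
          rw [← resO_resO (azs_mono hWg) (azs_mono (U.basicOpen_le g)) a]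
          exact congrArg _ ha.symm
        refine Eq.subst (motive := fun z ↦ z ∈ I W) h1.symm ?_
        rw [map_mul]
        exact Ideal.mul_mem_right _ _ (hb W hWg (hres hWf hPf)))
    exact ⟨n, fun _ ↦ by rwa [map_mul, map_pow]⟩
  choose n hn using hex
  let N := ∑ f ∈ t, n f
  have hN : g ^ N * a ∈ localIdeal I P U := by
    intro V h hV
    refine mem_of_span_eq_top _ (resO (azs_mono h) '' t) ?_ _ ?_
    · rw [← Ideal.map_span, ht, Ideal.map_top]
    · rintro _ ⟨f, hf, rfl⟩
      refine hloc V _ (hres (AffineZariskiSite.basicOpen_le _ _) hV) _ ?_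
      have h2 := basicOpen_resO_le h f
      have h3 : resO (azs_mono (U.basicOpen_le f)) (g ^ N * a) ∈ I (U.basicOpen f) := by
        have : N = (N - n f) + n f :=
          (Nat.sub_add_cancel (Finset.single_le_sum (fun _ _ ↦ Nat.zero_le _) hf)).symm
        rw [this, pow_add, mul_assoc, map_mul]
        exact Ideal.mul_mem_left _ _ (hn f hf)
      have h4 := Ideal.mem_map_of_mem (resO (azs_mono h2)) h3
      rw [hI h2 (htP hf), resO_resO] at h4
      rw [resO_resO]
      exact h4
  refine (IsLocalization.mem_map_algebraMap_iff (Submonoid.powers g) Γ(M, (U.basicOpen g).toOpens)).mpr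
    ⟨⟨⟨_, hN⟩, ⟨_, N + m, rfl⟩⟩, ?_⟩
  simp only [map_mul, map_pow, pow_add] at ha ⊢
  rw [← ha]
  ring

/-- `ofIdeals` is the largest ideal sheaf below `I`, so a competitor suffices. The ideals
`localIdeal` form an ideal sheaf, lie below `I` everywhere by `hloc` and a partition of unity, and
contain `I U` on good `U` by `hI`. -/
theorem ofIdeals_ideal_eq (U : M.AffineZariskiSite) (hU : P U) :
    (IdealSheafData.ofIdeals fun V : M.affineOpens ↦ I ⟨V.1, V.2⟩).ideal ⟨U.1, U.2⟩ = I U := by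
  apply le_antisymm
  · exact IdealSheafData.ideal_ofIdeals_le (fun V : M.affineOpens ↦ I ⟨V.1, V.2⟩) ⟨U.1, U.2⟩
  let J : M.IdealSheafData :=
    { ideal := fun V ↦ localIdeal I P ⟨V.1, V.2⟩
      map_ideal_basicOpen := fun V f ↦
        localIdeal_map I P hcov hres hI hloc ⟨V.1, V.2⟩ f }
  have hJ : J ≤ IdealSheafData.ofIdeals fun V : M.affineOpens ↦ I ⟨V.1, V.2⟩ := by
    rw [IdealSheafData.le_ofIdeals_iff]
    intro V a ha
    refine mem_of_span_eq_top _ _ (span_basicOpen_eq_top ⟨V.1, V.2⟩ (P := P) (hcov _)) a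
      fun f hf ↦ ?_
    exact hloc _ f hf a (ha _ (AffineZariskiSite.basicOpen_le _ _) hf)
  refine le_trans ?_ (hJ ⟨U.1, U.2⟩)
  intro a ha V h hV
  exact (hI h hU).le (Ideal.mem_map_of_mem _ ha)

end OfIdeals

end IdealSheaves

end ConormalCycle

namespace ConormalCycle

/-! ### Functionals on principal parts and the Jacobian ideal. -/

section PrincipalParts

open scoped TensorProduct

variable (k : Type u) {A N : Type u} [CommRing k] [CommRing A] [Algebra k A] [AddCommGroup N]
  [Module A N]

/-- The ideal generated by `f` and its derivatives along vector fields. -/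
def jacobianIdeal (f : A) : Ideal A where
  carrier := { a | ∃ (c : A) (D : Tangent k A), a = f * c + D (KaehlerDifferential.D k A f) }
  add_mem' := by
    rintro _ _ ⟨c, D, rfl⟩ ⟨c', D', rfl⟩
    exact ⟨c + c', D + D', by rw [LinearMap.add_apply]; ring⟩
  zero_mem' := ⟨0, 0, by simp⟩
  smul_mem' := by
    rintro a _ ⟨c, D, rfl⟩
    exact ⟨a * c, a • D, by rw [LinearMap.smul_apply, smul_eq_mul, smul_eq_mul]; ring⟩

lemma mem_jacobianIdeal {f a : A} : a ∈ jacobianIdeal k f ↔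
    ∃ (c : A) (D : Tangent k A), a = f * c + D (KaehlerDifferential.D k A f) := Iff.rfl

lemma mem_zeroIdeal {s : N} {a : A} : a ∈ zeroIdeal A s ↔ ∃ φ : N →ₗ[A] A, φ s = a := Iff.rfl

lemma tangent_leibniz (D : Tangent k A) (a b : A) : D (KaehlerDifferential.D k A (a * b)) =
    a * D (KaehlerDifferential.D k A b) + b * D (KaehlerDifferential.D k A a) := by
  rw [Derivation.leibniz, map_add, map_smul, map_smul, smul_eq_mul, smul_eq_mul]

lemma tangent_algebraMap (D : Tangent k A) (c : k) :
    D (KaehlerDifferential.D k A (algebraMap k A c)) = 0 := by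
  rw [Derivation.map_algebraMap, map_zero]

lemma zeroIdeal_smul_of_bijective {e : N} (he : Function.Bijective fun r : A ↦ r • e) (f : A) :
    zeroIdeal A (f • e) = Ideal.span {f} := by
  ext a
  rw [mem_zeroIdeal, Ideal.mem_span_singleton]
  constructor
  · rintro ⟨φ, rfl⟩
    exact ⟨φ e, by rw [map_smul, smul_eq_mul]⟩
  · rintro ⟨c, rfl⟩
    let ε : A ≃ₗ[A] N := LinearEquiv.ofBijective (LinearMap.toSpanSingleton A N e) he
    refine ⟨LinearMap.toSpanSingleton A A c ∘ₗ ε.symm.toLinearMap, ?_⟩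
    have : ε.symm (f • e) = f := ε.symm_apply_eq.mpr rfl
    rw [LinearMap.comp_apply, LinearEquiv.coe_coe, this]
    rfl

variable [Module k N] [IsScalarTower k A N]

/-- A differential operator of order at most one from a module to the ring, as a functional on the
principal parts. -/
noncomputable def principalPartsLift (φ : N →ₗ[k] A)
    (hφ : ∀ (a b : A) (m : N),
      a * b * φ m - a * φ (b • m) - b * φ (a • m) + φ ((a * b) • m) = 0) :
    PrincipalParts k A N →ₗ[A] A :=
  (principalPartsRel k A N).liftQ (LinearMap.liftBaseChange A φ) (by
    rw [principalPartsRel, Submodule.span_le]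
    rintro _ ⟨a, b, m, rfl⟩
    simpa using hφ a b m)

omit [IsScalarTower k A N] in
lemma principalPartsLift_principalPart (φ : N →ₗ[k] A)
    (hφ : ∀ (a b : A) (m : N),
      a * b * φ m - a * φ (b • m) - b * φ (a • m) + φ ((a * b) • m) = 0) (m : N) :
    principalPartsLift k φ hφ (principalPart k A m) = φ m := by
  refine (Submodule.liftQ_apply _ _ _).trans ?_
  simp

/-- A functional `Φ` is an operator of order at most one. Subtracting its value at `e` leaves a
derivation `δ` of `A`, and `Φ` takes the value `f Φ(e) + δ f` on `f e`. No frame is needed for this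
half. -/
lemma zeroIdeal_principalPart_le (e : N) (f : A) :
    zeroIdeal A (principalPart k A (f • e)) ≤ jacobianIdeal k f := by
  intro a
  rw [mem_zeroIdeal, mem_jacobianIdeal]
  rintro ⟨Φ, rfl⟩
  have hmk : ∀ (a : A) (m : N), Φ ((principalPartsRel k A N).mkQ (a ⊗ₜ m)) =
      a * Φ (principalPart k A m) := by
    intro a m
    rw [← smul_eq_mul, ← map_smul, principalPart, ← map_smul, TensorProduct.smul_tmul',
      smul_eq_mul, mul_one]
  have hrel : ∀ (a b : A) (m : N), a * b * Φ (principalPart k A m) -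
      a * Φ (principalPart k A (b • m)) - b * Φ (principalPart k A (a • m)) +
      Φ (principalPart k A ((a * b) • m)) = 0 := by
    intro a b m
    have h0 : (principalPartsRel k A N).mkQ ((a * b) ⊗ₜ m - a ⊗ₜ (b • m) - b ⊗ₜ (a • m) +
        1 ⊗ₜ ((a * b) • m)) = 0 := by
      rw [Submodule.mkQ_apply, Submodule.Quotient.mk_eq_zero]
      exact Submodule.subset_span ⟨a, b, m, rfl⟩
    have h1 := congrArg Φ h0
    rw [map_add, map_sub, map_sub, map_add, map_sub, map_sub, hmk, hmk, hmk, hmk, map_zero,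
      one_mul] at h1
    exact h1
  have hadd : ∀ m m' : N, Φ (principalPart k A (m + m')) =
      Φ (principalPart k A m) + Φ (principalPart k A m') := by
    intro m m'
    rw [principalPart, TensorProduct.tmul_add, map_add, map_add]
    rfl
  have hsmul : ∀ (c : k) (m : N), Φ (principalPart k A (c • m)) =
      algebraMap k A c * Φ (principalPart k A m) := by
    intro c m
    rw [← hmk, principalPart, TensorProduct.tmul_smul, TensorProduct.smul_tmul',
      Algebra.smul_def, mul_one]
  -- The Leibniz rule for `δ` is precisely the defining relation of the principal parts, applied to
  -- `a`, `b`, `e`.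
  let δ : Derivation k A A := Derivation.mk'
    { toFun := fun b ↦ Φ (principalPart k A (b • e)) - b * Φ (principalPart k A e)
      map_add' := fun b b' ↦ by rw [add_smul, hadd]; ring
      map_smul' := fun c b ↦ by
        rw [smul_assoc, hsmul, RingHom.id_apply, Algebra.smul_def, Algebra.smul_def]; ring }
    (fun a b ↦ by
      have := hrel a b e
      simp only [LinearMap.coe_mk, AddHom.coe_mk, smul_eq_mul]
      linear_combination this)
  refine ⟨Φ (principalPart k A e), δ.liftKaehlerDifferential, ?_⟩
  rw [Derivation.liftKaehlerDifferential_comp_D]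
  change _ = _ + (Φ (principalPart k A (f • e)) - f * Φ (principalPart k A e))
  ring

/-- An order one operator on a free module of rank one. -/
lemma operator_rel (D : Tangent k A) (c a b r : A) :
    a * b * (r * c + D (KaehlerDifferential.D k A r)) -
      a * ((b * r) * c + D (KaehlerDifferential.D k A (b * r))) -
      b * ((a * r) * c + D (KaehlerDifferential.D k A (a * r))) +
      ((a * b * r) * c + D (KaehlerDifferential.D k A (a * b * r))) = 0 := by
  simp only [tangent_leibniz]
  ring

/-- A frame identifies `N` with `A`, so every operator `r e ↦ r c + D(dr)` exists and defines a
functional on the principal parts. -/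
lemma zeroIdeal_principalPart_smul {e : N} (he : Function.Bijective fun r : A ↦ r • e) (f : A) :
    zeroIdeal A (principalPart k A (f • e)) = jacobianIdeal k f := by
  refine le_antisymm (zeroIdeal_principalPart_le k e f) ?_
  rintro _ ⟨c, D, rfl⟩
  let ε : A ≃ₗ[A] N := LinearEquiv.ofBijective (LinearMap.toSpanSingleton A N e) he
  have hε : ∀ a, ε.symm (a • e) = a := fun a ↦ ε.symm_apply_eq.mpr rfl
  let φ : N →ₗ[k] A :=
    { toFun := fun m ↦ ε.symm m * c + D (KaehlerDifferential.D k A (ε.symm m))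
      map_add' := fun m m' ↦ by rw [map_add, map_add, map_add]; ring
      map_smul' := fun r m ↦ by
        rw [← algebraMap_smul A r m, map_smul, smul_eq_mul, tangent_leibniz, tangent_algebraMap,
          RingHom.id_apply, Algebra.smul_def]
        ring }
  refine mem_zeroIdeal.mpr ⟨principalPartsLift k φ ?_, ?_⟩
  · intro a b m
    have := operator_rel k D c a b (ε.symm m)
    simpa [φ] using this
  · rw [principalPartsLift_principalPart]
    change ε.symm (f • e) * c + D (KaehlerDifferential.D k A (ε.symm (f • e))) = _
    rw [hε]

end PrincipalParts

section JacobianLocalization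

variable {k A B : Type u} [CommRing k] [CommRing A] [CommRing B] [Algebra k A] [Algebra k B]

lemma jacobianIdeal_map_le (ψ : A →ₐ[k] B) (h : ψ.toRingHom.FormallyEtale) (f : A) :
    (jacobianIdeal k f).map ψ.toRingHom ≤ jacobianIdeal k (ψ f) := by
  rw [Ideal.map_le_iff_le_comap]
  rintro _ ⟨c, D, rfl⟩
  refine ⟨ψ c, tangentRes ψ h D, ?_⟩
  rw [tangentRes_apply]
  exact (map_add ψ _ _).trans (by rw [map_mul])

/-- Finite presentation of `Ω[A⁄k]` makes its dual commute with localization: up to a power of `r`,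
every vector field over `B` comes from `A`. -/
lemma jacobianIdeal_map (ψ : A →ₐ[k] B) (r : A)
    [Module.FinitePresentation A Ω[A⁄k]]
    (hr : letI := ψ.toRingHom.toAlgebra; IsLocalization.Away r B) (f : A) :
    (jacobianIdeal k f).map ψ.toRingHom = jacobianIdeal k (ψ f) := by
  have h : ψ.toRingHom.FormallyEtale := formallyEtale_of_away _ r hr
  refine le_antisymm (jacobianIdeal_map_le ψ h f) ?_
  rintro _ ⟨c, D, rfl⟩
  obtain ⟨n, D', hD'⟩ := (isLocalizedModule_tangentRes ψ h r hr).1 D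
  refine add_mem (Ideal.mul_mem_right _ _ (Ideal.mem_map_of_mem ψ.toRingHom ?_)) ?_
  · exact ⟨1, 0, by simp⟩
  · have hu : IsUnit (ψ r ^ n) := by
      let := ψ.toRingHom.toAlgebra
      exact (IsLocalization.Away.algebraMap_isUnit (S := B) r).pow n
    rw [← Ideal.unit_mul_mem_iff_mem _ hu]
    have h1 : ψ r ^ n * D (KaehlerDifferential.D k B (ψ f)) =
        ψ (D' (KaehlerDifferential.D k A f)) := by
      rw [← tangentRes_apply ψ h, hD']; rfl
    rw [h1]
    exact Ideal.mem_map_of_mem ψ.toRingHom ⟨0, D', by simp⟩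

end JacobianLocalization

end ConormalCycle

namespace ConormalCycle

/-! ### Frames, and the extension of first order operators from `D(f)`. -/

section Frames

open Scheme

variable {M : Scheme.{u}} {L : M.Modules}

lemma resSection_resSection {U V W : M.Opens} (h : U ≤ V) (h' : V ≤ W) (s : Γ(L, W)) :
    resSection L h (resSection L h' s) = resSection L (h.trans h') s :=
  congr($((L.presheaf.map_comp (homOfLE h').op (homOfLE h).op).symm) s)

lemma resSection_self {U : M.Opens} (h : U ≤ U) (s : Γ(L, U)) : resSection L h s = s :=
  congr($(L.presheaf.map_id (.op U)) s)

lemma resSection_smul {U V : M.Opens} (h : U ≤ V) (r : Γ(M, V)) (s : Γ(L, V)) :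
    resSection L h (r • s) = resO h r • resSection L h s :=
  Modules.map_smul L (homOfLE h) r s

lemma resSection_add {U V : M.Opens} (h : U ≤ V) (s s' : Γ(L, V)) :
    resSection L h (s + s') = resSection L h s + resSection L h s' :=
  map_add (L.presheaf.map (homOfLE h).op).hom s s'

lemma IsFrame.res {U V : M.Opens} {e : Γ(L, U)} (he : IsFrame L U e) (h : V ≤ U) :
    IsFrame L V (resSection L h e) := by
  intro W hW
  rw [resSection_resSection]
  exact he W _

lemma IsFrame.bijective {U : M.Opens} {e : Γ(L, U)} (he : IsFrame L U e) :
    Function.Bijective fun r : Γ(M, U) ↦ r • e := by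
  have := he U le_rfl
  rwa [resSection_self] at this

lemma IsFrame.exists_smul {U : M.Opens} {e : Γ(L, U)} (he : IsFrame L U e) (s : Γ(L, U)) :
    ∃ r : Γ(M, U), s = r • e := by
  obtain ⟨r, hr⟩ := he.bijective.2 s
  exact ⟨r, hr.symm⟩

variable (L) in
/-- An affine open set on which the line bundle is trivial. -/
def IsFramed (U : M.AffineZariskiSite) : Prop := ∃ e : Γ(L, U.toOpens), IsFrame L U.toOpens e

lemma IsFramed.res {U V : M.AffineZariskiSite} (h : V ≤ U) : IsFramed L U → IsFramed L V :=
  fun ⟨_, he⟩ ↦ ⟨_, he.res (azs_mono h)⟩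

lemma IsLineBundle.exists_isFramed (hL : IsLineBundle L) (U : M.AffineZariskiSite) (x : M)
    (hx : x ∈ U.toOpens) : ∃ V ≤ U, IsFramed L V ∧ x ∈ V.toOpens := by
  obtain ⟨W, e, hxW, he⟩ := hL x
  obtain ⟨f, hf, hxf⟩ := U.2.exists_basicOpen_le ⟨x, hxW⟩ hx
  exact ⟨U.basicOpen f, U.basicOpen_le f, ⟨_, he.res hf⟩, hxf⟩

variable (k : Type u) [CommRing k] [M.Over (Spec (.of k))]

variable [LocallyOfFinitePresentation (M ↘ Spec (.of k))]

/-- An operator of order at most one on the sections over a basic open subset `D(f)` extends over a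
given open set on which the line bundle is trivial, after multiplication by a power of `f`. -/
lemma exists_local_operator (U V' : M.AffineZariskiSite) (f : Γ(M, U.toOpens)) (hV' : V' ≤ U)
    {e : Γ(L, (U.basicOpen f).toOpens)} (he : IsFrame L _ e) (c : Γ(M, (U.basicOpen f).toOpens))
    (D : Tangent k Γ(M, (U.basicOpen f).toOpens)) (hfr : IsFramed L V') :
    ∃ (n : ℕ) (χ : Γ(L, U.toOpens) → Γ(M, V'.toOpens)),
      ∀ (s : Γ(L, U.toOpens)) (b : Γ(M, (U.basicOpen f).toOpens)),
        resSection L (azs_mono (U.basicOpen_le f)) s = b • e →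
        resO (azs_mono (V'.basicOpen_le (resO (azs_mono hV') f))) (χ s) =
          resO (azs_mono (basicOpen_resO_le hV' f))
            (resO (azs_mono (U.basicOpen_le f)) f ^ n *
              (b * c + D (KaehlerDifferential.D k _ b))) := by
  obtain ⟨e', he'⟩ := hfr
  let V := U.basicOpen f
  let r := resO (azs_mono hV') f
  let W := V'.basicOpen r
  have hWV : W ≤ V := basicOpen_resO_le hV' f
  have hWV' : W ≤ V' := V'.basicOpen_le r
  -- Here `e' = w e` on the overlap. With `b = β w`, the operator `b ↦ b c + D b` becomes `β ↦ β (w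
  -- c + D w) + w D β`; the function `w c + D w` and the vector field `w D` are extended to `V'`
  -- separately.
  obtain ⟨w, hw⟩ := (he.res (azs_mono hWV)).exists_smul (resSection L (azs_mono hWV') e')
  let ρ := resHom k (M := M) (azs_mono hWV)
  let ρ' := resHom k (M := M) (azs_mono hWV')
  let D' : Tangent k Γ(M, W.toOpens) := tangentRes ρ (formallyEtale_resHom k hWV) D
  have hD' : ∀ a, D' (KaehlerDifferential.D k _ (ρ a)) = ρ (D (KaehlerDifferential.D k _ a)) :=
    tangentRes_apply _ _ D
  have hloc := isLocalization_res hWV' r rfl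
  have := finitePresentation_kaehler k M V'
  obtain ⟨n, D₁, hD₁⟩ := (isLocalizedModule_tangentRes ρ' (formallyEtale_resHom k hWV') r hloc).1
    (w • D')
  obtain ⟨m, c₁, hc₁⟩ : ∃ (m : ℕ) (c₁ : Γ(M, V'.toOpens)),
      ρ' c₁ = ρ' r ^ m * (w * ρ c + D' (KaehlerDifferential.D k _ w)) := by
    let := ρ'.toRingHom.toAlgebra
    have hloc' : IsLocalization.Away r Γ(M, W.toOpens) := hloc
    obtain ⟨⟨a, ⟨_, m, rfl⟩⟩, h⟩ := IsLocalization.surj (Submonoid.powers r)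
      (w * ρ c + D' (KaehlerDifferential.D k _ w))
    refine ⟨m, a, h.symm.trans ?_⟩
    rw [mul_comm]
    exact congrArg (· * _) (map_pow ρ' r m)
  choose β hβ using fun s : Γ(L, U.toOpens) ↦ he'.exists_smul (resSection L (azs_mono hV') s)
  -- The extra factors `r ^ n` and `r ^ m` bring the two extended terms to the common denominator `r
  -- ^ (n + m)`.
  refine ⟨n + m, fun s ↦ r ^ n * (β s * c₁) + r ^ m * D₁ (KaehlerDifferential.D k _ (β s)), ?_⟩
  intro s b hs
  have hbw : ρ b = ρ' (β s) * w := by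
    apply (he.res (azs_mono hWV)).bijective.1
    change resO (azs_mono hWV) b • _ = (resO (azs_mono hWV') (β s) * w) • _
    rw [← resSection_smul, ← hs, mul_smul, ← hw, ← resSection_smul, ← hβ, resSection_resSection,
      resSection_resSection]
  have hr : ρ (resO (azs_mono (U.basicOpen_le f)) f) = ρ' r := by
    change resO _ (resO _ _) = resO _ (resO _ _)
    rw [resO_resO, resO_resO]
  have hD₁' : ρ' (D₁ (KaehlerDifferential.D k _ (β s))) =
      ρ' r ^ n * (w * D' (KaehlerDifferential.D k _ (ρ' (β s)))) := by
    rw [← tangentRes_apply ρ' (formallyEtale_resHom k hWV'), hD₁]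
    rfl
  change ρ' (r ^ n * (β s * c₁) + r ^ m * D₁ (KaehlerDifferential.D k _ (β s))) =
    ρ (resO (azs_mono (U.basicOpen_le f)) f ^ (n + m) * (b * c + D (KaehlerDifferential.D k _ b)))
  simp only [map_add, map_mul, map_pow]
  rw [hc₁, hD₁', hr, ← hD', hbw, tangent_leibniz, pow_add]
  ring

end Frames

end ConormalCycle

namespace ConormalCycle

section Operators

open Scheme

variable {M : Scheme.{u}} {L : M.Modules}

lemma resO_injective [IsIntegral M] {U V : M.Opens} (h : V ≤ U) [Nonempty V] :
    Function.Injective (resO h) :=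
  map_injective_of_isIntegral M (homOfLE h)

lemma subsingleton_of_isEmpty {U : M.Opens} (h : ¬ Nonempty U) : Subsingleton Γ(M, U) := by
  have : U = ⊥ := by
    rw [← TopologicalSpace.Opens.not_nonempty_iff_eq_bot]
    rintro ⟨x, hx⟩
    exact h ⟨x, hx⟩
  exact CommRingCat.subsingleton_of_isTerminal (M.sheaf.isTerminalOfEqEmpty this)

lemma nonempty_inf [IsIntegral M] {U V : M.Opens} (hU : Nonempty U) (hV : Nonempty V) :
    Nonempty (U ⊓ V : M.Opens) := by
  obtain ⟨x, hx⟩ := hU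
  obtain ⟨y, hy⟩ := hV
  obtain ⟨z, hz⟩ := nonempty_preirreducible_inter U.2 V.2 ⟨x, hx⟩ ⟨y, hy⟩
  exact ⟨z, hz⟩

variable (k : Type u) [CommRing k] [M.Over (Spec (.of k))]
  [LocallyOfFinitePresentation (M ↘ Spec (.of k))]

/-- An operator of order at most one on the sections over a basic open subset `D(f)` extends to the
whole affine open set after multiplication by a power of `f`. -/
lemma exists_operator [IsIntegral M] (hL : IsLineBundle L) (U : M.AffineZariskiSite)
    (f : Γ(M, U.toOpens)) {e : Γ(L, (U.basicOpen f).toOpens)} (he : IsFrame L _ e)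
    (hV : Nonempty (U.basicOpen f).toOpens)
    (c : Γ(M, (U.basicOpen f).toOpens)) (D : Tangent k Γ(M, (U.basicOpen f).toOpens)) :
    ∃ (n : ℕ) (ψ : Γ(L, U.toOpens) → Γ(M, U.toOpens)),
      ∀ (s : Γ(L, U.toOpens)) (b : Γ(M, (U.basicOpen f).toOpens)),
        resSection L (azs_mono (U.basicOpen_le f)) s = b • e →
        resO (azs_mono (U.basicOpen_le f)) (ψ s) =
          resO (azs_mono (U.basicOpen_le f)) f ^ n *
            (b * c + D (KaehlerDifferential.D k _ b)) := by
  have hUf := U.basicOpen_le f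
  obtain ⟨t, htP, ht⟩ := (Ideal.span_eq_top_iff_finite _).mp
    (span_basicOpen_eq_top U (P := IsFramed L) (hL.exists_isFramed U))
  choose n χ hχ using fun g : t ↦
    exists_local_operator k U (U.basicOpen g.1) f (U.basicOpen_le g.1) he c D (htP g.2)
  let N := ∑ g : t, n g
  let V := U.basicOpen f
  let V' : t → M.AffineZariskiSite := fun g ↦ U.basicOpen g.1
  let r : ∀ g : t, Γ(M, (V' g).toOpens) := fun g ↦ resO (azs_mono (U.basicOpen_le g.1)) f
  let W : t → M.AffineZariskiSite := fun g ↦ (V' g).basicOpen (r g)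
  have hWV : ∀ g, W g ≤ V := fun g ↦ basicOpen_resO_le (U.basicOpen_le g.1) f
  have hWV' : ∀ g, W g ≤ V' g := fun g ↦ (V' g).basicOpen_le (r g)
  have hW : ∀ g, (W g).toOpens = (V' g).toOpens ⊓ V.toOpens := fun g ↦ M.basicOpen_res f _
  have hr : ∀ g, resO (azs_mono (hWV' g)) (r g) =
      resO (azs_mono (hWV g)) (resO (azs_mono hUf) f) := by
    intro g
    rw [resO_resO, resO_resO]
  -- The local extensions are rescaled to the common exponent `N`, since otherwise they would not
  -- agree on overlaps.
  let χ' : ∀ g : t, Γ(L, U.toOpens) → Γ(M, (V' g).toOpens) :=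
    fun g s ↦ r g ^ (N - n g) * χ g s
  have hχ' : ∀ (g : t) (s : Γ(L, U.toOpens)) (b : Γ(M, V.toOpens)),
      resSection L (azs_mono hUf) s = b • e →
      resO (azs_mono (hWV' g)) (χ' g s) = resO (azs_mono (hWV g))
        (resO (azs_mono hUf) f ^ N * (b * c + D (KaehlerDifferential.D k _ b))) := by
    intro g s b hs
    have hN : N = (N - n g) + n g :=
      (Nat.sub_add_cancel (Finset.single_le_sum (fun _ _ ↦ Nat.zero_le _) (Finset.mem_univ g))).symm
    change resO (azs_mono (hWV' g)) (r g ^ (N - n g) * χ g s) = _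
    rw [map_mul, map_pow, hr, hχ g s b hs, ← map_pow, ← map_mul, ← mul_assoc, ← pow_add, ← hN]
  have hcov : U.toOpens ≤ ⨆ g, (V' g).toOpens := U.2.self_le_iSup_basicOpen_iff.mpr ht
  have hglue : ∀ s : Γ(L, U.toOpens), ∃ a : Γ(M, U.toOpens),
      ∀ g, resO (azs_mono (U.basicOpen_le g.1)) a = χ' g s := by
    intro s
    obtain ⟨b, hb⟩ := he.exists_smul (resSection L (azs_mono hUf) s)
    obtain ⟨a, ha, -⟩ := M.sheaf.existsUnique_gluing' (fun g ↦ (V' g).toOpens) U.toOpens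
      (fun g ↦ homOfLE (azs_mono (U.basicOpen_le g.1))) hcov (fun g ↦ χ' g s) (by
        intro g g'
        change resO (inf_le_left : (V' g).toOpens ⊓ (V' g').toOpens ≤ _) (χ' g s) =
          resO (inf_le_right : (V' g).toOpens ⊓ (V' g').toOpens ≤ _) (χ' g' s)
        by_cases hne : Nonempty ((V' g).toOpens ⊓ (V' g').toOpens : M.Opens)
        swap
        · have := subsingleton_of_isEmpty hne
          exact Subsingleton.elim _ _
        -- Two local values are compared on `D(f)`, where both equal `f ^ N (b c + D b)`.
        -- Irreducibility keeps the intersection nonempty, and integrality makes the restriction to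
        -- it injective.
        have := nonempty_inf hne hV
        apply resO_injective (inf_le_left :
          ((V' g).toOpens ⊓ (V' g').toOpens) ⊓ V.toOpens ≤ (V' g).toOpens ⊓ (V' g').toOpens)
        have h1 : ((V' g).toOpens ⊓ (V' g').toOpens) ⊓ V.toOpens ≤ (W g).toOpens :=
          (inf_le_inf_right _ inf_le_left).trans (hW g).ge
        have h2 : ((V' g).toOpens ⊓ (V' g').toOpens) ⊓ V.toOpens ≤ (W g').toOpens :=
          (inf_le_inf_right _ inf_le_right).trans (hW g').ge
        rw [resO_resO, resO_resO]
        have h3 := congrArg (resO h1) (hχ' g s b hb)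
        have h4 := congrArg (resO h2) (hχ' g' s b hb)
        rw [resO_resO, resO_resO] at h3 h4
        exact h3.trans h4.symm)
    exact ⟨a, ha⟩
  choose ψ hψ using hglue
  refine ⟨N, ψ, fun s b hs ↦ ?_⟩
  obtain ⟨x, hx⟩ := hV
  obtain ⟨g, hxg⟩ := TopologicalSpace.Opens.mem_iSup.mp (hcov (azs_mono hUf hx))
  have : Nonempty (W g).toOpens := ⟨⟨x, (hW g).ge ⟨hxg, hx⟩⟩⟩
  apply resO_injective (azs_mono (hWV g))
  rw [← hχ' g s b hs, ← hψ, resO_resO, resO_resO]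

end Operators

/-! ### The two ideal sheaves on trivializing affine open sets. -/

section FrameIdeals

open Scheme

lemma exists_pow_mem_of_isEmpty {M : Scheme.{u}} [IsIntegral M] {U : M.AffineZariskiSite} {f : Γ(M, U.toOpens)}
    (h : ¬ Nonempty (U.basicOpen f).toOpens) (I : Ideal Γ(M, U.toOpens)) (a : Γ(M, U.toOpens)) :
    ∃ n : ℕ, f ^ n * a ∈ I := by
  have hf : f = 0 := by
    rw [← basicOpen_eq_bot_iff, ← TopologicalSpace.Opens.not_nonempty_iff_eq_bot]
    rintro ⟨x, hx⟩
    exact h ⟨x, hx⟩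
  exact ⟨1, by rw [hf]; simp⟩

variable {M : Scheme.{u}} {L : M.Modules} (F : Γ(L, ⊤)) (k : Type u) [CommRing k]
  [M.Over (Spec (.of k))]

noncomputable instance moduleSections (U : M.Opens) : Module k Γ(L, U) :=
  Module.compHom _ (algebraMap k Γ(M, U))

instance (U : M.Opens) : IsScalarTower k Γ(M, U) Γ(L, U) := ⟨fun c a m ↦ by
  rw [Algebra.smul_def, mul_smul]; rfl⟩

/-- The ideals of functions whose associated ideal sheaf is that of the zero-scheme. -/
noncomputable def zeroIdealAt (U : M.AffineZariskiSite) : Ideal Γ(M, U.toOpens) :=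
  zeroIdeal Γ(M, U.toOpens) (resSection L (le_top : U.toOpens ≤ ⊤) F)

/-- The ideals of functions whose associated ideal sheaf is that of the singularity subscheme. -/
noncomputable def singularityIdealAt (U : M.AffineZariskiSite) : Ideal Γ(M, U.toOpens) :=
  zeroIdeal Γ(M, U.toOpens) (principalPart k Γ(M, U.toOpens)
    (resSection L (le_top : U.toOpens ≤ ⊤) F))

lemma zeroIdealAt_eq {U : M.AffineZariskiSite} {e : Γ(L, U.toOpens)} (he : IsFrame L _ e)
    {f : Γ(M, U.toOpens)} (hf : resSection L (le_top : U.toOpens ≤ ⊤) F = f • e) :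
    zeroIdealAt F U = Ideal.span {f} := by
  rw [zeroIdealAt, hf, zeroIdeal_smul_of_bijective he.bijective]

lemma singularityIdealAt_eq {U : M.AffineZariskiSite} {e : Γ(L, U.toOpens)} (he : IsFrame L _ e)
    {f : Γ(M, U.toOpens)} (hf : resSection L (le_top : U.toOpens ≤ ⊤) F = f • e) :
    singularityIdealAt F k U = jacobianIdeal k f := by
  rw [singularityIdealAt, hf, zeroIdeal_principalPart_smul k he.bijective]

lemma resSection_top {U V : M.AffineZariskiSite} (h : V ≤ U) {e : Γ(L, U.toOpens)}
    {f : Γ(M, U.toOpens)} (hf : resSection L (le_top : U.toOpens ≤ ⊤) F = f • e) :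
    resSection L (le_top : V.toOpens ≤ ⊤) F =
      resO (azs_mono h) f • resSection L (azs_mono h) e := by
  rw [← resSection_smul, ← hf, resSection_resSection]

lemma zeroIdealAt_map {U V : M.AffineZariskiSite} (h : V ≤ U) (hU : IsFramed L U) :
    (zeroIdealAt F U).map (resO (azs_mono h)) = zeroIdealAt F V := by
  obtain ⟨e, he⟩ := hU
  obtain ⟨f, hf⟩ := he.exists_smul (resSection L (le_top : U.toOpens ≤ ⊤) F)
  rw [zeroIdealAt_eq F he hf, zeroIdealAt_eq F (he.res (azs_mono h)) (resSection_top F h hf),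
    Ideal.map_span, Set.image_singleton]

variable [LocallyOfFinitePresentation (M ↘ Spec (.of k))]

lemma singularityIdealAt_map {U V : M.AffineZariskiSite} (h : V ≤ U) (hU : IsFramed L U) :
    (singularityIdealAt F k U).map (resO (azs_mono h)) = singularityIdealAt F k V := by
  obtain ⟨e, he⟩ := hU
  obtain ⟨f, hf⟩ := he.exists_smul (resSection L (le_top : U.toOpens ≤ ⊤) F)
  rw [singularityIdealAt_eq F k he hf,
    singularityIdealAt_eq F k (he.res (azs_mono h)) (resSection_top F h hf)]
  have := finitePresentation_kaehler k M U
  exact jacobianIdeal_map (resHom k (azs_mono h)) h.choose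
    (isLocalization_res h h.choose h.choose_spec) f

variable [IsIntegral M] (hL : IsLineBundle L)

include hL

/-- This supplies the hypothesis `hloc` of `ofIdeals_ideal_eq` for both ideal sheaves. The extended
operator `ψ` sends `F` to `f ^ n a`. It is only a function so far; additivity, `k`-linearity and the
order one relation hold on `D(f)`, hence on `U` by injectivity of restriction. When `D = 0` it is
linear over the functions, so that already the zero ideal contains `f ^ n a`. -/
lemma exists_operator_mem (U : M.AffineZariskiSite)
    (f : Γ(M, U.toOpens)) {e : Γ(L, (U.basicOpen f).toOpens)} (he : IsFrame L _ e)
    (hV : Nonempty (U.basicOpen f).toOpens)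
    {b : Γ(M, (U.basicOpen f).toOpens)}
    (hb : resSection L (le_top : (U.basicOpen f).toOpens ≤ ⊤) F = b • e)
    (c : Γ(M, (U.basicOpen f).toOpens)) (D : Tangent k Γ(M, (U.basicOpen f).toOpens))
    (a : Γ(M, U.toOpens)) (ha : resO (azs_mono (U.basicOpen_le f)) a =
      b * c + D (KaehlerDifferential.D k _ b)) :
    (∃ n : ℕ, f ^ n * a ∈ singularityIdealAt F k U) ∧
      (D = 0 → ∃ n : ℕ, f ^ n * a ∈ zeroIdealAt F U) := by
  obtain ⟨n, ψ, hψ⟩ := exists_operator k hL U f he hV c D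
  have hinj := resO_injective (azs_mono (U.basicOpen_le f))
  choose β hβ using fun s : Γ(L, U.toOpens) ↦
    he.exists_smul (resSection L (azs_mono (U.basicOpen_le f)) s)
  have hβu : ∀ s b, resSection L (azs_mono (U.basicOpen_le f)) s = b • e → β s = b := by
    intro s b hb
    exact he.bijective.1 ((hβ s).symm.trans hb)
  have hβadd : ∀ s s', β (s + s') = β s + β s' := fun s s' ↦
    hβu _ _ (by rw [resSection_add, hβ, hβ s', add_smul])
  have hβsmul : ∀ (r : Γ(M, U.toOpens)) s,
      β (r • s) = resO (azs_mono (U.basicOpen_le f)) r * β s := fun r s ↦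
    hβu _ _ (by rw [resSection_smul, hβ, mul_smul])
  have hψβ : ∀ s, resO (azs_mono (U.basicOpen_le f)) (ψ s) =
      resO (azs_mono (U.basicOpen_le f)) f ^ n *
        (β s * c + D (KaehlerDifferential.D k _ (β s))) := fun s ↦ hψ s _ (hβ s)
  have hψF : ψ (resSection L le_top F) = f ^ n * a := by
    apply hinj
    rw [hψ _ b (by rw [resSection_resSection, hb]), map_mul, map_pow, ha]
  have hadd : ∀ s s', ψ (s + s') = ψ s + ψ s' := by
    intro s s'
    apply hinj
    rw [map_add, hψβ, hψβ, hψβ, hβadd, map_add, map_add]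
    ring
  constructor
  · refine ⟨n, mem_zeroIdeal.mpr ⟨principalPartsLift k
      { toFun := ψ
        map_add' := hadd
        map_smul' := fun r s ↦ ?_ } ?_, ?_⟩⟩
    · apply hinj
      rw [RingHom.id_apply, Algebra.smul_def, map_mul, hψβ, hψβ, ← algebraMap_smul Γ(M, U.toOpens),
        hβsmul, tangent_leibniz]
      have : resO (azs_mono (U.basicOpen_le f)) (algebraMap k _ r) = algebraMap k _ r :=
        (resHom k (azs_mono (U.basicOpen_le f))).commutes r
      rw [this, tangent_algebraMap]
      ring
    · intro x y m
      apply hinj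
      simp only [LinearMap.coe_mk, AddHom.coe_mk, map_add, map_sub, map_mul, map_zero]
      rw [hψβ, hψβ, hψβ, hψβ, hβsmul, hβsmul, hβsmul, map_mul (resO _) x y]
      linear_combination (resO (azs_mono (U.basicOpen_le f)) f ^ n) *
        operator_rel k D c (resO (azs_mono (U.basicOpen_le f)) x)
          (resO (azs_mono (U.basicOpen_le f)) y) (β m)
    · rw [principalPartsLift_principalPart]
      exact hψF
  · rintro rfl
    refine ⟨n, mem_zeroIdeal.mpr ⟨
      { toFun := ψ
        map_add' := hadd
        map_smul' := fun r s ↦ ?_ }, hψF⟩⟩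
    apply hinj
    rw [RingHom.id_apply, smul_eq_mul, map_mul, hψβ, hψβ, hβsmul]
    simp only [LinearMap.zero_apply, add_zero]
    ring

include k in
theorem zeroIdealSheaf_ideal (U : M.AffineZariskiSite) (hU : IsFramed L U) :
    (zeroIdealSheaf L F).ideal ⟨U.1, U.2⟩ = zeroIdealAt F U := by
  refine ofIdeals_ideal_eq (zeroIdealAt F) (IsFramed L) hL.exists_isFramed (fun h ↦ IsFramed.res h)
    (fun h ↦ zeroIdealAt_map F h) ?_ U hU
  rintro U f ⟨e, he⟩ a ha
  by_cases hV : Nonempty (U.basicOpen f).toOpens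
  swap
  · exact exists_pow_mem_of_isEmpty hV _ _
  obtain ⟨b, hb⟩ := he.exists_smul (resSection L (le_top : (U.basicOpen f).toOpens ≤ ⊤) F)
  rw [zeroIdealAt_eq F he hb, Ideal.mem_span_singleton] at ha
  obtain ⟨c, hc⟩ := ha
  exact (exists_operator_mem F k hL U f he hV hb c 0 a (by rw [hc]; simp)).2 rfl

theorem singularityIdealSheaf_ideal (U : M.AffineZariskiSite) (hU : IsFramed L U) :
    (singularityIdealSheaf L F k).ideal ⟨U.1, U.2⟩ = singularityIdealAt F k U := by
  refine ofIdeals_ideal_eq (singularityIdealAt F k) (IsFramed L) hL.exists_isFramed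
    (fun h ↦ IsFramed.res h) (fun h ↦ singularityIdealAt_map F k h) ?_ U hU
  rintro U f ⟨e, he⟩ a ha
  by_cases hV : Nonempty (U.basicOpen f).toOpens
  swap
  · exact exists_pow_mem_of_isEmpty hV _ _
  obtain ⟨b, hb⟩ := he.exists_smul (resSection L (le_top : (U.basicOpen f).toOpens ≤ ⊤) F)
  rw [singularityIdealAt_eq F k he hb] at ha
  obtain ⟨c, D, hc⟩ := ha
  exact (exists_operator_mem F k hL U f he hV hb c D a hc).1

end FrameIdeals

end ConormalCycle

namespace ConormalCycle

/-! ### The ideal of the singularity subscheme inside the hypersurface. -/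

section ClosedSubscheme

open Scheme

variable {M : Scheme.{u}}

/-- The pulled back ideal is the kernel of a projection from the fibre product of the two
subschemes. The subscheme of `I ⊔ Z` maps to that fibre product, so a lift of a function in this
kernel lies in `I + Z`, and the `Z`-part dies on `Z`. -/
lemma ideal_comap_subschemeι (I Z : M.IdealSheafData) (U : M.affineOpens) :
    (I.comap Z.subschemeι).ideal ⟨Z.subschemeι ⁻¹ᵁ U.1, U.2.preimage Z.subschemeι⟩ =
      (I.ideal U).map (Z.subschemeι.app U.1).hom := by
  apply le_antisymm
  · have h1 : (I.comap Z.subschemeι).map Z.subschemeι ≤ I ⊔ Z := by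
      rw [IdealSheafData.comap, IdealSheafData.map_ker, ← (I ⊔ Z).ker_subschemeι]
      have h2 : (I ⊔ Z).subschemeι =
          pullback.lift (f := Z.subschemeι) (g := I.subschemeι)
            (IdealSheafData.inclusion (le_sup_right : Z ≤ I ⊔ Z))
            (IdealSheafData.inclusion (le_sup_left : I ≤ I ⊔ Z))
            (by rw [IdealSheafData.inclusion_subschemeι, IdealSheafData.inclusion_subschemeι]) ≫
            (pullback.fst Z.subschemeι I.subschemeι ≫ Z.subschemeι) := by
        rw [pullback.lift_fst_assoc, IdealSheafData.inclusion_subschemeι]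
      rw [h2]
      exact Hom.le_ker_comp _ _
    intro b hb
    obtain ⟨a, rfl⟩ := IdealSheafData.subschemeι_app_surjective Z U b
    have h3 : a ∈ ((I.comap Z.subschemeι).map Z.subschemeι).ideal U := by
      rw [IdealSheafData.ideal_map_of_isAffineHom]
      exact hb
    have h4 := h1 U h3
    rw [IdealSheafData.ideal_sup, Pi.sup_apply, Submodule.mem_sup] at h4
    obtain ⟨x, hx, y, hy, rfl⟩ := h4
    rw [← IdealSheafData.ker_subschemeι_app Z U, RingHom.mem_ker] at hy
    refine Eq.subst (motive := fun z ↦ z ∈ (I.ideal U).map (Z.subschemeι.app U.1).hom)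
      ?_ (Ideal.mem_map_of_mem _ hx)
    rw [map_add]
    exact (add_zero _).symm.trans (congrArg _ hy.symm)
  · rw [Ideal.map_le_iff_le_comap]
    have h1 := (IdealSheafData.le_map_comap (J := I) (f := Z.subschemeι)) U
    rwa [IdealSheafData.ideal_map_of_isAffineHom] at h1

end ClosedSubscheme

section HypersurfaceLocal

open Scheme

variable {M : Scheme.{u}} {L : M.Modules} (F : Γ(L, ⊤))

/-- Restriction of functions to the hypersurface. -/
noncomputable def toHyp (U : M.AffineZariskiSite) :
    Γ(M, U.toOpens) →+* Γ(hypersurface L F, (hypersurfaceAffine L F U).toOpens) :=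
  ((hypersurfaceι L F).app U.toOpens).hom

lemma toHyp_surjective (U : M.AffineZariskiSite) : Function.Surjective (toHyp F U) :=
  IdealSheafData.subschemeι_app_surjective (zeroIdealSheaf L F) ⟨U.1, U.2⟩

lemma hypersurfaceAffine_mono {U V : M.AffineZariskiSite} (h : U ≤ V) :
    hypersurfaceAffine L F U ≤ hypersurfaceAffine L F V := by
  obtain ⟨f, hf⟩ := h
  refine ⟨(hypersurfaceι L F).app V.toOpens f, ?_⟩
  refine ((hypersurfaceι L F).preimage_basicOpen f).symm.trans ?_
  exact congrArg ((hypersurfaceι L F) ⁻¹ᵁ ·) hf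

lemma toHyp_resO {U V : M.AffineZariskiSite} (h : U ≤ V) (a : Γ(M, V.toOpens)) :
    toHyp F U (resO (azs_mono h) a) =
      resO (azs_mono (hypersurfaceAffine_mono F h)) (toHyp F V a) :=
  congr($((hypersurfaceι L F).naturality (homOfLE (azs_mono h)).op) a)

variable (k : Type u) [CommRing k] [M.Over (Spec (.of k))]

/-- The ideal of the singularity subscheme on an affine open subset of the hypersurface. -/
noncomputable def singIdeal (U : M.AffineZariskiSite) :
    Ideal Γ(hypersurface L F, (hypersurfaceAffine L F U).toOpens) :=
  (singularityIdeal L F k).ideal ⟨(hypersurfaceAffine L F U).1, (hypersurfaceAffine L F U).2⟩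

variable [LocallyOfFinitePresentation (M ↘ Spec (.of k))] [IsIntegral M] (hL : IsLineBundle L)
  {U : M.AffineZariskiSite} {e : Γ(L, U.toOpens)} (he : IsFrame L _ e)
  {f : Γ(M, U.toOpens)} (hf : resSection L (le_top : U.toOpens ≤ ⊤) F = f • e)

include k hL he hf

lemma toHyp_eq_zero_iff (a : Γ(M, U.toOpens)) : toHyp F U a = 0 ↔ f ∣ a := by
  rw [← Ideal.mem_span_singleton, ← zeroIdealAt_eq F he hf,
    ← zeroIdealSheaf_ideal F k hL U ⟨e, he⟩, ← IdealSheafData.ker_subschemeι_app]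
  exact Iff.rfl

/-- No span is needed: `f` vanishes on `X`, and the image of the Jacobian ideal under the surjective
restriction is an ideal. Thus vector fields map onto the degree one part of the Rees algebra. -/
lemma mem_singIdeal (b : Γ(hypersurface L F, (hypersurfaceAffine L F U).toOpens)) :
    b ∈ singIdeal F k U ↔
      ∃ D : Tangent k Γ(M, U.toOpens), toHyp F U (D (KaehlerDifferential.D k _ f)) = b := by
  have h1 : singIdeal F k U = (jacobianIdeal k f).map (toHyp F U) := by
    rw [← singularityIdealAt_eq F k he hf, ← singularityIdealSheaf_ideal F k hL U ⟨e, he⟩]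
    exact ideal_comap_subschemeι (singularityIdealSheaf L F k) (zeroIdealSheaf L F) ⟨U.1, U.2⟩
  have hf0 : toHyp F U f = 0 := (toHyp_eq_zero_iff F k hL he hf f).mpr dvd_rfl
  rw [h1, Ideal.mem_map_iff_of_surjective _ (toHyp_surjective F U)]
  constructor
  · rintro ⟨_, ⟨c, D, rfl⟩, rfl⟩
    exact ⟨D, by rw [map_add, map_mul, hf0, zero_mul, zero_add]⟩
  · rintro ⟨D, rfl⟩
    exact ⟨_, ⟨0, D, by rw [mul_zero, zero_add]⟩, rfl⟩

end HypersurfaceLocal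

end ConormalCycle

namespace ConormalCycle

/-! ### Morphisms of `Proj`, and the graded homomorphism given by `df`. -/

section GradedSurjective

variable {A B σ τ : Type u} [CommRing A] [CommRing B] [SetLike σ A] [AddSubgroupClass σ A]
  [SetLike τ B] [AddSubgroupClass τ B] {𝒜 : ℕ → σ} {ℬ : ℕ → τ} [GradedRing 𝒜] [GradedRing ℬ]
  {φ φ' : 𝒜 →+*ᵍ ℬ}

lemma exists_homogeneous_of_surjective (h : Function.Surjective φ) {n : ℕ} {b : B}
    (hb : b ∈ ℬ n) : ∃ a ∈ 𝒜 n, φ a = b := by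
  classical
  obtain ⟨a, rfl⟩ := h b
  refine ⟨DirectSum.decompose 𝒜 a n, SetLike.coe_mem _, ?_⟩
  rw [GradedRingHom.map_directSumDecompose 𝒜 ℬ φ, DirectSum.decompose_of_mem_same _ hb]

lemma irrelevant_le_of_surjective (h : Function.Surjective φ) :
    HomogeneousIdeal.irrelevant ℬ ≤ (HomogeneousIdeal.irrelevant 𝒜).map φ := by
  rw [HomogeneousIdeal.irrelevant_le]
  intro i hi b hb
  obtain ⟨a, ha, rfl⟩ := exists_homogeneous_of_surjective h hb
  exact Ideal.mem_map_of_mem _ (HomogeneousIdeal.mem_irrelevant_of_mem 𝒜 hi ha)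

open HomogeneousLocalization in
lemma away_map_surjective (h : Function.Surjective φ) {d : ℕ} {s : A} (hs : s ∈ 𝒜 d) :
    Function.Surjective (Away.map φ s) := by
  intro z
  obtain ⟨n, b, hb, rfl⟩ := Away.mk_surjective ℬ (map_mem φ hs) z
  obtain ⟨a, ha, rfl⟩ := exists_homogeneous_of_surjective h hb
  exact ⟨Away.mk 𝒜 hs n a ha, Away.map_mk φ s hs n a ha⟩

/-- Over the chart `D₊(s)` of the target, the morphism is `Spec` of a surjection of homogeneous
localizations. -/
lemma isClosedImmersion_proj_map (h : Function.Surjective φ)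
    (hφ : HomogeneousIdeal.irrelevant ℬ ≤ (HomogeneousIdeal.irrelevant 𝒜).map φ) :
    IsClosedImmersion (Proj.map φ hφ) := by
  rw [IsZariskiLocalAtTarget.iff_of_openCover (P := @IsClosedImmersion)
    (Proj.affineOpenCover 𝒜).openCover]
  suffices H : ∀ (d : ℕ) (hd : 0 < d) (s : A) (hs : s ∈ 𝒜 d),
      IsClosedImmersion (pullback.snd (Proj.map φ hφ) (Proj.awayι 𝒜 s hs hd)) by
    rintro ⟨⟨d, hd⟩, ⟨s, hs⟩⟩
    exact H d hd s hs
  intro d hd s hs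
  have hp := IsAwayMap.isPullback_awayι φ hφ hd hs
  have : IsClosedImmersion
      (Spec.map (CommRingCat.ofHom (HomogeneousLocalization.Away.map φ s))) :=
    IsClosedImmersion.spec_of_surjective _ (away_map_surjective h hs)
  rw [← hp.flip.isoPullback_inv_snd]
  infer_instance

open HomogeneousLocalization in
/-- Twisting a homomorphism of graded rings by an element of degree zero does not change the morphism
of `Proj`. -/
lemma proj_map_eq_of_twist (u : B) (hu : u ∈ ℬ 0)
    (h : ∀ n, ∀ a ∈ 𝒜 n, φ' a = u ^ n * φ a)
    (hφ : HomogeneousIdeal.irrelevant ℬ ≤ (HomogeneousIdeal.irrelevant 𝒜).map φ)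
    (hφ' : HomogeneousIdeal.irrelevant ℬ ≤ (HomogeneousIdeal.irrelevant 𝒜).map φ') :
    Proj.map φ hφ = Proj.map φ' hφ' := by
  classical
  refine (Proj.mapAffineOpenCover φ' hφ').openCover.hom_ext _ _ ?_
  suffices H : ∀ (d : ℕ) (hd : 0 < d) (s : A) (hs : s ∈ 𝒜 d),
      Proj.awayι ℬ (φ' s) (map_mem φ' hs) hd ≫ Proj.map φ hφ =
        Proj.awayι ℬ (φ' s) (map_mem φ' hs) hd ≫ Proj.map φ' hφ' by
    rintro ⟨⟨d, hd⟩, ⟨s, hs⟩⟩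
    exact H d hd s hs
  intro d hd s hs
  have hu0 : u ^ d ∈ ℬ 0 := by simpa using SetLike.pow_mem_graded d hu
  have hs' : φ' s = φ s * u ^ d := by rw [h d s hs, mul_comm]
  rw [Proj.awayι_comp_map φ' hφ' hd s hs]
  -- Since `φ' s = φ s * u ^ d`, the chart of `φ' s` lies in that of `φ s`. On it the powers of `u`
  -- cancel in fractions of degree zero; `u` need not be a unit, as `hφ'` makes these charts cover.
  have h1 : Proj.awayι ℬ (φ' s) (map_mem φ' hs) hd =
      Spec.map (CommRingCat.ofHom (awayMap ℬ hu0 hs')) ≫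
        Proj.awayι ℬ (φ s) (map_mem φ hs) hd :=
    (Proj.SpecMap_awayMap_awayι ℬ (map_mem φ hs) hd hu0 hs').symm
  rw [h1, Category.assoc, Proj.awayι_comp_map φ hφ hd s hs, ← Category.assoc, ← Spec.map_comp]
  congr 2
  ext z
  obtain ⟨n, a, ha, rfl⟩ := Away.mk_surjective 𝒜 hs z
  change val (awayMap ℬ hu0 hs' (Away.map φ s (Away.mk 𝒜 hs n a ha))) =
    val (Away.map φ' s (Away.mk 𝒜 hs n a ha))
  rw [Away.map_mk, Away.map_mk, awayMap_mk, Away.val_mk, Away.val_mk]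
  congr 1
  rw [h _ a ha, mul_comm, smul_eq_mul, mul_comm n, pow_mul]

end GradedSurjective

section DiffHom

open Polynomial

variable {k A B : Type u} [CommRing k] [CommRing A] [Algebra k A] [CommRing B]

/-- The homomorphism of graded algebras `Sym (Ω[A⁄k]^∨) → ⨁ Jᵐ` sending `D` to the image of `D (df)`
in degree one. -/
noncomputable def diffHom (ψ : A →+* B) (f : A) (J : Ideal B)
    (hJ : ∀ D : Tangent k A, ψ (D (KaehlerDifferential.D k A f)) ∈ J) :
    symDeg A (Tangent k A) →+*ᵍ reesDeg J :=
  symLift (reesDeg J) ((algebraMap B (reesAlgebra J)).comp ψ)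
    { toFun := fun D ↦ reesMonomial J 1 (ψ (D (KaehlerDifferential.D k A f)))
        (by rw [pow_one]; exact hJ D)
      map_zero' := by apply Subtype.ext; simp [reesMonomial]
      map_add' := fun D D' ↦ by apply Subtype.ext; simp [reesMonomial] }
    (fun a D ↦ by
      apply Subtype.ext
      change monomial 1 (ψ (a * D (KaehlerDifferential.D k A f))) =
        C (ψ a) * monomial 1 (ψ (D (KaehlerDifferential.D k A f)))
      rw [C_mul_monomial, map_mul])
    (fun a ↦ SetLike.algebraMap_mem_graded _ _) (fun D ↦ reesMonomial_mem J 1 _ (by rw [pow_one]; exact hJ D))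

variable (ψ : A →+* B) (f : A) (J : Ideal B)
  (hJ : ∀ D : Tangent k A, ψ (D (KaehlerDifferential.D k A f)) ∈ J)

lemma diffHom_algebraMap (a : A) : diffHom ψ f J hJ (algebraMap A _ a) =
    algebraMap B (reesAlgebra J) (ψ a) :=
  symLift_algebraMap (reesDeg J) _ _ _ _ _ a

lemma coe_diffHom_ι (D : Tangent k A) :
    (diffHom ψ f J hJ (SymmetricAlgebra.ι A _ D) : B[X]) =
      monomial 1 (ψ (D (KaehlerDifferential.D k A f))) :=
  congrArg Subtype.val (symLift_ι (reesDeg J) _ _ _ _ _ D)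

/-- The Rees algebra is generated over `B` by `J t`, so surjectivity in degrees zero and one is
enough. -/
lemma diffHom_surjective (hψ : Function.Surjective ψ)
    (hJ' : ∀ b ∈ J, ∃ D : Tangent k A, ψ (D (KaehlerDifferential.D k A f)) = b) :
    Function.Surjective (diffHom ψ f J hJ) := by
  suffices h : ∀ p ∈ Algebra.adjoin B (Submodule.map (monomial 1 : B →ₗ[B] B[X]) J : Set B[X]),
      ∃ x, (diffHom ψ f J hJ x : B[X]) = p by
    intro p
    obtain ⟨x, hx⟩ := h p (by rw [adjoin_monomial_eq_reesAlgebra]; exact p.2)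
    exact ⟨x, Subtype.ext hx⟩
  intro p hp
  induction hp using Algebra.adjoin_induction with
  | mem p hp =>
    obtain ⟨b, hb, rfl⟩ := hp
    obtain ⟨D, rfl⟩ := hJ' b hb
    exact ⟨_, coe_diffHom_ι ψ f J hJ D⟩
  | algebraMap b =>
    obtain ⟨a, rfl⟩ := hψ b
    exact ⟨_, congrArg Subtype.val (diffHom_algebraMap ψ f J hJ a)⟩
  | add p q _ _ hp hq =>
    obtain ⟨x, rfl⟩ := hp
    obtain ⟨y, rfl⟩ := hq
    exact ⟨x + y, by rw [map_add]; rfl⟩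
  | mul p q _ _ hp hq =>
    obtain ⟨x, rfl⟩ := hp
    obtain ⟨y, rfl⟩ := hq
    exact ⟨x * y, by rw [map_mul]; rfl⟩

/-- A homomorphism of graded rings out of a symmetric algebra is the twist of another one by a
unit as soon as this is so in degrees zero and one. -/
lemma twist_of_generators {N T τ : Type u} [AddCommGroup N] [Module A N] [CommRing T]
    [SetLike τ T] [AddSubgroupClass τ T] {𝒯 : ℕ → τ} [GradedRing 𝒯]
    (φ φ' : symDeg A N →+*ᵍ 𝒯) (u : T)
    (h0 : ∀ a, φ' (algebraMap A _ a) = φ (algebraMap A _ a))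
    (h1 : ∀ x, φ' (SymmetricAlgebra.ι A N x) = u * φ (SymmetricAlgebra.ι A N x)) (n : ℕ)
    (a : SymmetricAlgebra A N) (ha : a ∈ symDeg A N n) : φ' a = u ^ n * φ a := by
  unfold symDeg at ha
  induction ha using Submodule.pow_induction_on_left' with
  | algebraMap r => rw [h0, pow_zero, one_mul]
  | add x y i hx hy ihx ihy => rw [map_add, map_add, ihx, ihy, mul_add]
  | mem_mul m hm i x hx ih =>
    obtain ⟨y, rfl⟩ := hm
    rw [map_mul, map_mul, ih, h1, Nat.succ_eq_add_one, pow_succ]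
    ring

end DiffHom

end ConormalCycle

namespace ConormalCycle

/-! ### Gluing morphisms out of a relative `Proj`. -/

section GlueRelProj

open Scheme

variable {X : Scheme.{u}} (𝒮 : GradedQCAlg X)

namespace GradedQCAlg

lemma toBase_preimage (U : X.AffineZariskiSite) :
    𝒮.toBase ⁻¹ᵁ U.toOpens = (𝒮.ι U).opensRange := by
  refine Eq.trans ?_ (𝒮.gluingData.toBase_preimage_eq_opensRange_ι U)
  refine congrArg (𝒮.toBase ⁻¹ᵁ ·) ?_
  exact (Opens.opensRange_ι U.toOpens).symm

lemma mem_range_ι {U : X.AffineZariskiSite} {y : 𝒮.relProj} (h : 𝒮.toBase y ∈ U.toOpens) :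
    ∃ z, 𝒮.ι U z = y := by
  have : y ∈ 𝒮.toBase ⁻¹ᵁ U.toOpens := h
  rw [toBase_preimage] at this
  exact this

lemma toBase_ι_mem {U : X.AffineZariskiSite} (z : Proj (𝒮.deg U)) :
    𝒮.toBase (𝒮.ι U z) ∈ U.toOpens := by
  have : 𝒮.ι U z ∈ 𝒮.toBase ⁻¹ᵁ U.toOpens := by
    rw [toBase_preimage]
    exact ⟨z, rfl⟩
  exact this

variable {I : Type u} [Preorder I] {a : I → X.AffineZariskiSite} (ha : Monotone a)
  (hcov : ∀ x : X, ∃ i, x ∈ (a i).toOpens)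
  (hdir : ∀ i j, ∀ x ∈ (a i).toOpens, x ∈ (a j).toOpens → ∃ l, l ≤ i ∧ l ≤ j ∧ x ∈ (a l).toOpens)
  {Z : Scheme.{u}} (g : ∀ i, Proj (𝒮.deg (a i)) ⟶ Z)
  (hg : ∀ i j (h : i ≤ j), Proj.map (𝒮.map (ha h)) (𝒮.irrelevant_le (ha h)) ≫ g j = g i)

include hcov in
/-- The open cover of the relative `Proj` over a family of affine open sets which cover the base. -/
noncomputable def coverOfFamily : 𝒮.relProj.OpenCover :=
  Cover.mkOfCovers I (fun i ↦ Proj (𝒮.deg (a i))) (fun i ↦ 𝒮.ι (a i))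
    (fun y ↦ by
      obtain ⟨i, hi⟩ := hcov (𝒮.toBase y)
      exact ⟨i, 𝒮.mem_range_ι hi⟩) (fun i ↦ inferInstanceAs (IsOpenImmersion (𝒮.ι (a i))))

include hcov hdir hg in
-- Intersections of the base sets need not belong to the family, so agreement on overlaps is checked
-- near each point: there both inclusions factor through the `Proj` over a smaller member `a l`, on
-- which `hg` identifies the two morphisms.
lemma exists_glue : ∃ G : 𝒮.relProj ⟶ Z, ∀ i, 𝒮.ι (a i) ≫ G = g i := by
  refine ⟨(𝒮.coverOfFamily hcov).glueMorphisms g ?_,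
    fun i ↦ (𝒮.coverOfFamily hcov).ι_glueMorphisms g _ i⟩
  intro i j
  change pullback.fst (𝒮.ι (a i)) (𝒮.ι (a j)) ≫ g i = pullback.snd (𝒮.ι (a i)) (𝒮.ι (a j)) ≫ g j
  refine hom_ext_of_forall _ _ fun p ↦ ?_
  let q : pullback (𝒮.ι (a i)) (𝒮.ι (a j)) ⟶ 𝒮.relProj := pullback.fst _ _ ≫ 𝒮.ι (a i)
  have hq : q = pullback.snd _ _ ≫ 𝒮.ι (a j) := pullback.condition
  have hi : 𝒮.toBase (q p) ∈ (a i).toOpens :=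
    𝒮.toBase_ι_mem (pullback.fst (𝒮.ι (a i)) (𝒮.ι (a j)) p)
  have hj : 𝒮.toBase (q p) ∈ (a j).toOpens := by
    rw [hq]
    exact 𝒮.toBase_ι_mem (pullback.snd (𝒮.ι (a i)) (𝒮.ι (a j)) p)
  obtain ⟨l, hli, hlj, hl⟩ := hdir i j _ hi hj
  let W := q ⁻¹ᵁ (𝒮.ι (a l)).opensRange
  refine ⟨W, 𝒮.mem_range_ι hl, ?_⟩
  have hW : Set.range (W.ι ≫ q) ⊆ Set.range (𝒮.ι (a l)) := by
    rintro _ ⟨w, rfl⟩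
    exact w.2
  let s := IsOpenImmersion.lift (𝒮.ι (a l)) (W.ι ≫ q) hW
  have hs : s ≫ 𝒮.ι (a l) = W.ι ≫ q := IsOpenImmersion.lift_fac _ _ _
  have h1 : W.ι ≫ pullback.fst (𝒮.ι (a i)) (𝒮.ι (a j)) =
      s ≫ Proj.map (𝒮.map (ha hli)) (𝒮.irrelevant_le (ha hli)) := by
    rw [← cancel_mono (𝒮.ι (a i)), Category.assoc, Category.assoc, map_ι, hs]
  have h2 : W.ι ≫ pullback.snd (𝒮.ι (a i)) (𝒮.ι (a j)) =
      s ≫ Proj.map (𝒮.map (ha hlj)) (𝒮.irrelevant_le (ha hlj)) := by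
    rw [← cancel_mono (𝒮.ι (a j)), Category.assoc, Category.assoc, map_ι, hs, hq]
  rw [← Category.assoc, ← Category.assoc, h1, h2, Category.assoc, Category.assoc]
  exact (congrArg (s ≫ ·) (hg l i hli)).trans (congrArg (s ≫ ·) (hg l j hlj)).symm

end GradedQCAlg

end GlueRelProj

end ConormalCycle

/-! ### The local embeddings and their independence of the frame. -/

namespace ConormalCycle

/-- On `X` the term `f dv` of `d(f v)` vanishes. This is why a change of frame only rescales `df`.
-/
lemma map_tangent_mul {k A B : Type u} [CommRing k] [CommRing A] [Algebra k A] [CommRing B]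
    (ψ : A →+* B) {f : A} (hf : ψ f = 0) (v : A) (D : Tangent k A) :
    ψ (D (KaehlerDifferential.D k A (f * v))) = ψ v * ψ (D (KaehlerDifferential.D k A f)) := by
  rw [Derivation.leibniz, map_add, map_add, D.map_smul, D.map_smul, smul_eq_mul, smul_eq_mul, map_mul,
    map_mul, hf, zero_mul, zero_add]

section LocalMorphism

open Scheme Polynomial

variable {M : Scheme.{u}} {L : M.Modules} (F : Γ(L, ⊤)) (k : Type u) [CommRing k]
  [M.Over (Spec (.of k))] [LocallyOfFinitePresentation (M ↘ Spec (.of k))] [IsIntegral M]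
  (hL : IsLineBundle L)

/-- The graded homomorphism `Sym (Ω¹_M)^∨ → ⨁ 𝒥ᵐ` over an affine open set on which `F = f e` for a
frame `e`. -/
noncomputable def localHom {U : M.AffineZariskiSite} {e : Γ(L, U.toOpens)} (he : IsFrame L _ e)
    {f : Γ(M, U.toOpens)} (hf : resSection L (le_top : U.toOpens ≤ ⊤) F = f • e) :
    (symTangent k M).deg U →+*ᵍ
      (rees (hypersurface L F) (singularityIdeal L F k)).deg (hypersurfaceAffine L F U) :=
  diffHom (toHyp F U) f (singIdeal F k U) fun D ↦ (mem_singIdeal F k hL he hf _).mpr ⟨D, rfl⟩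

section

variable {U : M.AffineZariskiSite} {e : Γ(L, U.toOpens)} (he : IsFrame L _ e)
  {f : Γ(M, U.toOpens)} (hf : resSection L (le_top : U.toOpens ≤ ⊤) F = f • e)

lemma localHom_algebraMap (a : Γ(M, U.toOpens)) :
    localHom F k hL he hf (algebraMap Γ(M, U.toOpens)
      (SymmetricAlgebra Γ(M, U.toOpens) (Tangent k Γ(M, U.toOpens))) a) =
      algebraMap _ (reesAlgebra (singIdeal F k U)) (toHyp F U a) :=
  diffHom_algebraMap (toHyp F U) f (singIdeal F k U) _ a

lemma coe_localHom_ι (D : Tangent k Γ(M, U.toOpens)) :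
    (localHom F k hL he hf (SymmetricAlgebra.ι _ _ D)).1 =
      monomial 1 (toHyp F U (D (KaehlerDifferential.D k _ f))) :=
  coe_diffHom_ι (toHyp F U) f (singIdeal F k U) _ D

lemma localHom_surjective : Function.Surjective (localHom F k hL he hf) :=
  diffHom_surjective _ _ _ _ (toHyp_surjective F U) fun b hb ↦ (mem_singIdeal F k hL he hf b).mp hb

lemma localHom_irrelevant_le :
    HomogeneousIdeal.irrelevant
      ((rees (hypersurface L F) (singularityIdeal L F k)).deg (hypersurfaceAffine L F U)) ≤
      (HomogeneousIdeal.irrelevant ((symTangent k M).deg U)).map (localHom F k hL he hf) :=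
  irrelevant_le_of_surjective (localHom_surjective F k hL he hf)

/-- The morphism of `Proj` induced by the differential of a local equation. -/
noncomputable def localProjMap :
    Proj ((rees (hypersurface L F) (singularityIdeal L F k)).deg (hypersurfaceAffine L F U)) ⟶
      Proj ((symTangent k M).deg U) :=
  Proj.map (localHom F k hL he hf) (localHom_irrelevant_le F k hL he hf)

/-- The two equations differ by the transition function `v`, so the graded homomorphisms differ by
the twist `vⁿ` in degree `n`. -/
lemma localProjMap_eq {e' : Γ(L, U.toOpens)} (he' : IsFrame L _ e') {f' : Γ(M, U.toOpens)}
    (hf' : resSection L (le_top : U.toOpens ≤ ⊤) F = f' • e') :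
    localProjMap F k hL he hf = localProjMap F k hL he' hf' := by
  obtain ⟨v, hv⟩ := he'.exists_smul e
  have hff : f' = f * v := he'.bijective.1 (by
    change f' • e' = (f * v) • e'
    rw [← hf', hf, mul_smul, ← hv])
  have hf0 : toHyp F U f = 0 := (toHyp_eq_zero_iff F k hL he hf f).mpr dvd_rfl
  refine proj_map_eq_of_twist (algebraMap _ (reesAlgebra (singIdeal F k U)) (toHyp F U v))
    (SetLike.algebraMap_mem_graded (reesDeg (singIdeal F k U)) _)
    (twist_of_generators _ _ _ (fun a ↦ ?_) (fun D ↦ ?_)) _ _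
  · exact (localHom_algebraMap F k hL he' hf' a).trans (localHom_algebraMap F k hL he hf a).symm
  · apply Subtype.ext
    refine (coe_localHom_ι F k hL he' hf' D).trans ?_
    refine Eq.trans ?_ (congrArg (C (toHyp F U v) * ·) (coe_localHom_ι F k hL he hf D)).symm
    subst hff
    exact (congrArg (monomial 1) (map_tangent_mul (toHyp F U) hf0 v D)).trans C_mul_monomial.symm

lemma localHom_res {V : M.AffineZariskiSite} (h : V ≤ U)
    (a : SymmetricAlgebra Γ(M, U.toOpens) (Tangent k Γ(M, U.toOpens))) :
    (rees (hypersurface L F) (singularityIdeal L F k)).map (hypersurfaceAffine_mono F h)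
        (localHom F k hL he hf a) =
      localHom F k hL (he.res (azs_mono h)) (resSection_top F h hf) ((symTangent k M).map h a) := by
  refine congrFun (congrArg DFunLike.coe (sym_ringHom_ext
    (f := (((rees (hypersurface L F) (singularityIdeal L F k)).map
      (hypersurfaceAffine_mono F h)).comp (localHom F k hL he hf)).toRingHom)
    (g := ((localHom F k hL (he.res (azs_mono h)) (resSection_top F h hf)).comp
      ((symTangent k M).map h)).toRingHom) (fun a ↦ ?_) (fun D ↦ ?_))) a
  · refine (congrArg ((rees (hypersurface L F) (singularityIdeal L F k)).map
      (hypersurfaceAffine_mono F h)) (localHom_algebraMap F k hL he hf a)).trans ?_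
    refine Eq.trans ?_ (congrArg (localHom F k hL (he.res (azs_mono h)) (resSection_top F h hf))
      ((symTangent k M).map_algebraMap h a)).symm
    refine Eq.trans ?_ (localHom_algebraMap F k hL (he.res (azs_mono h))
      (resSection_top F h hf) (resO (azs_mono h) a)).symm
    refine ((rees (hypersurface L F) (singularityIdeal L F k)).map_algebraMap
      (hypersurfaceAffine_mono F h) (toHyp F U a)).trans ?_
    exact congrArg (algebraMap _ (reesAlgebra (singIdeal F k V))) (toHyp_resO F h a).symm
  · apply Subtype.ext
    refine Eq.trans ?_ (congrArg (fun x ↦ (localHom F k hL (he.res (azs_mono h))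
      (resSection_top F h hf) x).1) (symMap_ι (resHom k (azs_mono h)).toRingHom
        (tangentRes (resHom k (azs_mono h)) (formallyEtale_resHom k h)) D)).symm
    refine Eq.trans ?_ (coe_localHom_ι F k hL (he.res (azs_mono h)) (resSection_top F h hf)
      (tangentRes (resHom k (azs_mono h)) (formallyEtale_resHom k h) D)).symm
    refine (congrArg (Polynomial.map (resO (azs_mono (hypersurfaceAffine_mono F h))))
      (coe_localHom_ι F k hL he hf D)).trans ?_
    refine (Polynomial.map_monomial _).trans (congrArg (monomial 1) ?_)
    refine (toHyp_resO F h _).symm.trans (congrArg (toHyp F V) ?_)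
    exact (tangentRes_apply (resHom k (azs_mono h)) (formallyEtale_resHom k h) D f).symm

end

end LocalMorphism

end ConormalCycle

namespace ConormalCycle

/-! ### The glued morphism is a closed embedding over the hypersurface. -/

section ClosedEmbedding

open Scheme

lemma IsLineBundle.exists_mem_isFramed {M : Scheme.{u}} {L : M.Modules} (hL : IsLineBundle L)
    (x : M) : ∃ U : { U : M.AffineZariskiSite // IsFramed L U }, x ∈ U.1.toOpens := by
  obtain ⟨_, ⟨W, hW, rfl⟩, hxW, -⟩ := M.isBasis_affineOpens.exists_subset_of_mem_open
    (Set.mem_univ x) isOpen_univ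
  obtain ⟨V, -, hV, hxV⟩ := hL.exists_isFramed ⟨W, hW⟩ _ hxW
  exact ⟨⟨V, hV⟩, hxV⟩

variable {M : Scheme.{u}} {L : M.Modules} (F : Γ(L, ⊤)) (k : Type u) [CommRing k]
  [M.Over (Spec (.of k))] [LocallyOfFinitePresentation (M ↘ Spec (.of k))] [IsIntegral M]
  (hL : IsLineBundle L)

include hL in
/-- The local morphisms given by the differentials of local equations glue. -/
lemma exists_blowupSing_hom : ∃ G : blowupSing L F k ⟶ projCotangent k M,
    ∀ (U : M.AffineZariskiSite) (e : Γ(L, U.toOpens)) (he : IsFrame L _ e) (f : Γ(M, U.toOpens))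
      (hf : resSection L (le_top : U.toOpens ≤ ⊤) F = f • e),
      (rees (hypersurface L F) (singularityIdeal L F k)).ι (hypersurfaceAffine L F U) ≫ G =
        localProjMap F k hL he hf ≫ (symTangent k M).ι U := by
  have hfr : ∀ U : { U : M.AffineZariskiSite // IsFramed L U },
      ∃ (e : Γ(L, U.1.toOpens)) (f : Γ(M, U.1.toOpens)), IsFrame L _ e ∧
        resSection L (le_top : U.1.toOpens ≤ ⊤) F = f • e := fun ⟨U, e, he⟩ ↦
    ⟨e, (he.exists_smul _).choose, he, (he.exists_smul _).choose_spec⟩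
  choose e f he hf using hfr
  obtain ⟨G, hG⟩ := GradedQCAlg.exists_glue (rees (hypersurface L F) (singularityIdeal L F k))
    (I := { U : M.AffineZariskiSite // IsFramed L U })
    (a := fun U ↦ hypersurfaceAffine L F U.1)
    (fun U V h ↦ hypersurfaceAffine_mono F h)
    (fun x ↦ hL.exists_mem_isFramed (hypersurfaceι L F x))
    (fun U V x hxU hxV ↦ by
      -- A neighbourhood distinguished in both affine sets is required, because the order on the
      -- family is the order of `AffineZariskiSite`.
      obtain ⟨f, g, hfg, hx⟩ := exists_basicOpen_le_affine_inter U.1.2 V.1.2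
        (hypersurfaceι L F x) ⟨hxU, hxV⟩
      exact ⟨⟨U.1.basicOpen f, U.2.res (U.1.basicOpen_le f)⟩, U.1.basicOpen_le f,
        ⟨g, hfg.symm⟩, hx⟩)
    (fun U ↦ localProjMap F k hL (he U) (hf U) ≫ (symTangent k M).ι U.1)
    (fun V U h ↦ by
      -- The frame chosen on `V` is unrelated to the one chosen on `U`; it is first replaced by the
      -- restriction of the latter.
      have h1 := localProjMap_eq F k hL (he V) (hf V) ((he U).res (azs_mono h))
        (resSection_top F h (hf U))
      rw [h1, ← (symTangent k M).map_ι h, ← Category.assoc, ← Category.assoc]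
      congr 1
      refine (Proj.map_comp _ _ _ _).symm.trans (Eq.trans ?_ (Proj.map_comp _ _ _ _))
      exact GradedQCAlg.proj_map_congr
        (GradedRingHom.ext (localHom_res F k hL (he U) (hf U) h)) _ _)
  refine ⟨G, fun U e' he' f' hf' ↦ (hG ⟨U, e', he'⟩).trans ?_⟩
  exact congrArg (· ≫ (symTangent k M).ι U) (localProjMap_eq F k hL _ _ he' hf')

end ClosedEmbedding

end ConormalCycle

namespace ConormalCycle

lemma isClosedImmersion_pullback_snd {P X Y Z : Scheme.{u}} {fst : P ⟶ X} {snd : P ⟶ Y} {f : X ⟶ Z}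
    {g : Y ⟶ Z} (h : IsPullback fst snd f g) (hs : IsClosedImmersion snd) :
    IsClosedImmersion (pullback.snd f g) := by
  rw [← h.isoPullback_inv_snd]
  infer_instance

section ClosedEmbedding

open Scheme

variable {M : Scheme.{u}} {L : M.Modules} (F : Γ(L, ⊤)) (k : Type u) [CommRing k]
  [M.Over (Spec (.of k))] [LocallyOfFinitePresentation (M ↘ Spec (.of k))] [IsIntegral M]
  (hL : IsLineBundle L)

variable {F k hL} in
lemma localProjMap_projToSpec {U : M.AffineZariskiSite} {e : Γ(L, U.toOpens)} (he : IsFrame L _ e)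
    {f : Γ(M, U.toOpens)} (hf : resSection L (le_top : U.toOpens ≤ ⊤) F = f • e) :
    localProjMap F k hL he hf ≫ projToSpec ((symTangent k M).deg U) =
      projToSpec ((rees (hypersurface L F) (singularityIdeal L F k)).deg
        (hypersurfaceAffine L F U)) ≫ Spec.map (CommRingCat.ofHom (toHyp F U)) :=
  map_projToSpec (toHyp F U) (localHom F k hL he hf) (localHom_irrelevant_le F k hL he hf)
    (localHom_algebraMap F k hL he hf)

variable {G : blowupSing L F k ⟶ projCotangent k M}
  (hG : ∀ (U : M.AffineZariskiSite) (e : Γ(L, U.toOpens)) (he : IsFrame L _ e)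
    (f : Γ(M, U.toOpens)) (hf : resSection L (le_top : U.toOpens ≤ ⊤) F = f • e),
      (rees (hypersurface L F) (singularityIdeal L F k)).ι (hypersurfaceAffine L F U) ≫ G =
        localProjMap F k hL he hf ≫ (symTangent k M).ι U)

include hG

lemma hom_toBase : G ≫ (symTangent k M).toBase = blowupSingπ L F k ≫ hypersurfaceι L F := by
  refine ((rees (hypersurface L F) (singularityIdeal L F k)).coverOfFamily
    (a := fun U : { U : M.AffineZariskiSite // IsFramed L U } ↦ hypersurfaceAffine L F U.1)
    (fun x ↦ hL.exists_mem_isFramed (hypersurfaceι L F x))).hom_ext _ _ ?_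
  rintro ⟨U, e, he⟩
  obtain ⟨f, hf⟩ := he.exists_smul (resSection L (le_top : U.toOpens ≤ ⊤) F)
  change (rees (hypersurface L F) (singularityIdeal L F k)).ι (hypersurfaceAffine L F U) ≫ _ =
    (rees (hypersurface L F) (singularityIdeal L F k)).ι (hypersurfaceAffine L F U) ≫ _
  refine (Category.assoc _ _ _).symm.trans ?_
  refine (congrArg (· ≫ (symTangent k M).toBase) (hG U e he f hf)).trans ?_
  refine (Category.assoc _ _ _).trans ?_
  refine (congrArg (localProjMap F k hL he hf ≫ ·) ((symTangent k M).ι_toBase U)).trans ?_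
  refine (Category.assoc _ _ _).symm.trans ?_
  refine (congrArg (· ≫ U.2.fromSpec) (localProjMap_projToSpec he hf)).trans ?_
  refine Eq.trans ?_ (Category.assoc _ _ _)
  refine Eq.trans ?_ (congrArg (· ≫ hypersurfaceι L F)
    ((rees (hypersurface L F) (singularityIdeal L F k)).ι_toBase (hypersurfaceAffine L F U))).symm
  refine (Category.assoc _ _ _).trans (Eq.trans ?_ (Category.assoc _ _ _).symm)
  refine congrArg (projToSpec _ ≫ ·) ?_
  refine Eq.trans ?_ (IsAffineOpen.SpecMap_appLE_fromSpec (hypersurfaceι L F) U.2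
    (hypersurfaceAffine L F U).2 le_rfl)
  refine congrArg (Spec.map · ≫ U.2.fromSpec) ?_
  exact Scheme.Hom.app_eq_appLE (hypersurfaceι L F) (U := U.toOpens)

/-- Since `G` lies over `M`, the preimage of the chart over `U` is the whole chart over `X ∩ U`.
This lets closedness of `G` be tested on the local morphisms. -/
lemma isPullback_localProjMap {U : M.AffineZariskiSite} {e : Γ(L, U.toOpens)}
    (he : IsFrame L _ e) {f : Γ(M, U.toOpens)}
    (hf : resSection L (le_top : U.toOpens ≤ ⊤) F = f • e) :
    IsPullback (localProjMap F k hL he hf)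
      ((rees (hypersurface L F) (singularityIdeal L F k)).ι (hypersurfaceAffine L F U))
      ((symTangent k M).ι U) G := by
  refine IsOpenImmersion.isPullback _ _ _ _ (hG U e he f hf) ?_
  refine Eq.trans ?_ ((rees (hypersurface L F) (singularityIdeal L F k)).toBase_preimage
    (hypersurfaceAffine L F U))
  refine (congrArg (G ⁻¹ᵁ ·) ((symTangent k M).toBase_preimage U)).symm.trans ?_
  exact congrArg (· ⁻¹ᵁ U.toOpens) (hom_toBase F k hL hG)

lemma isClosedImmersion_hom : IsClosedImmersion G := by
  refine (IsZariskiLocalAtTarget.iff_of_openCover (P := @IsClosedImmersion) (f := G)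
    ((symTangent k M).coverOfFamily
      (a := fun U : { U : M.AffineZariskiSite // IsFramed L U } ↦ U.1)
      hL.exists_mem_isFramed)).mpr ?_
  suffices H : ∀ U : M.AffineZariskiSite, IsFramed L U →
      IsClosedImmersion (pullback.snd G ((symTangent k M).ι U)) from fun U ↦ H U.1 U.2
  rintro U ⟨e, he⟩
  obtain ⟨f, hf⟩ := he.exists_smul (resSection L (le_top : U.toOpens ≤ ⊤) F)
  have hp := isPullback_localProjMap F k hL hG he hf
  exact isClosedImmersion_pullback_snd hp.flip
    (isClosedImmersion_proj_map (localHom_surjective F k hL he hf) _)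

/-- The morphism from the blow-up to the restriction of `P(T^*M)` to the hypersurface. -/
noncomputable def liftRestrict : blowupSing L F k ⟶ projCotangentRestrict L F k :=
  pullback.lift G (blowupSingπ L F k) (hom_toBase F k hL hG)

lemma liftRestrict_restrictToProjCotangent :
    liftRestrict F k hL hG ≫ restrictToProjCotangent L F k = G :=
  pullback.lift_fst _ _ _

lemma liftRestrict_projCotangentRestrictπ :
    liftRestrict F k hL hG ≫ projCotangentRestrictπ L F k = blowupSingπ L F k :=
  pullback.lift_snd _ _ _

/-- The composite with the closed immersion `P(T^*M|_X) ⟶ P(T^*M)`, a base change of `X ⟶ M`, is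
`G`; closed immersions satisfy this cancellation. -/
lemma isClosedImmersion_liftRestrict : IsClosedImmersion (liftRestrict F k hL hG) := by
  have : IsClosedImmersion (restrictToProjCotangent L F k) :=
    inferInstanceAs (IsClosedImmersion (pullback.fst (symTangent k M).toBase (hypersurfaceι L F)))
  have : IsClosedImmersion (liftRestrict F k hL hG ≫ restrictToProjCotangent L F k) := by
    rw [liftRestrict_restrictToProjCotangent]
    exact isClosedImmersion_hom F k hL hG
  exact IsClosedImmersion.of_comp _ (restrictToProjCotangent L F k)

lemma isInducedByDifferential_liftRestrict :
    IsInducedByDifferential L F k (liftRestrict F k hL hG) := by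
  intro U e f he hf
  refine ⟨localHom F k hL he hf, localHom_irrelevant_le F k hL he hf,
    localHom_algebraMap F k hL he hf, coe_localHom_ι F k hL he hf, ?_⟩
  exact (congrArg ((rees (hypersurface L F) (singularityIdeal L F k)).ι
    (hypersurfaceAffine L F U) ≫ ·) (liftRestrict_restrictToProjCotangent F k hL hG)).trans
    (hG U e he f hf)

end ClosedEmbedding

end ConormalCycle

namespace ConormalCycle

/-! ### Nonvanishing of `df` at the generic points of the hypersurface. -/

section Conormal

open scoped TensorProduct

/-- A projective module is a direct summand of a free one, and the coordinates of the free module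
detect nonzero vectors in the fibre. -/
lemma exists_dual_apply_ne_zero {A N κ : Type*} [CommRing A] [AddCommGroup N] [Module A N]
    [Module.Projective A N] [CommRing κ] [Algebra A κ] (x : N) (hx : (1 : κ) ⊗ₜ[A] x ≠ 0) :
    ∃ D : Module.Dual A N, algebraMap A κ (D x) ≠ 0 := by
  by_contra! H
  obtain ⟨s, hs⟩ := Module.projective_def.mp ‹Module.Projective A N›
  refine hx ?_
  rw [← hs x, Finsupp.linearCombination_apply, Finsupp.sum, TensorProduct.tmul_sum]
  refine Finset.sum_eq_zero fun n _ ↦ ?_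
  have h1 : algebraMap A κ (s x n) = 0 := H (Finsupp.lapply n ∘ₗ s)
  rw [id, TensorProduct.tmul_smul, TensorProduct.smul_tmul', ← Algebra.algebraMap_eq_smul_one, h1,
    TensorProduct.zero_tmul]

lemma isField_localization_of_mem_minimalPrimes {B : Type*} [CommRing B] [IsReduced B]
    (P : Ideal B) [P.IsPrime] (hP : P ∈ minimalPrimes B) : IsField (Localization.AtPrime P) := by
  rw [← PrimeSpectrum.subsingleton_iff_isField_of_isReduced]
  exact IsLocalization.subsingleton_primeSpectrum_of_mem_minimalPrimes _ hP _

/-- Formal smoothness of `K` splits the conormal map from `(f)/(f²)` to `K ⊗ Ω[A⁄k]`, so `df = 0` in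
the fibre would give `f ∈ (f²)`. In a domain this makes `f` zero or a unit, and `f` is not a unit
because it dies in the field `K`. -/
lemma one_tmul_D_ne_zero {k A K : Type u} [Field k] [CommRing A] [Algebra k A] [IsDomain A]
    [Algebra.FormallySmooth k A] [Field K] [Algebra k K] [Algebra.FormallySmooth k K] [Algebra A K]
    [IsScalarTower k A K] (hs : Function.Surjective (algebraMap A K)) {f : A} (hf : f ≠ 0)
    (hker : ∀ a, algebraMap A K a = 0 ↔ f ∣ a) :
    (1 : K) ⊗ₜ[A] KaehlerDifferential.D k A f ≠ 0 := by
  intro h0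
  obtain ⟨l, hl⟩ := (Algebra.FormallySmooth.iff_split_injection (R := k) hs).mp inferInstance
  have hf0 : algebraMap A K f = 0 := (hker f).mpr dvd_rfl
  let f' : RingHom.ker (algebraMap A K) := ⟨f, hf0⟩
  have h1 : (RingHom.ker (algebraMap A K)).toCotangent f' = 0 := by
    have := congr($hl ((RingHom.ker (algebraMap A K)).toCotangent f'))
    rw [LinearMap.comp_apply, KaehlerDifferential.kerCotangentToTensor_toCotangent, h0,
      map_zero] at this
    exact this.symm
  rw [Ideal.toCotangent_eq_zero] at h1
  change f ∈ _ at h1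
  have h2 : RingHom.ker (algebraMap A K) = Ideal.span {f} := by
    ext a
    rw [RingHom.mem_ker, hker, Ideal.mem_span_singleton]
  rw [h2, Ideal.span_singleton_pow, Ideal.mem_span_singleton] at h1
  obtain ⟨g, hg⟩ := h1
  have h3 : f * (1 - f * g) = 0 := by
    change f = f ^ 2 * g at hg
    linear_combination hg
  rcases mul_eq_zero.mp h3 with h | h
  · exact hf h
  · have := congrArg (algebraMap A K) h
    rw [map_sub, map_one, map_mul, hf0, zero_mul, sub_zero, map_zero] at this
    exact one_ne_zero this

/-- The differential of an equation of a reduced hypersurface in a smooth variety does not vanish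
at the generic points of the hypersurface. -/
lemma exists_tangent_apply_notMem {k A B : Type u} [Field k] [PerfectField k] [CommRing A]
    [Algebra k A] [IsDomain A] [Algebra.Smooth k A] [CommRing B] [IsReduced B] (ψ : A →+* B)
    (hψ : Function.Surjective ψ) {f : A} (hf : f ≠ 0) (hker : ∀ a, ψ a = 0 ↔ f ∣ a)
    (P : Ideal B) (hP : P ∈ minimalPrimes B) :
    ∃ D : Tangent k A, ψ (D (KaehlerDifferential.D k A f)) ∉ P := by
  have := hP.1.1
  let := ψ.toAlgebra
  let : Algebra k B := (ψ.comp (algebraMap k A)).toAlgebra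
  have : IsScalarTower k A B := .of_algebraMap_eq fun _ ↦ rfl
  let 𝔭 : Ideal A := P.comap ψ
  let K := Localization.AtPrime P
  let A' := Localization.AtPrime 𝔭
  let : Field K := (isField_localization_of_mem_minimalPrimes P hP).toField
  let χ : A' →+* K := Localization.localRingHom 𝔭 P ψ rfl
  let : Algebra A' K := χ.toAlgebra
  have hχ : ∀ a, χ (algebraMap A A' a) = algebraMap B K (ψ a) :=
    Localization.localRingHom_to_map 𝔭 P ψ rfl
  have : IsScalarTower A A' K := .of_algebraMap_eq fun a ↦ (hχ a).symm
  have : IsScalarTower k A' K := .of_algebraMap_eq fun a ↦ by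
    rw [IsScalarTower.algebraMap_apply k A A', IsScalarTower.algebraMap_apply k B K]
    exact (hχ _).symm
  have : Algebra.FormallySmooth A A' := .of_isLocalization 𝔭.primeCompl
  have : Algebra.FormallySmooth k A' := .comp k A A'
  have : IsDomain A' := IsLocalization.isDomain_localization (Ideal.primeCompl_le_nonZeroDivisors 𝔭)
  -- The residue field `K` is essentially of finite type over the perfect field `k`, hence formally
  -- smooth over it.
  have : Algebra.FiniteType A B := .of_surjective (Algebra.ofId A B) hψ
  have : Algebra.FiniteType k B := .trans (S := A) inferInstance inferInstance
  have : Algebra.EssFiniteType B K := .of_isLocalization _ P.primeCompl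
  have : Algebra.EssFiniteType k K := .comp k B K
  have hs : Function.Surjective χ := by
    intro z
    obtain ⟨b, s, rfl⟩ := IsLocalization.exists_mk'_eq P.primeCompl z
    obtain ⟨a, rfl⟩ := hψ b
    obtain ⟨t, ht⟩ := hψ s
    have htp : t ∈ 𝔭.primeCompl := fun h ↦ s.2 (by rw [← ht]; exact h)
    refine ⟨IsLocalization.mk' A' a ⟨t, htp⟩, ?_⟩
    refine (Localization.localRingHom_mk' 𝔭 P ψ rfl a ⟨t, htp⟩).trans ?_
    congr 1
    exact Subtype.ext ht
  have hinj : Function.Injective (algebraMap A A') :=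
    IsLocalization.injective _ (Ideal.primeCompl_le_nonZeroDivisors 𝔭)
  have hf' : algebraMap A A' f ≠ 0 := fun h ↦ hf (hinj (h.trans (map_zero _).symm))
  have hker' : ∀ z, χ z = 0 ↔ algebraMap A A' f ∣ z := by
    intro z
    constructor
    · obtain ⟨a, s, rfl⟩ := IsLocalization.exists_mk'_eq 𝔭.primeCompl z
      intro h
      have h1 : algebraMap B K (ψ a) = 0 := by
        rw [← hχ, ← IsLocalization.mk'_spec A' a s, map_mul, h, zero_mul]
      obtain ⟨⟨b, hb⟩, hba⟩ := (IsLocalization.map_eq_zero_iff P.primeCompl K _).mp h1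
      obtain ⟨t, rfl⟩ := hψ b
      rw [← map_mul, hker] at hba
      have ht : IsUnit (algebraMap A A' t) :=
        IsLocalization.map_units A' (⟨t, hb⟩ : 𝔭.primeCompl)
      have hsu : IsUnit (algebraMap A A' s) := IsLocalization.map_units A' s
      rw [← hsu.dvd_mul_right, IsLocalization.mk'_spec, ← ht.dvd_mul_left, ← map_mul]
      exact map_dvd _ hba
    · rintro ⟨w, rfl⟩
      rw [map_mul, hχ, (hker f).mpr dvd_rfl, map_zero, zero_mul]
  have h1 := one_tmul_D_ne_zero (k := k) (A := A') (K := K) hs hf' hker'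
  -- Nonvanishing descends from the local ring `A'` to `A`, where the differentials form a
  -- projective module and a global vector field detects `df`.
  have h2 : (1 : K) ⊗ₜ[A] KaehlerDifferential.D k A f ≠ 0 := by
    intro h0
    refine h1 ?_
    let g : K ⊗[A] Ω[A⁄k] →ₗ[A] K ⊗[A'] Ω[A'⁄k] :=
      TensorProduct.lift ((TensorProduct.mk A' K Ω[A'⁄k]).restrictScalars₁₂ A A |>.compl₂
        (KaehlerDifferential.map k k A A'))
    have := congrArg g h0
    rw [map_zero] at this
    rw [← this]
    change _ = (1 : K) ⊗ₜ[A'] KaehlerDifferential.map k k A A' _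
    rw [KaehlerDifferential.map_D]
  obtain ⟨D, hD⟩ := exists_dual_apply_ne_zero _ h2
  refine ⟨D, fun h ↦ hD ?_⟩
  rw [IsScalarTower.algebraMap_apply A B K]
  change algebraMap B K (ψ _) = 0
  have : ¬ IsUnit (algebraMap B K (ψ (D (KaehlerDifferential.D k A f)))) := by
    rw [IsLocalization.AtPrime.isUnit_to_map_iff K P]
    exact fun h' ↦ h' h
  exact not_not.mp fun h' ↦ this (IsUnit.mk0 _ h')

end Conormal

end ConormalCycle

namespace ConormalCycle

/-! ### Conormal covectors as homogeneous prime ideals. -/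

section KerPoint

variable {A B C σ τ υ : Type u} [CommRing A] [CommRing B] [CommRing C] [SetLike σ A]
  [AddSubgroupClass σ A] [SetLike τ B] [AddSubgroupClass τ B] [SetLike υ C] [AddSubgroupClass υ C]
  {𝒜 : ℕ → σ} {ℬ : ℕ → τ} {𝒞 : ℕ → υ} [GradedRing 𝒜] [GradedRing ℬ] [GradedRing 𝒞]

/-- The point of `Proj` given by the kernel of a homomorphism to a graded domain. -/
noncomputable def kerPoint [IsDomain B] (φ : 𝒜 →+*ᵍ ℬ)
    (h : ∃ n > 0, ∃ a ∈ 𝒜 n, φ a ≠ 0) : Proj 𝒜 where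
  asHomogeneousIdeal := ⟨RingHom.ker φ, fun i a ha ↦ by
    change φ _ = 0
    rw [GradedRingHom.map_directSumDecompose 𝒜 ℬ φ, (ha : φ a = 0), DirectSum.decompose_zero]
    rfl⟩
  isPrime := RingHom.ker_isPrime φ
  not_irrelevant_le H := by
    obtain ⟨n, hn, a, ha, h⟩ := h
    exact h (H (HomogeneousIdeal.mem_irrelevant_of_mem 𝒜 hn ha))

lemma proj_ext {y z : Proj 𝒜}
    (h : y.asHomogeneousIdeal.toIdeal = z.asHomogeneousIdeal.toIdeal) : y = z :=
  ProjectiveSpectrum.ext (HomogeneousIdeal.toIdeal_injective h)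

lemma proj_specializes {y z : Proj 𝒜}
    (h : y.asHomogeneousIdeal.toIdeal ≤ z.asHomogeneousIdeal.toIdeal) : y ⤳ z := by
  rw [specializes_iff_mem_closure]
  exact (ProjectiveSpectrum.le_iff_mem_closure (𝒜 := 𝒜) y z).mp h

end KerPoint

section Conormal

open scoped TensorProduct
open Polynomial

variable {k A B κ : Type u} [CommRing k] [CommRing A] [CommRing B] [Field κ] [Algebra k A]

/-- The conormal sequence `I/I² → B ⊗ Ω[A⁄k] → Ω[B⁄k] → 0` stays exact after tensoring with `κ`, so
the kernel on fibres is spanned by the differentials of functions in the kernel of `A → B`. -/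
lemma mem_span_of_cotangentMap_eq_zero [Algebra k B] [Algebra A B] [IsScalarTower k A B]
    [Algebra A κ] [Algebra B κ] [IsScalarTower A B κ] (hs : Function.Surjective (algebraMap A B))
    (ξ : κ ⊗[A] Ω[A⁄k]) (hξ : cotangentMap k A B κ ξ = 0) :
    ξ ∈ Submodule.span κ { x | ∃ a : A, algebraMap A B a = 0 ∧
      x = (1 : κ) ⊗ₜ[A] KaehlerDifferential.D k A a } := by
  let e := TensorProduct.AlgebraTensorModule.cancelBaseChange A B κ κ Ω[A⁄k]
  obtain ⟨η, rfl⟩ := e.surjective ξ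
  have h1 : (cotangentMap k A B κ).restrictScalars B ∘ₗ e.toLinearMap.restrictScalars B =
      LinearMap.lTensor κ (KaehlerDifferential.mapBaseChange k A B) := by
    refine TensorProduct.ext' fun c y ↦ ?_
    induction y using TensorProduct.induction_on with
    | zero => rw [TensorProduct.tmul_zero, map_zero, map_zero]
    | add y z hy hz => rw [TensorProduct.tmul_add, map_add, map_add, hy, hz]
    | tmul b ω =>
      change cotangentMap k A B κ (e (c ⊗ₜ[B] (b ⊗ₜ[A] ω))) = _
      rw [LinearMap.lTensor_tmul, KaehlerDifferential.mapBaseChange_tmul]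
      change cotangentMap k A B κ ((b • c) ⊗ₜ[A] ω) = _
      change (b • c) • ((1 : κ) ⊗ₜ[B] KaehlerDifferential.map k k A B ω) = _
      rw [TensorProduct.smul_tmul', smul_eq_mul, mul_one, TensorProduct.smul_tmul]
  have h2 : LinearMap.lTensor κ (KaehlerDifferential.mapBaseChange k A B) η = 0 := by
    rw [← h1]
    exact hξ
  obtain ⟨ζ, rfl⟩ := (lTensor_exact (R := B)
    (M := (KaehlerDifferential.mapBaseChange k A B).ker) (N := B ⊗[A] Ω[A⁄k]) (P := Ω[B⁄k]) κ
    (LinearMap.exact_subtype_ker_map (KaehlerDifferential.mapBaseChange k A B))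
    (KaehlerDifferential.mapBaseChange_surjective k A B hs) η).mp h2
  clear hξ h2
  induction ζ using TensorProduct.induction_on with
  | zero => rw [map_zero, map_zero]; exact zero_mem _
  | add y z hy hz => rw [map_add, map_add]; exact add_mem hy hz
  | tmul c y =>
    obtain ⟨y, hy⟩ := y
    have h3 : y ∈ (KaehlerDifferential.kerCotangentToTensor k A B).range := by
      rw [KaehlerDifferential.range_kerCotangentToTensor k A B hs]
      exact hy
    obtain ⟨z, rfl⟩ := h3
    obtain ⟨x, rfl⟩ := Ideal.toCotangent_surjective _ z
    have h4 : e (c ⊗ₜ[B] ((1 : B) ⊗ₜ[A] KaehlerDifferential.D k A x.1)) =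
        c • ((1 : κ) ⊗ₜ[A] KaehlerDifferential.D k A x.1) := by
      change ((1 : B) • c) ⊗ₜ[A] _ = _
      rw [one_smul, TensorProduct.smul_tmul', smul_eq_mul, mul_one]
      rfl
    rw [LinearMap.lTensor_tmul]
    refine Eq.subst (motive := (· ∈ Submodule.span κ _)) h4.symm
      (Submodule.smul_mem _ _ (Submodule.subset_span ⟨x.1, x.2, rfl⟩))

/-- In the application `γ` is `D ↦ D(df)` at the point. When all differentials `da` with `a` in the
kernel are multiples of `γ`, so is every conormal covector. The scalar may a priori vanish; that is
excluded later, using that the ideal belongs to a point of `Proj`. -/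
lemma exists_scalar_of_mem_conormalIdeals (α : A →+* B) (β : B →+* κ)
    (hα : Function.Surjective α) (γ : Tangent k A → κ)
    (hγ : ∀ a, α a = 0 → ∃ c, ∀ D : Tangent k A,
      β (α (D (KaehlerDifferential.D k A a))) = c * γ D)
    {I : Ideal (SymmetricAlgebra A (Tangent k A))} (hI : I ∈ conormalIdeals k α β) :
    ∃ (c : κ) (ev : SymmetricAlgebra A (Tangent k A) →+* κ[X]), I = RingHom.ker ev ∧
      (∀ a, ev (algebraMap A _ a) = C (β (α a))) ∧
      ∀ D, ev (SymmetricAlgebra.ι A _ D) = monomial 1 (c * γ D) := by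
  let := α.toAlgebra
  let := β.toAlgebra
  let := (β.comp α).toAlgebra
  let := (α.comp (algebraMap k A)).toAlgebra
  have : IsScalarTower k A B := .of_algebraMap_eq fun _ ↦ rfl
  have : IsScalarTower A B κ := .of_algebraMap_eq fun _ ↦ rfl
  obtain ⟨ξ, -, hξ, rfl⟩ := hI
  have h1 := mem_span_of_cotangentMap_eq_zero hα ξ hξ
  obtain ⟨c, hc⟩ : ∃ c : κ, ∀ D : Tangent k A, Module.Dual.baseChange κ D ξ = c * γ D := by
    clear hξ
    induction h1 using Submodule.span_induction with
    | mem x hx =>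
      obtain ⟨a, ha, rfl⟩ := hx
      obtain ⟨c, hc⟩ := hγ a ha
      refine ⟨c, fun D ↦ ?_⟩
      rw [← hc, Module.Dual.baseChange_apply_tmul, Algebra.smul_def, mul_one]
      rfl
    | zero => exact ⟨0, fun D ↦ by rw [map_zero, zero_mul]⟩
    | add x y _ _ hx hy =>
      obtain ⟨c, hc⟩ := hx
      obtain ⟨c', hc'⟩ := hy
      exact ⟨c + c', fun D ↦ by rw [map_add, hc, hc', add_mul]⟩
    | smul r x _ hx =>
      obtain ⟨c, hc⟩ := hx
      exact ⟨r * c, fun D ↦ by rw [map_smul, hc, smul_eq_mul, mul_assoc]⟩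
  refine ⟨c, covectorHom k ξ, rfl, fun a ↦ symLiftHom_algebraMap _ _ _ a, fun D ↦ ?_⟩
  rw [← hc]
  exact symLiftHom_ι _ _ _ D

/-- The evaluation at a point of the Rees algebra. -/
noncomputable def reesEval (β : B →+* κ) (J : Ideal B) : reesDeg J →+*ᵍ reesDeg (⊤ : Ideal κ) :=
  reesMap β J ⊤ le_top

/-- The covector is `df` itself: the homomorphism it defines to `κ[t]` factors as `diffHom` followed
by evaluation of the Rees algebra at the point. -/
lemma ker_mem_conormalIdeals (α : A →+* B) (β : B →+* κ) {f : A} (hf : α f = 0) (J : Ideal B)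
    (hJ : ∀ D : Tangent k A, α (D (KaehlerDifferential.D k A f)) ∈ J)
    (hD : ∃ D : Tangent k A, β (α (D (KaehlerDifferential.D k A f))) ≠ 0) :
    (RingHom.ker (reesEval β J)).comap (diffHom α f J hJ) ∈ conormalIdeals k α β := by
  let := α.toAlgebra
  let := β.toAlgebra
  let := (β.comp α).toAlgebra
  let := (α.comp (algebraMap k A)).toAlgebra
  have : IsScalarTower k A B := .of_algebraMap_eq fun _ ↦ rfl
  have : IsScalarTower A B κ := .of_algebraMap_eq fun _ ↦ rfl
  have h1 (D : Tangent k A) : Module.Dual.baseChange κ D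
      ((1 : κ) ⊗ₜ[A] KaehlerDifferential.D k A f) = β (α (D (KaehlerDifferential.D k A f))) := by
    rw [Module.Dual.baseChange_apply_tmul, Algebra.smul_def, mul_one]
    rfl
  refine ⟨(1 : κ) ⊗ₜ[A] KaehlerDifferential.D k A f, fun h ↦ ?_, ?_, ?_⟩
  · obtain ⟨D, hD⟩ := hD
    rw [← h1, h, map_zero] at hD
    exact hD rfl
  · have hf' : algebraMap A B f = 0 := hf
    change (1 : κ) • ((1 : κ) ⊗ₜ[B] KaehlerDifferential.map k k A B
      (KaehlerDifferential.D k A f)) = 0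
    rw [KaehlerDifferential.map_D, hf', map_zero, TensorProduct.tmul_zero,
      smul_zero]
  · have h2 : covectorHom k ((1 : κ) ⊗ₜ[A] KaehlerDifferential.D k A f) =
        (reesAlgebra (⊤ : Ideal κ)).val.toRingHom.comp ((reesEval β J).toRingHom.comp
          (diffHom α f J hJ).toRingHom) := by
      refine sym_ringHom_ext (fun a ↦ ?_) (fun D ↦ ?_)
      · refine (symLiftHom_algebraMap _ _ _ a).trans ?_
        refine Eq.trans ?_ (congrArg (Polynomial.map β ·.1) (diffHom_algebraMap α f J hJ a)).symm
        exact (Polynomial.map_C β).symm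
      · refine (symLiftHom_ι _ _ _ D).trans ?_
        refine Eq.trans ?_ (congrArg (Polynomial.map β) (coe_diffHom_ι α f J hJ D)).symm
        refine Eq.trans ?_ (Polynomial.map_monomial β).symm
        exact congrArg (monomial 1) (h1 D)
    ext a
    rw [RingHom.mem_ker, h2]
    exact (Subtype.ext_iff (a2 := (0 : reesAlgebra (⊤ : Ideal κ))))

end Conormal

end ConormalCycle

namespace ConormalCycle

/-! ### Conormal points lie in the image of the blow-up. -/

section ConormalPoints

open Scheme Polynomial

lemma exists_ι_ne_zero_of_not_irrelevant_le {A N : Type u} [CommRing A] [AddCommGroup N] [Module A N]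
    {T : Type u} [CommRing T] (ev : SymmetricAlgebra A N →+* T) (q : Proj (symDeg A N))
    (hq : q.asHomogeneousIdeal.toIdeal = RingHom.ker ev) :
    ∃ x, ev (SymmetricAlgebra.ι A N x) ≠ 0 := by
  by_contra! H
  refine q.not_irrelevant_le ?_
  rw [HomogeneousIdeal.irrelevant_le]
  intro n hn a ha
  change a ∈ q.asHomogeneousIdeal.toIdeal
  rw [hq, RingHom.mem_ker]
  obtain ⟨m, rfl⟩ : ∃ m, n = m + 1 := ⟨n - 1, by omega⟩
  change a ∈ LinearMap.range (SymmetricAlgebra.ι A N) ^ (m + 1) at ha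
  rw [pow_succ] at ha
  induction ha using Submodule.mul_induction_on' with
  | mem_mul_mem b _ y hy =>
    obtain ⟨x, rfl⟩ := hy
    rw [map_mul, H, mul_zero]
  | add x _ y _ hx hy => rw [map_add, hx, hy, add_zero]

/-- Rescaling a covector by `c` is the substitution `t ↦ c t`; its injectivity says that
proportional covectors define the same point. -/
lemma comp_C_mul_X_injective {κ : Type*} [Field κ] {c : κ} (hc : c ≠ 0) :
    Function.Injective (compRingHom (C c * X)) := by
  refine Function.LeftInverse.injective (g := compRingHom (C c⁻¹ * X)) fun p ↦ ?_
  change (p.comp (C c * X)).comp (C c⁻¹ * X) = p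
  rw [comp_assoc, mul_comp, C_comp, X_comp, ← mul_assoc, ← C_mul, mul_inv_cancel₀ hc, C_1, one_mul,
    comp_X]

variable {M : Scheme.{u}} {L : M.Modules} (F : Γ(L, ⊤)) (k : Type u) [CommRing k]
  [M.Over (Spec (.of k))] [LocallyOfFinitePresentation (M ↘ Spec (.of k))] [IsIntegral M]
  (hL : IsLineBundle L)

/-- The value of a function on the hypersurface at a point. -/
noncomputable def hypEval (U : M.AffineZariskiSite) (x : hypersurface L F)
    (hx : x ∈ (hypersurfaceAffine L F U).toOpens) :
    Γ(hypersurface L F, (hypersurfaceAffine L F U).toOpens) →+* (hypersurface L F).residueField x :=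
  ((hypersurface L F).evaluation (hypersurfaceAffine L F U).toOpens x hx).hom

omit [IsIntegral M] in
lemma hypEval_res {U V : M.AffineZariskiSite} (h : V ≤ U) (x : hypersurface L F)
    (hx : x ∈ (hypersurfaceAffine L F V).toOpens)
    (b : Γ(hypersurface L F, (hypersurfaceAffine L F U).toOpens)) :
    hypEval F V x hx (resO (azs_mono (hypersurfaceAffine_mono F h)) b) =
      hypEval F U x (azs_mono (hypersurfaceAffine_mono F h) hx) b :=
  congrArg ((hypersurface L F).residue x) (TopCat.Presheaf.germ_res_apply
    (hypersurface L F).presheaf (homOfLE (azs_mono (hypersurfaceAffine_mono F h))) x hx b)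

include hL in
-- Conormal points are defined using arbitrary affine `U`, while an equation `f` exists only on a
-- smaller `V`. There `a = f b`, hence `da = b df` along `X`.
lemma toHyp_tangentRes {U V : M.AffineZariskiSite} (h : V ≤ U) {e : Γ(L, V.toOpens)}
    (he : IsFrame L _ e) {f : Γ(M, V.toOpens)}
    (hf : resSection L (le_top : V.toOpens ≤ ⊤) F = f • e) (a : Γ(M, U.toOpens))
    (ha : toHyp F U a = 0) : ∃ b : Γ(M, V.toOpens), ∀ D : Tangent k Γ(M, U.toOpens),
      resO (azs_mono (hypersurfaceAffine_mono F h)) (toHyp F U (D (KaehlerDifferential.D k _ a))) =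
        toHyp F V b * toHyp F V (tangentRes (resHom k (azs_mono h)) (formallyEtale_resHom k h) D
          (KaehlerDifferential.D k _ f)) := by
  have h1 : f ∣ resO (azs_mono h) a := by
    rw [← toHyp_eq_zero_iff F k hL he hf, toHyp_resO F h, ha, map_zero]
  obtain ⟨b, hb⟩ := h1
  refine ⟨b, fun D ↦ ?_⟩
  have hf0 : toHyp F V f = 0 := (toHyp_eq_zero_iff F k hL he hf f).mpr dvd_rfl
  rw [← map_tangent_mul (toHyp F V) hf0, ← hb, ← toHyp_resO F h]
  exact congrArg (toHyp F V) (tangentRes_apply (resHom k (azs_mono h))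
    (formallyEtale_resHom k h) D a).symm

variable {G : blowupSing L F k ⟶ projCotangent k M}
  (hG : ∀ (U : M.AffineZariskiSite) (e : Γ(L, U.toOpens)) (he : IsFrame L _ e)
    (f : Γ(M, U.toOpens)) (hf : resSection L (le_top : U.toOpens ≤ ⊤) F = f • e),
      (rees (hypersurface L F) (singularityIdeal L F k)).ι (hypersurfaceAffine L F U) ≫ G =
        localProjMap F k hL he hf ≫ (symTangent k M).ι U)

/-- The point of the blow-up over a point of the hypersurface outside of the singularity
subscheme. -/
noncomputable def blowupPoint (U : M.AffineZariskiSite) (x : hypersurface L F)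
    (hx : x ∈ (hypersurfaceAffine L F U).toOpens)
    (h : ∃ b ∈ singIdeal F k U, hypEval F U x hx b ≠ 0) :
    Proj ((rees (hypersurface L F) (singularityIdeal L F k)).deg (hypersurfaceAffine L F U)) :=
  kerPoint (reesEval (hypEval F U x hx) (singIdeal F k U)) (by
    obtain ⟨b, hb, h⟩ := h
    refine ⟨1, one_pos, reesMonomial _ 1 b (by rwa [pow_one]), reesMonomial_mem _ _ _ _,
      fun h0 ↦ h ?_⟩
    have h1 := congrArg (fun p : reesAlgebra (⊤ : Ideal ((hypersurface L F).residueField x)) ↦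
      (p : ((hypersurface L F).residueField x)[X]).coeff 1) h0
    change (Polynomial.map (hypEval F U x hx) (monomial 1 b)).coeff 1 = 0 at h1
    rwa [coeff_map, coeff_monomial_same] at h1)

include hG in
-- The covector of a conormal point is `c df(x)`. Being nonzero it forces `c ≠ 0` and `df(x) ≠ 0`,
-- so there is a point of the blow-up over `x`, given by evaluation of the Rees algebra at `x`, and
-- its image is the line of `df(x)`.
lemma conormalPoints_subset_range : conormalPoints k (hypersurfaceι L F) ⊆ Set.range G := by
  rintro p ⟨x, U, hxU, q, -, hq, rfl⟩
  obtain ⟨V, h, ⟨e, he⟩, hxV'⟩ := hL.exists_isFramed U _ hxU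
  have hxV : x ∈ (hypersurfaceAffine L F V).toOpens := hxV'
  obtain ⟨f, hf⟩ := he.exists_smul (resSection L (le_top : V.toOpens ≤ ⊤) F)
  let res := tangentRes (resHom k (azs_mono h)) (formallyEtale_resHom k h)
  obtain ⟨c, ev, hev, hev0, hev1⟩ := exists_scalar_of_mem_conormalIdeals (toHyp F U)
    (hypEval F U x hxU) (toHyp_surjective F U)
    (fun D ↦ hypEval F V x hxV (toHyp F V (res D (KaehlerDifferential.D k _ f))))
    (fun a ha ↦ by
      obtain ⟨b, hb⟩ := toHyp_tangentRes F k hL h he hf a ha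
      refine ⟨hypEval F V x hxV (toHyp F V b), fun D ↦ ?_⟩
      rw [← map_mul, ← hb, hypEval_res F h]) hq
  obtain ⟨D, hD⟩ := exists_ι_ne_zero_of_not_irrelevant_le ev q hev
  rw [hev1] at hD
  -- Nonvanishing of the product yields two facts: the value of `D(df)` puts `x` outside the
  -- singularity subscheme, and `c ≠ 0` makes the rescaling injective.
  have hcD := mt (fun h0 ↦ (congrArg (monomial 1) h0).trans (map_zero _)) hD
  have hne := right_ne_zero_of_mul hcD
  have hc := left_ne_zero_of_mul hcD
  let z := blowupPoint F k V x hxV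
    ⟨_, (mem_singIdeal F k hL he hf _).mpr ⟨res D, rfl⟩, hne⟩
  let θ : SymmetricAlgebra Γ(M, U.toOpens) (Tangent k Γ(M, U.toOpens)) →+*
      ((hypersurface L F).residueField x)[X] :=
    (reesAlgebra (⊤ : Ideal ((hypersurface L F).residueField x))).val.toRingHom.comp
      ((reesEval (hypEval F V x hxV) (singIdeal F k V)).toRingHom.comp
        ((localHom F k hL he hf).toRingHom.comp ((symTangent k M).map h).toRingHom))
  have hθ : ev = (compRingHom (C c * X)).comp θ := by
    refine sym_ringHom_ext (fun a ↦ ?_) (fun D ↦ ?_)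
    · rw [hev0]
      have h1 : θ (algebraMap _ _ a) = C (hypEval F U x hxU (toHyp F U a)) := by
        refine (congrArg (fun y ↦ Polynomial.map (hypEval F V x hxV) (localHom F k hL he hf y).1)
          ((symTangent k M).map_algebraMap h a)).trans ?_
        refine (congrArg (fun y : reesAlgebra _ ↦ Polynomial.map (hypEval F V x hxV) y.1)
          (localHom_algebraMap F k hL he hf (resO (azs_mono h) a))).trans ?_
        refine (Polynomial.map_C _).trans (congrArg C ?_)
        rw [toHyp_resO F h, hypEval_res F h]
      rw [RingHom.comp_apply, h1]
      exact C_comp.symm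
    · rw [hev1]
      have h1 : θ (SymmetricAlgebra.ι _ _ D) = monomial 1
          (hypEval F V x hxV (toHyp F V (res D (KaehlerDifferential.D k _ f)))) := by
        refine (congrArg (fun y ↦ Polynomial.map (hypEval F V x hxV) (localHom F k hL he hf y).1)
          (symMap_ι (resHom k (azs_mono h)).toRingHom res D)).trans ?_
        refine (congrArg (Polynomial.map (hypEval F V x hxV))
          (coe_localHom_ι F k hL he hf (res D))).trans ?_
        exact Polynomial.map_monomial _
      rw [RingHom.comp_apply, h1]
      refine Eq.trans ?_ (monomial_comp 1).symm
      rw [pow_one, ← mul_assoc, ← C_mul, C_mul_X_eq_monomial, mul_comm]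
  have hz : Proj.map ((symTangent k M).map h) ((symTangent k M).irrelevant_le h)
      (localProjMap F k hL he hf z) = q := by
    refine proj_ext (hev.trans ?_).symm
    ext a
    rw [RingHom.mem_ker, hθ, RingHom.comp_apply,
      map_eq_zero_iff _ (comp_C_mul_X_injective hc)]
    exact (Subtype.ext_iff (a2 := (0 : reesAlgebra (⊤ : Ideal
      ((hypersurface L F).residueField x))))).symm
  refine ⟨(rees (hypersurface L F) (singularityIdeal L F k)).ι (hypersurfaceAffine L F V) z, ?_⟩
  refine congr($(hG V e he f hf) z).trans ?_
  refine congr($(((symTangent k M).map_ι h).symm) (localProjMap F k hL he hf z)).trans ?_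
  exact congrArg ((symTangent k M).ι U) hz

end ConormalPoints

end ConormalCycle

namespace ConormalCycle

/-! ### The conormal points are dense in the image of the blow-up. -/

section Generic

/-- As there are finitely many components, removing all the others leaves a nonempty open set inside
`closure {x}`. A dense open set meets it, hence contains its generic point `x`. -/
lemma mem_of_closure_mem_irreducibleComponents {T : Type*} [TopologicalSpace T]
    [TopologicalSpace.NoetherianSpace T] {x : T} (hx : closure {x} ∈ irreducibleComponents T)
    {W : Set T} (hW : IsOpen W) (hd : Dense W) : x ∈ W := by
  let Z : Set T := ⋃ C ∈ irreducibleComponents T \ {closure {x}}, C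
  have hZ : IsClosed Z := TopologicalSpace.NoetherianSpace.finite_irreducibleComponents.sdiff
    |>.isClosed_biUnion fun C hC ↦ isClosed_of_mem_irreducibleComponents C hC.1
  have hxZ : x ∉ Z := by
    intro h
    obtain ⟨C, hC, hxC⟩ := Set.mem_iUnion₂.mp h
    have h1 : closure {x} ⊆ C := (isClosed_of_mem_irreducibleComponents C hC.1).closure_subset_iff.mpr
      (Set.singleton_subset_iff.mpr hxC)
    exact hC.2 (Set.Subset.antisymm (hx.2 hC.1.1 h1) h1)
  obtain ⟨y, hyZ, hyW⟩ := hd.inter_open_nonempty _ hZ.isOpen_compl ⟨x, hxZ⟩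
  have hy : y ∈ closure {x} := by
    by_contra h
    refine hyZ (Set.mem_iUnion₂.mpr ⟨irreducibleComponent y,
      ⟨irreducibleComponent_mem_irreducibleComponents y, fun h' ↦ h ?_⟩, mem_irreducibleComponent⟩)
    rw [← (h' : irreducibleComponent y = _)]
    exact mem_irreducibleComponent
  obtain ⟨_, hw, rfl⟩ := mem_closure_iff.mp hy W hW hyW
  exact hw

lemma exists_smooth_nhds {K : Type u} [Field K] [PerfectField K] {X : Scheme.{u}} [IsReduced X]
    (f : X ⟶ Spec (.of K)) [LocallyOfFiniteType f] {U : X.Opens} (hU : IsAffineOpen U)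
    (P : Spec Γ(X, U)) (hP : P.asIdeal ∈ minimalPrimes Γ(X, U)) :
    ∃ W : X.Opens, hU.fromSpec P ∈ W ∧ Smooth (W.ι ≫ f) := by
  have : IsLocallyNoetherian X := LocallyOfFiniteType.isLocallyNoetherian f
  have : LocallyOfFinitePresentation f :=
    LocallyOfFinitePresentation.iff_locallyOfFiniteType.mpr inferInstance
  have : IsNoetherianRing Γ(X, U) := IsLocallyNoetherian.component_noetherian ⟨U, hU⟩
  refine ⟨f.smoothLocus, ?_, ?_⟩
  · refine mem_of_closure_mem_irreducibleComponents (T := PrimeSpectrum Γ(X, U)) (x := P)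
      (W := hU.fromSpec ⁻¹' f.smoothLocus) ?_ (f.smoothLocus.2.preimage hU.fromSpec.continuous)
      (f.dense_smoothLocus_of_perfectField.preimage hU.fromSpec.isOpenEmbedding.isOpenMap)
    rw [← PrimeSpectrum.vanishingIdeal_mem_minimalPrimes]
    exact Eq.subst (motive := (· ∈ minimalPrimes _))
      (PrimeSpectrum.vanishingIdeal_singleton (P : PrimeSpectrum Γ(X, U))).symm hP
  · rw [← Scheme.Hom.smoothLocus_eq_top_iff, ← Scheme.Hom.preimage_smoothLocus_eq]
    exact Scheme.Opens.ι_preimage_self _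

/-- If for each of the finitely many minimal primes `P` some element with coefficients in `P` were
outside `I`, the product of these would have coefficients in the nilradical, hence be zero, and yet
lie outside the prime `I`. -/
lemma exists_minimalPrime_le {B : Type u} [CommRing B] [IsReduced B] [IsNoetherianRing B]
    (J : Ideal B) (I : Ideal (reesAlgebra J)) (hI : I.IsPrime) : ∃ P ∈ minimalPrimes B,
      ∀ p : reesAlgebra J, (∀ n, (p : Polynomial B).coeff n ∈ P) → p ∈ I := by
  by_contra! H
  choose! p hp hpI using H
  have hfin := minimalPrimes.finite_of_isNoetherianRing B
  have h0 : ∏ P ∈ hfin.toFinset, p P = 0 := by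
    apply Subtype.ext
    ext n
    have h1 : ((∏ P ∈ hfin.toFinset, p P : reesAlgebra J) : Polynomial B).coeff n ∈
        sInf (minimalPrimes B) := by
      rw [Ideal.mem_sInf]
      intro P hP
      have h2 : Polynomial.map (Ideal.Quotient.mk P)
          ((∏ P ∈ hfin.toFinset, p P : reesAlgebra J) : Polynomial B) = 0 := by
        rw [SubmonoidClass.coe_finsetProd, Polynomial.map_prod]
        refine Finset.prod_eq_zero (hfin.mem_toFinset.mpr hP) ?_
        ext m
        rw [Polynomial.coeff_map, Polynomial.coeff_zero, Ideal.Quotient.eq_zero_iff_mem]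
        exact hp P hP m
      rw [← Ideal.Quotient.eq_zero_iff_mem, ← Polynomial.coeff_map, h2, Polynomial.coeff_zero]
    have h3 : sInf (minimalPrimes B) = ⊥ :=
      (Ideal.sInf_minimalPrimes (I := (⊥ : Ideal B))).trans (nilradical_eq_zero B)
    rwa [h3] at h1
  have h4 : ∏ P ∈ hfin.toFinset, p P ∈ I := by rw [h0]; exact zero_mem I
  obtain ⟨P, hP, hPI⟩ := hI.prod_mem_iff.mp h4
  exact hpI P (hfin.mem_toFinset.mp hP) hPI

end Generic

section Equation

open Scheme

variable {M : Scheme.{u}} {L : M.Modules} {F : Γ(L, ⊤)} [IsIntegral M]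

/-- If `F` vanished on one nonempty open set, its equation on every trivializing set would vanish on
a nonempty overlap, hence identically, and `F` would be zero. -/
lemma equation_ne_zero (hL : IsLineBundle L) (hF : F ≠ 0) {U : M.AffineZariskiSite}
    (hU : Nonempty U.toOpens) {e : Γ(L, U.toOpens)} {f : Γ(M, U.toOpens)}
    (hf : resSection L (le_top : U.toOpens ≤ ⊤) F = f • e) : f ≠ 0 := by
  rintro rfl
  rw [zero_smul] at hf
  refine hF ?_
  refine TopCat.Sheaf.eq_of_locally_eq' ⟨L.presheaf, L.isSheaf⟩
    (fun V : { V : M.AffineZariskiSite // IsFramed L V } ↦ V.1.toOpens) ⊤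
    (fun V ↦ homOfLE le_top) (fun x _ ↦ ?_) F 0 fun V ↦ ?_
  · obtain ⟨V, hV⟩ := hL.exists_mem_isFramed x
    exact TopologicalSpace.Opens.mem_iSup.mpr ⟨V, hV⟩
  · obtain ⟨V, e', he'⟩ := V
    obtain ⟨g, hg⟩ := he'.exists_smul (resSection L (le_top : V.toOpens ≤ ⊤) F)
    refine Eq.trans (b := 0) ?_ (map_zero (L.presheaf.map (homOfLE le_top).op).hom).symm
    refine hg.trans ?_
    suffices h : g = 0 by rw [h, zero_smul]
    by_cases hV : Nonempty V.toOpens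
    · have := nonempty_inf hV hU
      have h1 : V.toOpens ⊓ U.toOpens ≤ V.toOpens := inf_le_left
      have h2 : V.toOpens ⊓ U.toOpens ≤ U.toOpens := inf_le_right
      refine resO_injective h1 ?_
      refine (he'.res h1).bijective.1 ?_
      change resO h1 g • resSection L h1 e' = resO h1 0 • resSection L h1 e'
      rw [← resSection_smul, ← hg, resSection_resSection, map_zero, zero_smul,
        ← resSection_resSection h2 le_top, hf]
      exact map_zero (L.presheaf.map (homOfLE h2).op).hom
    · have := subsingleton_of_isEmpty hV
      exact Subsingleton.elim _ _

lemma smooth_sections (k : Type u) [CommRing k] {M : Scheme.{u}} [M.Over (Spec (.of k))]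
    [Smooth (M ↘ Spec (.of k))] (U : M.AffineZariskiSite) :
    Algebra.Smooth k Γ(M, U.toOpens) := by
  have h1 := (M ↘ Spec (.of k)).smooth_appLE (isAffineOpen_top _) U.2
    (by simp : U.1 ≤ (M ↘ Spec (.of k)) ⁻¹ᵁ ⊤)
  have h3 : (ΓSpecIso (.of k)).inv.hom.Smooth :=
    RingHom.Smooth.of_bijective (ConcreteCategory.bijective_of_isIso (ΓSpecIso (.of k)).inv)
  exact h3.comp h1

end Equation

end ConormalCycle

namespace ConormalCycle

section ConormalPoints

open Scheme Polynomial

lemma hypEval_fromSpec_eq_zero_iff {M : Scheme.{u}} {L : M.Modules} (F : Γ(L, ⊤))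
    (U : M.AffineZariskiSite)
    (P : Spec Γ(hypersurface L F, (hypersurfaceAffine L F U).toOpens))
    (hx : (hypersurfaceAffine L F U).2.fromSpec P ∈ (hypersurfaceAffine L F U).toOpens)
    (b : Γ(hypersurface L F, (hypersurfaceAffine L F U).toOpens)) :
    hypEval F U _ hx b = 0 ↔ b ∈ P.asIdeal := by
  refine (Scheme.evaluation_eq_zero_iff_notMem_basicOpen _ _ hx b).trans ?_
  have h1 := (hypersurfaceAffine L F U).2.fromSpec_preimage_basicOpen b
  have h2 : (hypersurfaceAffine L F U).2.fromSpec P ∈ (hypersurface L F).basicOpen b ↔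
      P ∈ PrimeSpectrum.basicOpen b := by
    rw [← h1]
    exact Iff.rfl
  rw [h2]
  exact not_not

variable {M : Scheme.{u}} {L : M.Modules} (F : Γ(L, ⊤)) (k : Type u) [Field k] [PerfectField k]
  [M.Over (Spec (.of k))] [Smooth (M ↘ Spec (.of k))] [IsIntegral M]
  (hL : IsLineBundle L) (hF : F ≠ 0)

variable {G : blowupSing L F k ⟶ projCotangent k M}
  (hG : ∀ (U : M.AffineZariskiSite) (e : Γ(L, U.toOpens)) (he : IsFrame L _ e)
    (f : Γ(M, U.toOpens)) (hf : resSection L (le_top : U.toOpens ≤ ⊤) F = f • e),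
      (rees (hypersurface L F) (singularityIdeal L F k)).ι (hypersurfaceAffine L F U) ≫ G =
        localProjMap F k hL he hf ≫ (symTangent k M).ι U)

include hG hF in
-- `T` consists of the points `[df]` over the generic points of the components of `X ∩ U`, one for
-- each minimal prime. Finiteness is not needed for density but gives the local finiteness of the
-- cycle in `exists_cycle`.
lemma exists_finite_generizations [IsReduced (hypersurface L F)] {U : M.AffineZariskiSite}
    {e : Γ(L, U.toOpens)} (he : IsFrame L _ e) :
    ∃ T ⊆ conormalPoints k (hypersurfaceι L F), T.Finite ∧ ∀ z,
      hypersurfaceι L F (blowupSingπ L F k z) ∈ U.toOpens → ∃ t ∈ T, t ⤳ G z := by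
  by_cases hne : Nonempty U.toOpens
  swap
  · exact ⟨∅, Set.empty_subset _, Set.finite_empty, fun z hz ↦ (hne ⟨⟨_, hz⟩⟩).elim⟩
  obtain ⟨f, hf⟩ := he.exists_smul (resSection L (le_top : U.toOpens ≤ ⊤) F)
  have hf0 := equation_ne_zero hL hF hne hf
  have := smooth_sections k U
  have : IsDomain Γ(M, U.toOpens) := inferInstance
  have : IsNoetherianRing Γ(M, U.toOpens) := Algebra.FiniteType.isNoetherianRing k _
  have : IsNoetherianRing Γ(hypersurface L F, (hypersurfaceAffine L F U).toOpens) :=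
    isNoetherianRing_of_surjective _ _ (toHyp F U) (toHyp_surjective F U)
  have : _root_.IsReduced Γ(hypersurface L F, (hypersurfaceAffine L F U).toOpens) := inferInstance
  have key : ∀ P ∈ minimalPrimes Γ(hypersurface L F, (hypersurfaceAffine L F U).toOpens),
      ∃ t ∈ conormalPoints k (hypersurfaceι L F),
        ∀ y : Proj ((rees (hypersurface L F) (singularityIdeal L F k)).deg
          (hypersurfaceAffine L F U)),
          (∀ p : reesAlgebra (singIdeal F k U), (∀ n, (p : Polynomial _).coeff n ∈ P) →
            p ∈ y.asHomogeneousIdeal.toIdeal) →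
          t ⤳ G ((rees (hypersurface L F) (singularityIdeal L F k)).ι
            (hypersurfaceAffine L F U) y) := by
    intro P hP
    obtain ⟨D, hD⟩ := exists_tangent_apply_notMem (k := k) (toHyp F U) (toHyp_surjective F U) hf0
      (toHyp_eq_zero_iff F k hL he hf) P hP
    let P' : Spec Γ(hypersurface L F, (hypersurfaceAffine L F U).toOpens) := ⟨P, hP.1.1⟩
    let x := (hypersurfaceAffine L F U).2.fromSpec P'
    have hx : x ∈ (hypersurfaceAffine L F U).toOpens := by
      have : x ∈ Set.range (hypersurfaceAffine L F U).2.fromSpec := ⟨P', rfl⟩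
      rwa [IsAffineOpen.range_fromSpec] at this
    have hD' : hypEval F U x hx (toHyp F U (D (KaehlerDifferential.D k _ f))) ≠ 0 := fun h ↦
      hD ((hypEval_fromSpec_eq_zero_iff F U P' hx _).mp h)
    have hb : ∃ b ∈ singIdeal F k U, hypEval F U x hx b ≠ 0 :=
      ⟨_, (mem_singIdeal F k hL he hf _).mpr ⟨D, rfl⟩, hD'⟩
    let w := blowupPoint F k U x hx hb
    refine ⟨G ((rees (hypersurface L F) (singularityIdeal L F k)).ι
      (hypersurfaceAffine L F U) w), ?_, fun y hPy ↦ ?_⟩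
    · refine ⟨x, U, hx, localProjMap F k hL he hf w, ?_, ?_, congr($(hG U e he f hf) w).symm⟩
      · exact exists_smooth_nhds (hypersurfaceι L F ≫ (M ↘ Spec (.of k)))
          (hypersurfaceAffine L F U).2 P' hP
      · exact ker_mem_conormalIdeals (toHyp F U) (hypEval F U x hx)
          ((toHyp_eq_zero_iff F k hL he hf f).mpr dvd_rfl) (singIdeal F k U) _ ⟨D, hD'⟩
    -- The ideal of `w` consists of the elements of the Rees algebra with all coefficients in `P`,
    -- which by `hPy` belong to the ideal of `y`.
    · have hwy : w ⤳ y := by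
        refine proj_specializes fun p hp ↦ hPy p fun n ↦ ?_
        refine (hypEval_fromSpec_eq_zero_iff F U P' hx _).mp ?_
        have h1 : Polynomial.map (hypEval F U x hx) (p.1) = 0 := congrArg Subtype.val hp
        rw [← coeff_map, h1, coeff_zero]
      exact (hwy.map ((rees (hypersurface L F) (singularityIdeal L F k)).ι
        (hypersurfaceAffine L F U)).continuous).map G.continuous
  choose t ht htG using key
  have := (minimalPrimes.finite_of_isNoetherianRing
    Γ(hypersurface L F, (hypersurfaceAffine L F U).toOpens)).to_subtype
  refine ⟨Set.range fun P : minimalPrimes _ ↦ t P.1 P.2,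
    Set.range_subset_iff.mpr fun P ↦ ht P.1 P.2, Set.finite_range _, fun z hz ↦ ?_⟩
  obtain ⟨y, rfl⟩ := (rees (hypersurface L F) (singularityIdeal L F k)).mem_range_ι
    (U := hypersurfaceAffine L F U) hz
  obtain ⟨P, hP, hPy⟩ := exists_minimalPrime_le (singIdeal F k U) y.asHomogeneousIdeal.toIdeal
    y.isPrime
  exact ⟨t P hP, ⟨⟨P, hP⟩, rfl⟩, htG P hP y hPy⟩

include hG hF in
lemma range_subset_closure_conormalPoints [IsReduced (hypersurface L F)] :
    Set.range G ⊆ closure (conormalPoints k (hypersurfaceι L F)) := by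
  rintro _ ⟨z, rfl⟩
  obtain ⟨⟨U, e, he⟩, hzU⟩ := hL.exists_mem_isFramed (hypersurfaceι L F (blowupSingπ L F k z))
  obtain ⟨T, hT, -, hTz⟩ := exists_finite_generizations F k hL hF hG he
  obtain ⟨t, ht, htz⟩ := hTz z hzU
  exact htz.mem_closed isClosed_closure (subset_closure (hT ht))

include hG hF in
theorem range_eq_closure_conormalPoints [IsReduced (hypersurface L F)] :
    Set.range G = closure (conormalPoints k (hypersurfaceι L F)) := by
  refine Set.Subset.antisymm (range_subset_closure_conormalPoints F k hL hF hG) ?_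
  have := isClosedImmersion_hom F k hL hG
  exact closure_minimal (conormalPoints_subset_range F k hL hG) G.isClosedEmbedding.isClosed_range

end ConormalPoints

end ConormalCycle

namespace ConormalCycle

/-! ### Fundamental cycles of reduced closed subschemes. -/

section FundamentalCycle

/-- The points of a set which have no proper generization in it. -/
def generizationMinimal {T : Type*} [TopologicalSpace T] (S : Set T) : Set T :=
  { p | p ∈ S ∧ ∀ q ∈ S, q ⤳ p → q = p }

lemma closure_mem_irreducibleComponents_iff {T : Type*} [TopologicalSpace T] [QuasiSober T]
    [T0Space T] (z : T) : closure {z} ∈ irreducibleComponents T ↔ ∀ y, y ⤳ z → y = z := by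
  constructor
  · intro h y hy
    have h1 := h.2 (isIrreducible_singleton (x := y)).closure
      hy.closure_subset
    exact (hy.antisymm (specializes_iff_closure_subset.mpr h1)).eq
  · intro h
    obtain ⟨y, hy⟩ := QuasiSober.sober (isIrreducible_irreducibleComponent (x := z))
      isClosed_irreducibleComponent
    have hyz : y = z := h y (hy.specializes mem_irreducibleComponent)
    rw [← hyz, hy.def]
    exact irreducibleComponent_mem_irreducibleComponents z

lemma closure_mem_irreducibleComponents_iff_mem_generizationMinimal {Z P : Scheme.{u}} (j : Z ⟶ P)
    [IsClosedImmersion j] (z : Z) :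
    closure {z} ∈ irreducibleComponents Z ↔ j z ∈ generizationMinimal (Set.range j) := by
  rw [closure_mem_irreducibleComponents_iff]
  have hj := j.isClosedEmbedding
  constructor
  · rintro h
    refine ⟨⟨z, rfl⟩, ?_⟩
    rintro _ ⟨y, rfl⟩ hy
    rw [h y (hj.isInducing.specializes_iff.mp hy)]
  · rintro ⟨-, h⟩ y hy
    exact hj.injective (h _ ⟨y, rfl⟩ (hy.map j.continuous))

lemma isSimpleModule_self_of_isField {R : Type*} [CommRing R] (h : IsField R) :
    IsSimpleModule R R := by
  let := h.toField
  exact inferInstanceAs (IsSimpleModule R R)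

open Classical in
-- The local ring of a reduced scheme at the generic point of a component is a field, of length one.
-- So the cycle depends only on the image of `j`, which reduces the comparison of cycles to one of
-- closed sets.
lemma cycleMultiplicity_eq {Z P : Scheme.{u}} (j : Z ⟶ P) [IsClosedImmersion j] [IsReduced Z]
    (p : P) :
    cycleMultiplicity j p = if p ∈ generizationMinimal (Set.range j) then 1 else 0 := by
  unfold cycleMultiplicity
  split_ifs with h
  · have key : ∀ z : { z : Z // j z = p ∧ closure {z} ∈ irreducibleComponents Z },
        Module.length (Z.presheaf.stalk z.1) (Z.presheaf.stalk z.1) = 1 := fun z ↦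
      Module.length_eq_one_iff.mpr (isSimpleModule_self_of_isField
        (isField_stalk_of_closure_mem_irreducibleComponents Z z.1 z.2.2))
    obtain ⟨z, rfl⟩ := h.1
    have : Nonempty { y : Z // j y = j z ∧ closure {y} ∈ irreducibleComponents Z } :=
      ⟨z, rfl, (closure_mem_irreducibleComponents_iff_mem_generizationMinimal j z).mpr h⟩
    simp only [key, ciSup_const]
  · refine iSup_eq_bot.mpr ?_
    rintro ⟨z, rfl, hz⟩
    exact (h ((closure_mem_irreducibleComponents_iff_mem_generizationMinimal j z).mp hz)).elim

open Classical in
lemma isCycleOf_of_isReduced {Z P : Scheme.{u}} (j : Z ⟶ P) [IsClosedImmersion j] [IsReduced Z]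
    (c : AlgebraicCycle P ℤ)
    (hc : ∀ p, c p = if p ∈ generizationMinimal (Set.range j) then 1 else 0) : IsCycleOf j c := by
  intro p
  refine ⟨if p ∈ generizationMinimal (Set.range j) then 1 else 0, ?_, ?_⟩
  · rw [hc]
    split_ifs <;> rfl
  · rw [cycleMultiplicity_eq]
    split_ifs <;> rfl

end FundamentalCycle

section Reduced

open Scheme

lemma isReduced_subscheme_vanishingIdeal {X : Scheme.{u}} (Z : TopologicalSpace.Closeds X) :
    IsReduced (IdealSheafData.vanishingIdeal Z).subscheme := by
  have (U : X.affineOpens) : _root_.IsReduced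
      (Γ(X, U) ⧸ (IdealSheafData.vanishingIdeal Z).ideal U) := by
    refine (Ideal.isRadical_iff_quotient_reduced _).mp ?_
    exact PrimeSpectrum.isRadical_vanishingIdeal _
  have key (U : X.affineOpens) : IsReduced (Spec (.of
      (Γ(X, U) ⧸ (IdealSheafData.vanishingIdeal Z).ideal U))) := inferInstance
  have (i : (IdealSheafData.vanishingIdeal Z).subschemeCover.openCover.I₀) :
      IsReduced ((IdealSheafData.vanishingIdeal Z).subschemeCover.openCover.X i) :=
    key i
  exact IsReduced.of_openCover _ (IdealSheafData.vanishingIdeal Z).subschemeCover.openCover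

lemma range_subschemeι_vanishingIdeal {X : Scheme.{u}} (Z : TopologicalSpace.Closeds X) :
    Set.range (IdealSheafData.vanishingIdeal Z).subschemeι = Z :=
  (IdealSheafData.range_subschemeι _).trans (IdealSheafData.coe_support_vanishingIdeal Z)

lemma isReduced_proj {A : Type u} {σ : Type*} [CommRing A] [SetLike σ A] [AddSubgroupClass σ A]
    (𝒜 : ℕ → σ) [GradedRing 𝒜] [_root_.IsReduced A] : IsReduced (Proj 𝒜) := by
  have (i : A) : _root_.IsReduced (HomogeneousLocalization.Away 𝒜 i) :=
    isReduced_of_injective (algebraMap _ (Localization.Away i))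
      (HomogeneousLocalization.val_injective _)
  have (i : (Proj.affineOpenCover 𝒜).openCover.I₀) :
      IsReduced ((Proj.affineOpenCover 𝒜).openCover.X i) :=
    inferInstanceAs (IsReduced (Spec (.of (HomogeneousLocalization.Away 𝒜 i.2.1))))
  exact IsReduced.of_openCover _ (Proj.affineOpenCover 𝒜).openCover

lemma isReduced_reesAlgebra {B : Type*} [CommRing B] [_root_.IsReduced B] (J : Ideal B) :
    _root_.IsReduced (reesAlgebra J) := by
  have : _root_.IsReduced (Polynomial B) := ⟨fun p hp ↦ Polynomial.ext fun n ↦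
    ((Polynomial.isNilpotent_iff.mp hp) n).eq_zero⟩
  exact isReduced_of_injective (reesAlgebra J).val Subtype.val_injective

lemma isReduced_blowup {X : Scheme.{u}} [IsReduced X] (𝒥 : X.IdealSheafData) :
    IsReduced (blowup X 𝒥) := by
  have hcov (x : X) : ∃ U : X.AffineZariskiSite, x ∈ U.toOpens := by
    obtain ⟨_, ⟨U, hU, rfl⟩, hxU, -⟩ := X.isBasis_affineOpens.exists_subset_of_mem_open
      (Set.mem_univ x) isOpen_univ
    exact ⟨⟨U, hU⟩, hxU⟩
  have (U : X.AffineZariskiSite) : IsReduced (Proj ((rees X 𝒥).deg U)) := by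
    have : _root_.IsReduced Γ(X, U.toOpens) := inferInstance
    have : _root_.IsReduced (reesAlgebra (𝒥.ideal ⟨U.1, U.2⟩)) :=
      isReduced_reesAlgebra _
    exact isReduced_proj (reesDeg (𝒥.ideal ⟨U.1, U.2⟩))
  have (U : ((rees X 𝒥).coverOfFamily (a := id) hcov).I₀) :
      IsReduced (((rees X 𝒥).coverOfFamily (a := id) hcov).X U) := this U
  exact IsReduced.of_openCover _ ((rees X 𝒥).coverOfFamily (a := id) hcov)

end Reduced

section ConormalPoints

open Scheme

variable {M : Scheme.{u}} {L : M.Modules} (F : Γ(L, ⊤)) (k : Type u) [Field k] [PerfectField k]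
  [M.Over (Spec (.of k))] [Smooth (M ↘ Spec (.of k))] [IsIntegral M]
  (hL : IsLineBundle L) (hF : F ≠ 0)
  {G : blowupSing L F k ⟶ projCotangent k M}
  (hG : ∀ (U : M.AffineZariskiSite) (e : Γ(L, U.toOpens)) (he : IsFrame L _ e)
    (f : Γ(M, U.toOpens)) (hf : resSection L (le_top : U.toOpens ≤ ⊤) F = f • e),
      (rees (hypersurface L F) (singularityIdeal L F k)).ι (hypersurfaceAffine L F U) ≫ G =
        localProjMap F k hL he hf ≫ (symTangent k M).ι U)

include hG hF in
open Classical in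
-- Over a trivializing affine open set, every point of the image is a specialization of a point of
-- the finite set `T`, which itself lies in the image; so a generization-minimal point belongs to
-- `T`, and the support is locally finite.
lemma exists_cycle [IsReduced (hypersurface L F)] : ∃ c : AlgebraicCycle (projCotangent k M) ℤ,
    ∀ p, c p = if p ∈ generizationMinimal (Set.range G) then 1 else 0 := by
  refine ⟨⟨fun p ↦ if p ∈ generizationMinimal (Set.range G) then 1 else 0,
    fun _ _ ↦ trivial, fun p _ ↦ ?_⟩, fun p ↦ rfl⟩
  obtain ⟨⟨U, e, he⟩, hpU⟩ := hL.exists_mem_isFramed ((symTangent k M).toBase p)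
  obtain ⟨T, hT, hTf, hTz⟩ := exists_finite_generizations F k hL hF hG he
  refine ⟨(symTangent k M).toBase ⁻¹' U.toOpens,
    ((symTangent k M).toBase ⁻¹ᵁ U.toOpens).2.mem_nhds hpU, hTf.subset ?_⟩
  rintro q ⟨hqU, hq⟩
  have hq : q ∈ generizationMinimal (Set.range G) := by
    by_contra h
    exact hq (if_neg h)
  obtain ⟨z, rfl⟩ := hq.1
  obtain ⟨t, ht, htz⟩ := hTz z (by
    have h1 : (symTangent k M).toBase (G z) = hypersurfaceι L F (blowupSingπ L F k z) :=
      congr($(hom_toBase F k hL hG) z)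
    exact h1 ▸ hqU)
  exact hq.2 t (conormalPoints_subset_range F k hL hG (hT ht)) htz ▸ ht

end ConormalPoints

end ConormalCycle

theorem mainTheorem7 {k : Type u} [Field k] [IsAlgClosed k] [CharZero k]
    (M : Scheme.{u}) [M.Over (Spec (.of k))] [Smooth (M ↘ Spec (.of k))]
    [IsSeparated (M ↘ Spec (.of k))] [QuasiCompact (M ↘ Spec (.of k))] [IsIntegral M]
    (L : M.Modules) (hL : ConormalCycle.IsLineBundle L) (F : Γ(L, ⊤)) (hF : F ≠ 0)
    (hX : IsReduced (ConormalCycle.hypersurface L F)) :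
    ∃ j : ConormalCycle.blowupSing L F k ⟶ ConormalCycle.projCotangentRestrict L F k,
      IsClosedImmersion j ∧
      j ≫ ConormalCycle.projCotangentRestrictπ L F k = ConormalCycle.blowupSingπ L F k ∧
      ConormalCycle.IsInducedByDifferential L F k j ∧
      ∃ c : AlgebraicCycle (ConormalCycle.projCotangent k M) ℤ,
        ConormalCycle.IsCycleOf
          (ConormalCycle.projConormalι k (ConormalCycle.hypersurfaceι L F)) c ∧
        ConormalCycle.IsCycleOf (j ≫ ConormalCycle.restrictToProjCotangent L F k) c := by
  classical
  obtain ⟨G, hG⟩ := ConormalCycle.exists_blowupSing_hom F k hL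
  have := ConormalCycle.isClosedImmersion_hom F k hL hG
  obtain ⟨c, hc⟩ := ConormalCycle.exists_cycle F k hL hF hG
  -- Both subschemes are reduced, so equality of their underlying sets lets the single cycle `c`
  -- serve for both.
  have hS : Set.range (ConormalCycle.projConormalι k (ConormalCycle.hypersurfaceι L F)) =
      Set.range G :=
    (ConormalCycle.range_subschemeι_vanishingIdeal _).trans
      (ConormalCycle.range_eq_closure_conormalPoints F k hL hF hG).symm
  refine ⟨ConormalCycle.liftRestrict F k hL hG, ConormalCycle.isClosedImmersion_liftRestrict ..,
    ConormalCycle.liftRestrict_projCotangentRestrictπ ..,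
    ConormalCycle.isInducedByDifferential_liftRestrict F k hL hG, c, ?_, ?_⟩
  · have : IsReduced (ConormalCycle.projConormal k (ConormalCycle.hypersurfaceι L F)) :=
      ConormalCycle.isReduced_subscheme_vanishingIdeal _
    have : IsClosedImmersion
        (ConormalCycle.projConormalι k (ConormalCycle.hypersurfaceι L F)) :=
      inferInstanceAs (IsClosedImmersion (Scheme.IdealSheafData.subschemeι _))
    exact ConormalCycle.isCycleOf_of_isReduced _ c fun p ↦ by rw [hS, hc]
  · have : IsReduced (ConormalCycle.blowupSing L F k) := ConormalCycle.isReduced_blowup _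
    rw [ConormalCycle.liftRestrict_restrictToProjCotangent F k hL hG]
    exact ConormalCycle.isCycleOf_of_isReduced G c hc
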